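/- Let $0<\rho_1<\rho_2$ and $\theta_1,\theta_2\in\mathbb{R}$, and put $s=\rho_2+\rho_1$, $d=\rho_2-\rho_1$, $L=\pi/(sd)$, $\omega=2\pi/L=2sd$, $\vartheta(t)=\omega t+\theta_2-\theta_1$, $S_k=\sinh(2\rho_kx)$, $C_k=\cosh(2\rho_kx)$, $C=\cosh(2(\rho_1+\rho_2)x)$. Let $$\Delta=2\rho_1\rho_2\cos\vartheta(t)-(\rho_1^2+\rho_2^2)C+(\rho_1+\rho_2)^2S_1S_2 ,$$ $$a^{(0)}(x,t)=\rho_1\rho_2\,\frac{(\rho_1+\rho_2)^2S_1S_2+\rho_1^2e^{-i\vartheta(t)}+\rho_2^2e^{i\vartheta(t)}-2\rho_1\rho_2C}{\Delta},$$ $$a^{(1)}(x,t)=i\,\frac{(\rho_1^2-\rho_2^2)\rho_1C_2S_1+(\rho_2^2-\rho_1^2)\rho_2C_1S_2}{\Delta},$$ $$a(x,t,\lambda)=\bigl(\lambda^2+a^{(1)}(x,t)\lambda+a^{(0)}(x,t)\bigr)e^{-2i(\lambda x+\lambda^2t)} .$$ These are solutions of $i\partial_tf+\frac12\partial_x^2f-V_0f=0$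 for the even, $L$-periodic two-soliton potential $V_0(x,t)$ with discrete data $\lambda_k=i\rho_k$, $g^{(k)}=e^{i\theta_k}$, $k=1,2$. Define for real $\lambda$ the dispersive modes $$\Psi_{\rm d}(x,\lambda)=\frac{a(x,0,\lambda)}{\sqrt{\pi(\lambda^2+\rho_1^2)(\lambda^2+\rho_2^2)}},\qquad \Psi^{\rm (e)}_{\rm d}(x,\lambda)=\frac{a(x,0,\lambda)+a(x,0,-\lambda)}{\sqrt{2\pi(\lambda^2+\rho_1^2)(\lambda^2+\rho_2^2)}},\qquad \Psi^{\rm (o)}_{\rm d}(x,\lambda)=\frac{a(x,0,\lambda)-a(x,0,-\lambda)}{\sqrt{2\pi(\lambda^2+\rho_1^2)(\lambda^2+\rho_2^2)}},$$ and the bound states $$\Psi^{\rm (e)}_{\rm b}(x)=\frac1{\sqrt{4(\rho_1+\rho_2)}}\Bigl[\frac{2}{\rho_1-\rho_2}e^{i\theta_1}a(x,0,-i\rho_1)+\frac{2}{\rho_2-\rho_1}e^{i\theta_2}a(x,0,-i\rho_2)\Bigr],$$ $$\Psi^{\rm (o)}_{\rm b}(x)=\frac1{\sqrt{4(\rho_1+\rho_2)}}\Bigl[\sqrt{\frac{\rho_2}{\rho_1}}\,\frac{2}{\rho_1-\rho_2}e^{i\theta_1}a(x,0,-i\rho_1)+\sqrt{\frac{\rho_1}{\rho_2}}\,\frac{2}{\rho_2-\rho_1}e^{i\theta_2}a(x,0,-i\rho_2)\Bigr].$$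 Let $\beta_{\rm b}>0$ satisfy $e^{2i\beta_{\rm b}L}=e^{2i\rho_1^2L}$. The Floquet generator $\mathcal B$ is the self-adjoint operator on $L^2(\mathbb{R})$ with eigenvalue $-2\beta_{\rm b}$ on the bound states that acts as multiplication by $2\lambda^2$ in the dispersive modes, so that, with $\langle g,f\rangle=\int g^*f\,dx$, $$e^{-it\mathcal B}f=e^{2i\beta_{\rm b}t}\sum_{\alpha={\rm e},{\rm o}}\langle\Psi_{\rm b}^{(\alpha)},f\rangle\Psi_{\rm b}^{(\alpha)}+\int_{-\infty}^{\infty}e^{-2i\lambda^2t}\langle\Psi_{\rm d}(\cdot,\lambda),f\rangle\Psi_{\rm d}(\cdot,\lambda)\,d\lambda ,$$ and the projections onto the even and odd parts of its continuous spectral subspace are $$\mathcal P_{\rm c}^{\rm (e,o)}f=\int_0^\infty\langle\Psi_{\rm d}^{\rm (e,o)}(\cdot,\lambda),f\rangle\,\Psi_{\rm d}^{\rm (e,o)}(\cdot,\lambda)\,d\lambda ;$$ the integrals in $\lambda$ and those defining $\langle\Psi_{\rm d}(\cdot,\lambda),f\rangle$ and $\langle\Psi_{\rm d}^{\rm (e,o)}(\cdot,\lambda),f\rangle$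 are limits in $L^2$ of integrals over bounded intervals. Write $\langle x\rangle=(1+x^2)^{1/2}$. Fix $\sigma>5/2$. Then there are constants $L^{\rm (e)},L^{\rm (o)}>0$ such that for all $f\in L^2(\mathbb{R})$ with $\langle\cdot\rangle^{\sigma}f\in L^2(\mathbb{R})$ and all $t\in\mathbb{R}$ the functions below are defined and $$\|\langle\cdot\rangle^{-\sigma}e^{-it\mathcal B}\mathcal P_{\rm c}^{\rm (e)}f\|_2\le L^{\rm (e)}\langle t\rangle^{-1/2}\|\langle\cdot\rangle^{\sigma}f\|_2,\qquad \|\langle\cdot\rangle^{-\sigma}e^{-it\mathcal B}\mathcal P_{\rm c}^{\rm (o)}f\|_2\le L^{\rm (o)}\langle t\rangle^{-3/2}\|\langle\cdot\rangle^{\sigma}f\|_2 .$$ -/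

import Mathlib

open MeasureTheory Filter
open scoped Topology ComplexConjugate

noncomputable section

/-- The weight `⟨x⟩ = (1 + x ^ 2) ^ (1 / 2)`. -/
def japaneseBracket (x : ℝ) : ℝ := Real.sqrt (1 + x ^ 2)

/-- `F` is the limit in `L²(μ)` of the family `φ R` as `R → ∞`. -/
def IsL2Limit (μ : Measure ℝ) (φ : ℝ → ℝ → ℂ) (F : ℝ → ℂ) : Prop :=
  MemLp F 2 μ ∧ Tendsto (fun R : ℝ => eLpNorm (fun x => φ R x - F x) 2 μ) atTop (𝓝 0)

/-- The scalar product `⟨g, f⟩ = ∫ g(x)^* f(x) dx` of `L²(ℝ)`. -/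
def l2Inner (g f : ℝ → ℂ) : ℂ := ∫ x : ℝ, conj (g x) * f x

/-- Given a family of modes `Ψ x ξ`, the function `F` on the set `S` of spectral parameters is
the transform `ξ ↦ ⟨Ψ(·, ξ), f⟩` of `f ∈ L²(ℝ)`: the integral over `ℝ` is improper, taken in the
sense of `L²(S)`, as for the Fourier transform. -/
def IsModeTransform (Ψ : ℝ → ℝ → ℂ) (S : Set ℝ) (f F : ℝ → ℂ) : Prop :=
  IsL2Limit (volume.restrict S) (fun R ξ => ∫ y in (-R)..R, conj (Ψ y ξ) * f y) F

/-- The discrete data of an even two-soliton periodic potential: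
`λ₁ = i ρ₁`, `λ₂ = i ρ₂`, `g⁽¹⁾ = exp (i θ₁)`, `g⁽²⁾ = exp (i θ₂)`, with `0 < ρ₁ < ρ₂`. -/
structure TwoSolitonData where
  ρ₁ : ℝ
  ρ₂ : ℝ
  θ₁ : ℝ
  θ₂ : ℝ
  ρ₁_pos : 0 < ρ₁
  ρ₁_lt_ρ₂ : ρ₁ < ρ₂

namespace TwoSolitonData

variable (D : TwoSolitonData)

/-- The period `L = π / (s d)` of the potential, where `s = ρ₂ + ρ₁` and `d = ρ₂ - ρ₁`. -/
def period : ℝ := Real.pi / ((D.ρ₂ + D.ρ₁) * (D.ρ₂ - D.ρ₁))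

/-- The frequency `ω = 2 π / L`. -/
def freq : ℝ := 2 * Real.pi / D.period

/-- The phase `ω t + (θ₂ - θ₁)`. -/
def phase (t : ℝ) : ℝ := D.freq * t + (D.θ₂ - D.θ₁)

/-- The common denominator of the two coefficient functions below. It never vanishes. -/
def denom (x t : ℝ) : ℝ :=
  2 * D.ρ₁ * D.ρ₂ * Real.cos (D.phase t)
    - (D.ρ₁ ^ 2 + D.ρ₂ ^ 2) * Real.cosh (2 * (D.ρ₁ + D.ρ₂) * x)
    + (D.ρ₁ + D.ρ₂) ^ 2 * (Real.sinh (2 * D.ρ₁ * x) * Real.sinh (2 * D.ρ₂ * x))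

/-- The coefficient `a⁽⁰⁾(x, t)`. -/
def a0 (x t : ℝ) : ℂ :=
  (D.ρ₁ : ℂ) * D.ρ₂ *
    (((D.ρ₁ + D.ρ₂) ^ 2 * (Real.sinh (2 * D.ρ₁ * x) * Real.sinh (2 * D.ρ₂ * x)) : ℝ)
      + (D.ρ₁ : ℂ) ^ 2 * Complex.exp (-Complex.I * D.phase t)
      + (D.ρ₂ : ℂ) ^ 2 * Complex.exp (Complex.I * D.phase t)
      - (2 * D.ρ₁ * D.ρ₂ * Real.cosh (2 * (D.ρ₁ + D.ρ₂) * x) : ℝ))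
    / (D.denom x t : ℂ)

/-- The coefficient `a⁽¹⁾(x, t)`. -/
def a1 (x t : ℝ) : ℂ :=
  Complex.I *
    (((D.ρ₁ ^ 2 - D.ρ₂ ^ 2) * D.ρ₁ * (Real.cosh (2 * D.ρ₂ * x) * Real.sinh (2 * D.ρ₁ * x))
      + (D.ρ₂ ^ 2 - D.ρ₁ ^ 2) * D.ρ₂ * (Real.cosh (2 * D.ρ₁ * x) * Real.sinh (2 * D.ρ₂ * x)) : ℝ) : ℂ)
    / (D.denom x t : ℂ)

/-- The solution
`a(x, t, ξ) = (ξ² + a⁽¹⁾(x, t) ξ + a⁽⁰⁾(x, t)) exp (-2 i (ξ x + ξ² t))`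
of the linear Schrödinger equation with the two-soliton potential. -/
def a (x t : ℝ) (ξ : ℂ) : ℂ :=
  (ξ ^ 2 + D.a1 x t * ξ + D.a0 x t) *
    Complex.exp (-2 * Complex.I * (ξ * (x : ℂ) + ξ ^ 2 * (t : ℂ)))

/-- The dispersive modes `Ψ_d(x, t, ξ)`, for real `ξ`. -/
def dispersive (t x ξ : ℝ) : ℂ :=
  D.a x t ξ / (Real.sqrt (Real.pi * ((ξ ^ 2 + D.ρ₁ ^ 2) * (ξ ^ 2 + D.ρ₂ ^ 2))) : ℂ)

/-- The even dispersive modes `Ψ_d^(e)(x, t, ξ)`, for `ξ ≥ 0`. -/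
def dispersiveEven (t x ξ : ℝ) : ℂ :=
  (D.a x t ξ + D.a x t (-ξ)) /
    (Real.sqrt (2 * Real.pi * ((ξ ^ 2 + D.ρ₁ ^ 2) * (ξ ^ 2 + D.ρ₂ ^ 2))) : ℂ)

/-- The odd dispersive modes `Ψ_d^(o)(x, t, ξ)`, for `ξ ≥ 0`. -/
def dispersiveOdd (t x ξ : ℝ) : ℂ :=
  (D.a x t ξ - D.a x t (-ξ)) /
    (Real.sqrt (2 * Real.pi * ((ξ ^ 2 + D.ρ₁ ^ 2) * (ξ ^ 2 + D.ρ₂ ^ 2))) : ℂ)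

/-- The normalized even bound state `Ψ_b^(e)(x, t)`, a combination of `a(x, t, λ₁^*)` and
`a(x, t, λ₂^*)`. The factors `exp (i θ_k)` make it even for all values of the phases. -/
def boundEven (t x : ℝ) : ℂ :=
  (1 / Real.sqrt (4 * (D.ρ₁ + D.ρ₂)) : ℝ) *
    ((2 / (D.ρ₁ - D.ρ₂) : ℝ) *
        (Complex.exp (Complex.I * D.θ₁) * D.a x t (-Complex.I * D.ρ₁))
      + (2 / (D.ρ₂ - D.ρ₁) : ℝ) *
        (Complex.exp (Complex.I * D.θ₂) * D.a x t (-Complex.I * D.ρ₂)))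

/-- The normalized odd bound state `Ψ_b^(o)(x, t)`. -/
def boundOdd (t x : ℝ) : ℂ :=
  (1 / Real.sqrt (4 * (D.ρ₁ + D.ρ₂)) : ℝ) *
    ((Real.sqrt (D.ρ₂ / D.ρ₁) * (2 / (D.ρ₁ - D.ρ₂)) : ℝ) *
        (Complex.exp (Complex.I * D.θ₁) * D.a x t (-Complex.I * D.ρ₁))
      + (Real.sqrt (D.ρ₁ / D.ρ₂) * (2 / (D.ρ₂ - D.ρ₁)) : ℝ) *
        (Complex.exp (Complex.I * D.θ₂) * D.a x t (-Complex.I * D.ρ₂)))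

/-- `β > 0` is a choice of the Floquet exponent of the bound states: `exp (2 i β L)` is their
Floquet multiplier `exp (2 i ρ₁² L) = exp (2 i ρ₂² L)`. -/
def IsFloquetExponent (β : ℝ) : Prop :=
  0 < β ∧ Complex.exp (2 * Complex.I * β * D.period)
    = Complex.exp (2 * Complex.I * (D.ρ₁ : ℂ) ^ 2 * D.period)

/-- `u = φ(B) f`, where `B` is the Floquet generator: the self-adjoint operator on `L²(ℝ)` that
has the eigenvalue `-2 β` on the bound states at `t = 0` and is multiplication by `2 ξ²` in the
dispersive modes at `t = 0`. Thus
`φ(B) f = φ(-2 β) ∑_b ⟨Ψ_b, f⟩ Ψ_b + ∫_ℝ φ(2 ξ²) ⟨Ψ_d(·, 0, ξ), f⟩ Ψ_d(·, 0, ξ) dξ`,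
with the integral over `ξ` improper in the sense of `L²(ℝ)`; `φ(s) = s` gives `B` itself. -/
def IsFunctionOfB (β : ℝ) (φ : ℝ → ℂ) (f u : ℝ → ℂ) : Prop :=
  ∃ F : ℝ → ℂ, IsModeTransform (D.dispersive 0) Set.univ f F ∧
    IsL2Limit volume
      (fun R x =>
        φ (-2 * β) * (l2Inner (D.boundEven 0) f * D.boundEven 0 x
            + l2Inner (D.boundOdd 0) f * D.boundOdd 0 x)
          + ∫ ξ in (-R)..R, φ (2 * ξ ^ 2) * F ξ * D.dispersive 0 x ξ)
      u

/-- `u = exp (-i t B) f`. -/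
def IsFloquetEvolution (β t : ℝ) (f u : ℝ → ℂ) : Prop :=
  D.IsFunctionOfB β (fun s : ℝ => Complex.exp (-Complex.I * t * s)) f u

/-- `g = P_c^(e) f = ∫_0^∞ ⟨Ψ_d^(e)(·, 0, ξ), f⟩ Ψ_d^(e)(·, 0, ξ) dξ`: the projection onto the
even part of the continuous spectral subspace of `B`. -/
def IsEvenContinuousProjection (f g : ℝ → ℂ) : Prop :=
  ∃ F : ℝ → ℂ, IsModeTransform (D.dispersiveEven 0) (Set.Ioi 0) f F ∧
    IsL2Limit volume (fun R x => ∫ ξ in (0 : ℝ)..R, F ξ * D.dispersiveEven 0 x ξ) g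

/-- `g = P_c^(o) f = ∫_0^∞ ⟨Ψ_d^(o)(·, 0, ξ), f⟩ Ψ_d^(o)(·, 0, ξ) dξ`: the projection onto the
odd part of the continuous spectral subspace of `B`. -/
def IsOddContinuousProjection (f g : ℝ → ℂ) : Prop :=
  ∃ F : ℝ → ℂ, IsModeTransform (D.dispersiveOdd 0) (Set.Ioi 0) f F ∧
    IsL2Limit volume (fun R x => ∫ ξ in (0 : ℝ)..R, F ξ * D.dispersiveOdd 0 x ξ) g

end TwoSolitonData

/-- The weighted function `⟨x⟩^s f(x)`. -/
def weighted (s : ℝ) (f : ℝ → ℂ) : ℝ → ℂ := fun x => ((japaneseBracket x ^ s : ℝ) : ℂ) * f x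

end

/-! The modes are dressed plane waves. At `t = 0` the mode `a(x, 0, ξ)` equals `(ξ + iρ₁)(ξ + iρ₂)
e^{-2iξx} (1 + r₁(x)/(ξ + iρ₁) + r₂(x)/(ξ + iρ₂))`, with bounded `r₁, r₂` built from a Hermitian 2×2
matrix `G(x)`, the inverse Gram matrix of the double commutation method. For a free wave `h`, let
`h_k` be its quotient by `ξ + iρ_k` on the Fourier side; then `h_k' = -2i h - 2ρ_k h_k`. A Riccati
equation for `G` makes `conj g · h - conj (g + r₁g₁ + r₂g₂) · (h + r₁h₁ + r₂h₂)` the exact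
derivative of the form of `G` in `(g₁, g₂)`, `(h₁, h₂)` (`hasDerivAt_gram_form`). Boundary terms
vanish by the Riemann–Lebesgue lemma, so dressing preserves inner products, and Plancherel gives
orthonormality of the dispersive modes (`integral_conj_synthesis_mul`). The bound states are the
dressings of `g = 0`, `g_k = κ_k e^{-2ρ_k x}`; the same identity makes them orthogonal to the
continuous subspace.

Orthonormality suffices; completeness of the modes is not needed. Superposition of modes extends to
an isometry of `L²`, its adjoint is the mode transform, and a superposition has its own amplitude as
transform. Hence `P_c f` exists, has no bound component, and `exp(-itB)` multiplies its amplitude by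
`e^{-2itξ²}`.

Decay is a stationary phase estimate for `∫_0^R e^{-2itξ²} Ψ(x, ξ) conj Ψ(y, ξ) dξ`, uniform in
large `R`. Two derivatives of the amplitude in `ξ` cost `⟨x⟩²⟨y⟩²`. Put `δ = |t|^{-1/2}`; a trivial
bound on `[0, δ]` and two integrations by parts beyond it give `O(δ)`. Each odd mode vanishes at `ξ
= 0`, so the odd amplitude vanishes to second order there and the bound improves to `O(δ³)`. The
growth `⟨x⟩²⟨y⟩²` is absorbed in `L²` by the weights because `⟨x⟩^{2-σ}` is square integrable for `σ
> 5/2`. For `|t| ≤ 1` boundedness on `L²` is enough. -/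

/-! ### Plancherel and Riemann–Lebesgue for the kernel `e^{-2iξx}` -/

open scoped FourierTransform in
/-- On `L¹ ∩ L²` the Fourier transform of `L²` is given by the Fourier integral. -/
theorem coeFn_fourier_toLp_ae_eq {F : ℝ → ℂ} (h1 : Integrable F) (h2 : MemLp F 2 volume) :
    (𝓕 (h2.toLp F) : Lp ℂ 2 (volume : Measure ℝ)) =ᵐ[volume] 𝓕 F := by
  refine ae_eq_of_integral_contDiff_smul_eq
    ((Lp.memLp _).locallyIntegrable (by norm_num)) ?_ ?_
  · refine Continuous.locallyIntegrable ?_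
    exact VectorFourier.fourierIntegral_continuous Real.continuous_fourierChar
      (by exact continuous_inner) h1
  · intro g hg hgc
    have hg1 : HasCompactSupport (fun x => (g x : ℂ)) := hgc.comp_left (g := ((↑) : ℝ → ℂ)) rfl
    have hg2 : ContDiff ℝ (⊤ : ℕ∞) (fun x => (g x : ℂ)) := Complex.ofRealCLM.contDiff.comp hg
    set G : SchwartzMap ℝ ℂ := hg1.toSchwartzMap hg2 with hG
    have hGx : ∀ x, G x = (g x : ℂ) := fun x => rfl
    -- The transforms on `L²` and on tempered distributions agree; paired with a test function, both
    -- sides become the integral of `F` against the Fourier transform of that function.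
    have key := DFunLike.congr_fun (Lp.fourier_toTemperedDistribution_eq (h2.toLp F)) G
    rw [TemperedDistribution.fourier_apply, Lp.toTemperedDistribution_apply,
      Lp.toTemperedDistribution_apply] at key
    have e1 : ∀ x, g x • (𝓕 (h2.toLp F) : Lp ℂ 2 (volume : Measure ℝ)) x
        = G x • (𝓕 (h2.toLp F) : Lp ℂ 2 (volume : Measure ℝ)) x := by
      intro x; rw [hGx]; simp
    have e2 : ∀ x, g x • 𝓕 F x = 𝓕 F x • G x := by
      intro x; rw [hGx]; simp [mul_comm]
    simp_rw [e1, e2]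
    rw [← key]
    have fl := VectorFourier.integral_fourierIntegral_smul_eq_flip (μ := (volume : Measure ℝ))
      (ν := (volume : Measure ℝ)) (L := innerₗ ℝ) (f := F) (g := G) Real.continuous_fourierChar
      (by exact continuous_inner) h1 G.integrable
    refine Eq.trans ?_ fl.symm
    refine integral_congr_ae ?_
    filter_upwards [h2.coeFn_toLp] with x hx
    rw [hx, smul_eq_mul, smul_eq_mul, mul_comm]
    congr 1
    rw [SchwartzMap.fourier_coe, flip_innerₗ]
    rfl

/-- The Fourier transform with the kernel `exp (-2 i ξ x)`. -/
noncomputable def expFourier (F : ℝ → ℂ) (x : ℝ) : ℂ :=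
  ∫ ξ : ℝ, F ξ * Complex.exp (-2 * Complex.I * (ξ * x))

open scoped FourierTransform in
theorem expFourier_eq (F : ℝ → ℂ) (x : ℝ) : expFourier F x = 𝓕 F (x / Real.pi) := by
  rw [Real.fourier_real_eq_integral_exp_smul, expFourier]
  refine integral_congr_ae (Eventually.of_forall fun ξ => ?_)
  simp only [smul_eq_mul]
  rw [mul_comm]
  congr 2
  have := Real.pi_ne_zero
  have h : (-2 * Real.pi * ξ * (x / Real.pi) : ℝ) = -2 * (ξ * x) := by field_simp
  rw [h]; push_cast; ring

theorem tendsto_div_pi_cocompact :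
    Tendsto (fun x : ℝ => x / Real.pi) (cocompact ℝ) (cocompact ℝ) :=
  (Homeomorph.mulRight₀ (Real.pi)⁻¹ (inv_ne_zero Real.pi_ne_zero)).isClosedEmbedding.tendsto_cocompact

theorem tendsto_expFourier_cocompact (F : ℝ → ℂ) :
    Tendsto (expFourier F) (cocompact ℝ) (𝓝 0) := by
  have := (Real.zero_at_infty_fourier F).comp tendsto_div_pi_cocompact
  refine this.congr fun x => ?_
  simp [expFourier_eq]

theorem continuous_expFourier {F : ℝ → ℂ} (h1 : Integrable F) : Continuous (expFourier F) := by
  have : Continuous (FourierTransform.fourier F : ℝ → ℂ) :=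
    VectorFourier.fourierIntegral_continuous Real.continuous_fourierChar
      (by exact continuous_inner) h1
  have h2 := this.comp (continuous_id.div_const Real.pi)
  refine h2.congr fun x => ?_
  simp [expFourier_eq]

open scoped FourierTransform in
theorem memLp_fourier {F : ℝ → ℂ} (h1 : Integrable F) (h2 : MemLp F 2 volume) :
    MemLp (𝓕 F) 2 volume :=
  (memLp_congr_ae (coeFn_fourier_toLp_ae_eq h1 h2)).1 (Lp.memLp _)

open scoped FourierTransform in
theorem integral_conj_fourier_mul {F G : ℝ → ℂ} (hF1 : Integrable F) (hF2 : MemLp F 2 volume)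
    (hG1 : Integrable G) (hG2 : MemLp G 2 volume) :
    ∫ x, conj (𝓕 F x) * 𝓕 G x = ∫ ξ, conj (F ξ) * G ξ := by
  have key := Lp.inner_fourier_eq (hF2.toLp F) (hG2.toLp G)
  rw [L2.inner_def, L2.inner_def] at key
  refine Eq.trans ?_ (key.trans ?_)
  · refine integral_congr_ae ?_
    filter_upwards [coeFn_fourier_toLp_ae_eq hF1 hF2, coeFn_fourier_toLp_ae_eq hG1 hG2]
      with x hx hy
    rw [hx, hy]; simp [mul_comm]
  · refine integral_congr_ae ?_
    filter_upwards [hF2.coeFn_toLp, hG2.coeFn_toLp] with x hx hy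
    rw [hx, hy]; simp [mul_comm]

theorem memLp_expFourier {F : ℝ → ℂ} (h1 : Integrable F) (h2 : MemLp F 2 volume) :
    MemLp (expFourier F) 2 volume := by
  rw [memLp_two_iff_integrable_sq_norm (continuous_expFourier h1).aestronglyMeasurable]
  have := ((memLp_fourier h1 h2).integrable_norm_pow (by norm_num)).comp_div Real.pi_ne_zero
  refine this.congr (Eventually.of_forall fun x => ?_)
  simp [expFourier_eq]

/-- The kernel `e^{-2iξx}` is the unitary one evaluated at `x / π`, which costs a factor `π`. The
`1/√π` in the normalization of the modes cancels it. -/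
theorem integral_conj_expFourier_mul {F G : ℝ → ℂ} (hF1 : Integrable F) (hF2 : MemLp F 2 volume)
    (hG1 : Integrable G) (hG2 : MemLp G 2 volume) :
    ∫ x, conj (expFourier F x) * expFourier G x = Real.pi * ∫ ξ, conj (F ξ) * G ξ := by
  simp_rw [expFourier_eq]
  rw [Measure.integral_comp_div (fun x => conj (FourierTransform.fourier F x)
    * FourierTransform.fourier G x) Real.pi, integral_conj_fourier_mul hF1 hF2 hG1 hG2,
    abs_of_pos Real.pi_pos]
  simp

theorem hasDerivAt_expFourier {F : ℝ → ℂ} (h1 : Integrable F)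
    (h2 : Integrable (fun ξ : ℝ => (ξ : ℂ) * F ξ)) (x : ℝ) :
    HasDerivAt (expFourier F) (-2 * Complex.I * expFourier (fun ξ : ℝ => (ξ : ℂ) * F ξ) x) x := by
  have key := hasDerivAt_integral_of_dominated_loc_of_deriv_le (μ := (volume : Measure ℝ))
    (F := fun (x : ℝ) (ξ : ℝ) => F ξ * Complex.exp (-2 * Complex.I * (ξ * x)))
    (F' := fun (x : ℝ) (ξ : ℝ) => -2 * Complex.I * ((ξ : ℂ) * F ξ
      * Complex.exp (-2 * Complex.I * (ξ * x)))) (x₀ := x) (s := Set.univ)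
    (bound := fun ξ => 2 * ‖(ξ : ℂ) * F ξ‖) univ_mem ?_ ?_ ?_ ?_ ?_ ?_
  · have := key.2
    rw [integral_const_mul] at this
    exact this
  · refine Eventually.of_forall fun y => ?_
    exact h1.aestronglyMeasurable.mul (by fun_prop)
  · refine h1.mul_bdd (c := 1) (by fun_prop) (Eventually.of_forall fun ξ => ?_)
    rw [Complex.norm_exp]; simp
  · exact (h2.aestronglyMeasurable.mul (by fun_prop)).const_mul _
  · refine Eventually.of_forall fun ξ y _ => ?_
    rw [norm_mul, norm_mul (_ * _) (Complex.exp _), Complex.norm_exp]; simp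
  · exact h2.norm.const_mul 2
  · refine Eventually.of_forall fun ξ y _ => ?_
    have h : HasDerivAt (fun y : ℝ => -2 * Complex.I * ((ξ : ℂ) * (y : ℂ)))
        (-2 * Complex.I * ((ξ : ℂ) * 1)) y :=
      ((Complex.ofRealCLM.hasDerivAt (x := y)).const_mul (ξ : ℂ)).const_mul _
    exact ((h.cexp).const_mul (F ξ)).congr_deriv (by ring)

/-! ### Dressing matrix and the algebraic form of the modes at `t = 0` -/

namespace TwoSolitonData

variable (D : TwoSolitonData)

theorem ρ₂_pos : 0 < D.ρ₂ := D.ρ₁_pos.trans D.ρ₁_lt_ρ₂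

/-- `exp (i (θ₂ - θ₁))`. -/
noncomputable def phaseFactor : ℂ := Complex.exp (Complex.I * (D.θ₂ - D.θ₁ : ℝ))

theorem phaseFactor_ne_zero : D.phaseFactor ≠ 0 := Complex.exp_ne_zero _

theorem norm_phaseFactor : ‖D.phaseFactor‖ = 1 := by
  rw [phaseFactor, mul_comm, Complex.norm_exp_ofReal_mul_I]

theorem conj_phaseFactor : conj D.phaseFactor = D.phaseFactor⁻¹ := by
  rw [Complex.inv_def, Complex.normSq_eq_norm_sq, norm_phaseFactor]; simp

theorem phase_zero : D.phase 0 = D.θ₂ - D.θ₁ := by simp [phase]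

theorem cos_phase_zero :
    ((Real.cos (D.phase 0) : ℝ) : ℂ) = (D.phaseFactor + D.phaseFactor⁻¹) / 2 := by
  rw [phase_zero, phaseFactor, ← Complex.exp_neg, Complex.ofReal_cos, Complex.cos]
  congr 3 <;> ring_nf

/-- `-exp (2 (ρ₁ + ρ₂) x) Δ(x, 0)`, as a polynomial in `X = exp (2 ρ₁ x)` and
`Y = exp (2 ρ₂ x)`. -/
noncomputable def gramDet (x : ℝ) : ℝ :=
  (D.ρ₂ - D.ρ₁) ^ 2 / 4 * (Real.exp (2 * D.ρ₁ * x) ^ 2 * Real.exp (2 * D.ρ₂ * x) ^ 2 + 1)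
    + (D.ρ₂ + D.ρ₁) ^ 2 / 4 * (Real.exp (2 * D.ρ₁ * x) ^ 2 + Real.exp (2 * D.ρ₂ * x) ^ 2)
    - 2 * D.ρ₁ * D.ρ₂ * Real.cos (D.phase 0)
      * (Real.exp (2 * D.ρ₁ * x) * Real.exp (2 * D.ρ₂ * x))

/-- With `X = e^{2ρ₁x}`, `Y = e^{2ρ₂x}` and `c` the cosine, the difference of the two sides is `ρ₁ρ₂
(X - Y)² + 2ρ₁ρ₂ XY (1 - c) ≥ 0`. The lower bound is a product, so it separates `X` from `Y`, and it
does not degenerate for any phase because `ρ₁ ≠ ρ₂`. -/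
theorem gramDet_lower_bound (x : ℝ) :
    (D.ρ₂ - D.ρ₁) ^ 2 / 4 * ((1 + Real.exp (2 * D.ρ₁ * x) ^ 2)
      * (1 + Real.exp (2 * D.ρ₂ * x) ^ 2)) ≤ D.gramDet x := by
  have h1 := D.ρ₁_pos
  have h2 := D.ρ₂_pos
  have h3 := Real.cos_le_one (D.phase 0)
  have hX := Real.exp_pos (2 * D.ρ₁ * x)
  have hY := Real.exp_pos (2 * D.ρ₂ * x)
  rw [gramDet]
  set X := Real.exp (2 * D.ρ₁ * x)
  set Y := Real.exp (2 * D.ρ₂ * x)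
  set c := Real.cos (D.phase 0)
  have h4 : 0 ≤ D.ρ₁ * D.ρ₂ * (X - Y) ^ 2 := by positivity
  have h5 : 0 ≤ D.ρ₁ * D.ρ₂ * (X * Y) * (1 - c) := by
    have : 0 ≤ 1 - c := by linarith
    positivity
  nlinarith

theorem gramDet_pos (x : ℝ) : 0 < D.gramDet x := by
  refine lt_of_lt_of_le ?_ (D.gramDet_lower_bound x)
  have : 0 < D.ρ₂ - D.ρ₁ := sub_pos.2 D.ρ₁_lt_ρ₂
  positivity

theorem denom_zero_eq (x : ℝ) : D.denom x 0 =
    -D.gramDet x / (Real.exp (2 * D.ρ₁ * x) * Real.exp (2 * D.ρ₂ * x)) := by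
  have hX := (Real.exp_pos (2 * D.ρ₁ * x)).ne'
  have hY := (Real.exp_pos (2 * D.ρ₂ * x)).ne'
  have e : 2 * (D.ρ₁ + D.ρ₂) * x = 2 * D.ρ₁ * x + 2 * D.ρ₂ * x := by ring
  rw [denom, gramDet, e, Real.cosh_eq, Real.sinh_eq, Real.sinh_eq, neg_add, Real.exp_add,
    Real.exp_add, Real.exp_neg, Real.exp_neg]
  field_simp
  ring

theorem ofReal_gramDet (x : ℝ) : (D.gramDet x : ℂ) =
    ((D.ρ₂ : ℂ) - D.ρ₁) ^ 2 / 4 * ((Real.exp (2 * D.ρ₁ * x) : ℂ) ^ 2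
        * (Real.exp (2 * D.ρ₂ * x) : ℂ) ^ 2 + 1)
    + ((D.ρ₂ : ℂ) + D.ρ₁) ^ 2 / 4 * ((Real.exp (2 * D.ρ₁ * x) : ℂ) ^ 2
        + (Real.exp (2 * D.ρ₂ * x) : ℂ) ^ 2)
    - D.ρ₁ * D.ρ₂ * (D.phaseFactor + D.phaseFactor⁻¹)
      * ((Real.exp (2 * D.ρ₁ * x) : ℂ) * (Real.exp (2 * D.ρ₂ * x) : ℂ)) := by
  rw [gramDet]
  push_cast
  have := D.cos_phase_zero
  push_cast at this
  rw [this]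
  ring

/-- The `(1, 1)` entry of the inverse Gram matrix of the double commutation method. -/
noncomputable def gram₁₁ (x : ℝ) : ℂ :=
  (D.ρ₁ : ℂ) * (D.ρ₂ + D.ρ₁) ^ 2 / 4 * ((Real.exp (2 * D.ρ₁ * x) : ℂ) ^ 2
    * (1 + (Real.exp (2 * D.ρ₂ * x) : ℂ) ^ 2)) / (D.gramDet x : ℂ)

/-- The `(2, 2)` entry of the inverse Gram matrix. -/
noncomputable def gram₂₂ (x : ℝ) : ℂ :=
  (D.ρ₂ : ℂ) * (D.ρ₂ + D.ρ₁) ^ 2 / 4 * ((Real.exp (2 * D.ρ₂ * x) : ℂ) ^ 2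
    * (1 + (Real.exp (2 * D.ρ₁ * x) : ℂ) ^ 2)) / (D.gramDet x : ℂ)

/-- The `(1, 2)` entry of the inverse Gram matrix. -/
noncomputable def gram₁₂ (x : ℝ) : ℂ :=
  -((D.ρ₁ : ℂ) * D.ρ₂ * (D.ρ₂ + D.ρ₁) / 2 * ((Real.exp (2 * D.ρ₁ * x) : ℂ)
    * (Real.exp (2 * D.ρ₂ * x) : ℂ) * (D.phaseFactor⁻¹
      + (Real.exp (2 * D.ρ₁ * x) : ℂ) * (Real.exp (2 * D.ρ₂ * x) : ℂ)))) / (D.gramDet x : ℂ)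

/-- The `(2, 1)` entry of the inverse Gram matrix. -/
noncomputable def gram₂₁ (x : ℝ) : ℂ :=
  -((D.ρ₁ : ℂ) * D.ρ₂ * (D.ρ₂ + D.ρ₁) / 2 * ((Real.exp (2 * D.ρ₁ * x) : ℂ)
    * (Real.exp (2 * D.ρ₂ * x) : ℂ) * (D.phaseFactor
      + (Real.exp (2 * D.ρ₁ * x) : ℂ) * (Real.exp (2 * D.ρ₂ * x) : ℂ)))) / (D.gramDet x : ℂ)

theorem conj_gram₁₁ (x : ℝ) : conj (D.gram₁₁ x) = D.gram₁₁ x := by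
  simp [gram₁₁, Complex.conj_ofNat, -Complex.ofReal_exp]

theorem conj_gram₂₂ (x : ℝ) : conj (D.gram₂₂ x) = D.gram₂₂ x := by
  simp [gram₂₂, Complex.conj_ofNat, -Complex.ofReal_exp]

theorem conj_gram₁₂ (x : ℝ) : conj (D.gram₁₂ x) = D.gram₂₁ x := by
  simp [gram₁₂, gram₂₁, conj_phaseFactor, Complex.conj_ofNat, -Complex.ofReal_exp]

theorem conj_gram₂₁ (x : ℝ) : conj (D.gram₂₁ x) = D.gram₁₂ x := by
  simp [gram₁₂, gram₂₁, conj_phaseFactor, Complex.conj_ofNat, -Complex.ofReal_exp]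

/-- The residue of the normalized mode at `-i ρ₁`. -/
noncomputable def residue₁ (x : ℝ) : ℂ := -2 * Complex.I * (D.gram₁₁ x + D.gram₂₁ x)

/-- The residue of the normalized mode at `-i ρ₂`. -/
noncomputable def residue₂ (x : ℝ) : ℂ := -2 * Complex.I * (D.gram₁₂ x + D.gram₂₂ x)

/-- Together with `a0_zero_eq` this compares coefficients in `ξ² + a⁽¹⁾ξ + a⁽⁰⁾ = (ξ + iρ₁)(ξ + iρ₂)
+ r₁(ξ + iρ₂) + r₂(ξ + iρ₁)`. -/
theorem a1_zero_eq (x : ℝ) : D.a1 x 0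
    = Complex.I * (D.ρ₂ + D.ρ₁) + D.residue₁ x + D.residue₂ x := by
  have hX : (Real.exp (2 * D.ρ₁ * x) : ℂ) ≠ 0 := by simp
  have hY : (Real.exp (2 * D.ρ₂ * x) : ℂ) ≠ 0 := by simp
  have hE := D.phaseFactor_ne_zero
  have hd : (D.gramDet x : ℂ) ≠ 0 := by exact_mod_cast (D.gramDet_pos x).ne'
  rw [a1, denom_zero_eq, residue₁, residue₂, gram₁₁, gram₁₂, gram₂₁, gram₂₂,
    Real.cosh_eq, Real.sinh_eq, Real.cosh_eq, Real.sinh_eq, Real.exp_neg, Real.exp_neg]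
  simp only [Complex.ofReal_div, Complex.ofReal_mul, Complex.ofReal_add, Complex.ofReal_sub,
    Complex.ofReal_inv, Complex.ofReal_neg, Complex.ofReal_ofNat, Complex.ofReal_pow]
  rw [ofReal_gramDet] at hd ⊢
  set X := (Real.exp (2 * D.ρ₁ * x) : ℂ)
  set Y := (Real.exp (2 * D.ρ₂ * x) : ℂ)
  -- The determinant stays an opaque nonzero symbol while denominators are cleared; it is expanded
  -- only afterwards, since it contains the inverse of the phase factor.
  set W := (_ - _ * (X * Y) : ℂ) with hW
  field_simp
  rw [hW]
  field_simp
  ring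

theorem a0_zero_eq (x : ℝ) : D.a0 x 0
    = -D.ρ₁ * D.ρ₂ + Complex.I * D.ρ₂ * D.residue₁ x + Complex.I * D.ρ₁ * D.residue₂ x := by
  have hX : (Real.exp (2 * D.ρ₁ * x) : ℂ) ≠ 0 := by simp
  have hY : (Real.exp (2 * D.ρ₂ * x) : ℂ) ≠ 0 := by simp
  have hE := D.phaseFactor_ne_zero
  have hd : (D.gramDet x : ℂ) ≠ 0 := by exact_mod_cast (D.gramDet_pos x).ne'
  have e : 2 * (D.ρ₁ + D.ρ₂) * x = 2 * D.ρ₁ * x + 2 * D.ρ₂ * x := by ring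
  have e1 : Complex.exp (Complex.I * D.phase 0) = D.phaseFactor := by
    rw [phase_zero, phaseFactor]
  have e2 : Complex.exp (-Complex.I * D.phase 0) = D.phaseFactor⁻¹ := by
    rw [← e1, ← Complex.exp_neg, neg_mul]
  rw [a0, e1, e2, denom_zero_eq, residue₁, residue₂, gram₁₁, gram₁₂, gram₂₁, gram₂₂, e,
    Real.cosh_eq, Real.sinh_eq, Real.sinh_eq, neg_add, Real.exp_add, Real.exp_add, Real.exp_neg,
    Real.exp_neg]
  simp only [Complex.ofReal_div, Complex.ofReal_mul, Complex.ofReal_add, Complex.ofReal_sub,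
    Complex.ofReal_inv, Complex.ofReal_neg, Complex.ofReal_ofNat, Complex.ofReal_pow]
  rw [ofReal_gramDet] at hd ⊢
  set X := (Real.exp (2 * D.ρ₁ * x) : ℂ)
  set Y := (Real.exp (2 * D.ρ₂ * x) : ℂ)
  set W := (_ - _ * (X * Y) : ℂ) with hW
  field_simp
  rw [hW]
  field_simp
  have hI : Complex.I ^ 2 = -1 := Complex.I_sq
  ring_nf
  simp only [hI]
  ring

theorem hasDerivAt_ofReal_exp (ρ x : ℝ) :
    HasDerivAt (fun x : ℝ => (Real.exp (2 * ρ * x) : ℂ))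
      (2 * ρ * (Real.exp (2 * ρ * x) : ℂ)) x := by
  have h : HasDerivAt (fun x : ℝ => Real.exp (2 * ρ * x)) (Real.exp (2 * ρ * x) * (2 * ρ)) x := by
    simpa using ((hasDerivAt_id x).const_mul (2 * ρ)).exp
  refine h.ofReal_comp.congr_deriv ?_
  simp only [Complex.ofReal_mul, Complex.ofReal_ofNat]
  ring

theorem hasDerivAt_gramDet (x : ℝ) : HasDerivAt (fun x => (D.gramDet x : ℂ))
    (((D.ρ₂ : ℂ) - D.ρ₁) ^ 2 * (D.ρ₂ + D.ρ₁) * ((Real.exp (2 * D.ρ₁ * x) : ℂ) ^ 2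
        * (Real.exp (2 * D.ρ₂ * x) : ℂ) ^ 2)
    + ((D.ρ₂ : ℂ) + D.ρ₁) ^ 2 * (D.ρ₁ * (Real.exp (2 * D.ρ₁ * x) : ℂ) ^ 2
        + D.ρ₂ * (Real.exp (2 * D.ρ₂ * x) : ℂ) ^ 2)
    - 2 * (D.ρ₂ + D.ρ₁) * D.ρ₁ * D.ρ₂ * (D.phaseFactor + D.phaseFactor⁻¹)
      * ((Real.exp (2 * D.ρ₁ * x) : ℂ) * (Real.exp (2 * D.ρ₂ * x) : ℂ))) x := by
  simp_rw [ofReal_gramDet]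
  have hX := hasDerivAt_ofReal_exp D.ρ₁ x
  have hY := hasDerivAt_ofReal_exp D.ρ₂ x
  refine HasDerivAt.congr_deriv (((((hX.fun_pow 2).fun_mul (hY.fun_pow 2)).add_const 1).const_mul _).fun_add
    (((hX.fun_pow 2).fun_add (hY.fun_pow 2)).const_mul _) |>.fun_sub ((hX.fun_mul hY).const_mul _)) ?_
  push_cast
  ring

/-- One entry of the Riccati equation `G' = PG + GP - 4 G J G`, where `P = diag(2ρ₁, 2ρ₂)` and `J`
is the all-ones matrix; the product of residues is an entry of `4 G J G` because `G` is Hermitian.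
For the inverse of `G` the equation is linear, `M' = -PM - MP + 4J`, and is solved by `M_jk = 2 (1 +
c_jk e^{-2(ρ_j+ρ_k)x}) / (ρ_j + ρ_k)`, with `c_jk = 1` on the diagonal and the phase factor or its
inverse off it. -/
theorem hasDerivAt_gram₁₁ (x : ℝ) : HasDerivAt D.gram₁₁
    (4 * D.ρ₁ * D.gram₁₁ x - conj (D.residue₁ x) * D.residue₁ x) x := by
  have hE := D.phaseFactor_ne_zero
  have hd : (D.gramDet x : ℂ) ≠ 0 := by exact_mod_cast (D.gramDet_pos x).ne'
  have hX := hasDerivAt_ofReal_exp D.ρ₁ x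
  have hY := hasDerivAt_ofReal_exp D.ρ₂ x
  refine HasDerivAt.congr_deriv ((((hX.fun_pow 2).fun_mul
    ((hY.fun_pow 2).const_add 1)).const_mul _).fun_div (D.hasDerivAt_gramDet x) hd) ?_
  have hI : Complex.I ^ 2 = -1 := Complex.I_sq
  have e : conj (D.residue₁ x) * D.residue₁ x
      = 4 * (D.gram₁₁ x + D.gram₁₂ x) * (D.gram₁₁ x + D.gram₂₁ x) := by
    simp only [residue₁, map_mul, map_add, map_neg, conj_gram₁₁, conj_gram₂₁, Complex.conj_I,
      Complex.conj_ofNat]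
    linear_combination (-4 * (D.gram₁₁ x + D.gram₁₂ x) * (D.gram₁₁ x + D.gram₂₁ x)) * hI
  rw [e, gram₁₁, gram₁₂, gram₂₁]
  rw [ofReal_gramDet] at hd ⊢
  set X := (Real.exp (2 * D.ρ₁ * x) : ℂ)
  set Y := (Real.exp (2 * D.ρ₂ * x) : ℂ)
  set W := (_ - _ * (X * Y) : ℂ) with hW
  field_simp
  rw [hW]
  simp only [Nat.cast_ofNat, Nat.reduceSub, pow_one]
  field_simp
  ring

theorem hasDerivAt_gram₂₂ (x : ℝ) : HasDerivAt D.gram₂₂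
    (4 * D.ρ₂ * D.gram₂₂ x - conj (D.residue₂ x) * D.residue₂ x) x := by
  have hE := D.phaseFactor_ne_zero
  have hd : (D.gramDet x : ℂ) ≠ 0 := by exact_mod_cast (D.gramDet_pos x).ne'
  have hX := hasDerivAt_ofReal_exp D.ρ₁ x
  have hY := hasDerivAt_ofReal_exp D.ρ₂ x
  refine HasDerivAt.congr_deriv ((((hY.fun_pow 2).fun_mul
    ((hX.fun_pow 2).const_add 1)).const_mul _).fun_div (D.hasDerivAt_gramDet x) hd) ?_
  have hI : Complex.I ^ 2 = -1 := Complex.I_sq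
  have e : conj (D.residue₂ x) * D.residue₂ x
      = 4 * (D.gram₂₁ x + D.gram₂₂ x) * (D.gram₁₂ x + D.gram₂₂ x) := by
    simp only [residue₂, map_mul, map_add, map_neg, conj_gram₂₂, conj_gram₁₂, Complex.conj_I,
      Complex.conj_ofNat]
    linear_combination (-4 * (D.gram₂₁ x + D.gram₂₂ x) * (D.gram₁₂ x + D.gram₂₂ x)) * hI
  rw [e, gram₂₂, gram₁₂, gram₂₁]
  rw [ofReal_gramDet] at hd ⊢
  set X := (Real.exp (2 * D.ρ₁ * x) : ℂ)
  set Y := (Real.exp (2 * D.ρ₂ * x) : ℂ)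
  set W := (_ - _ * (X * Y) : ℂ) with hW
  field_simp
  rw [hW]
  simp only [Nat.cast_ofNat, Nat.reduceSub, pow_one]
  field_simp
  ring

theorem hasDerivAt_gram₁₂ (x : ℝ) : HasDerivAt D.gram₁₂
    (2 * (D.ρ₁ + D.ρ₂) * D.gram₁₂ x - conj (D.residue₁ x) * D.residue₂ x) x := by
  have hE := D.phaseFactor_ne_zero
  have hd : (D.gramDet x : ℂ) ≠ 0 := by exact_mod_cast (D.gramDet_pos x).ne'
  have hX := hasDerivAt_ofReal_exp D.ρ₁ x
  have hY := hasDerivAt_ofReal_exp D.ρ₂ x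
  refine HasDerivAt.congr_deriv ((((hX.fun_mul hY).fun_mul
    ((hX.fun_mul hY).const_add D.phaseFactor⁻¹)).const_mul _).fun_neg.fun_div
      (D.hasDerivAt_gramDet x) hd) ?_
  have hI : Complex.I ^ 2 = -1 := Complex.I_sq
  have e : conj (D.residue₁ x) * D.residue₂ x
      = 4 * (D.gram₁₁ x + D.gram₁₂ x) * (D.gram₁₂ x + D.gram₂₂ x) := by
    simp only [residue₁, residue₂, map_mul, map_add, map_neg, conj_gram₁₁, conj_gram₂₁,
      Complex.conj_I, Complex.conj_ofNat]
    linear_combination (-4 * (D.gram₁₁ x + D.gram₁₂ x) * (D.gram₁₂ x + D.gram₂₂ x)) * hI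
  rw [e, gram₁₁, gram₁₂, gram₂₂]
  rw [ofReal_gramDet] at hd ⊢
  set X := (Real.exp (2 * D.ρ₁ * x) : ℂ)
  set Y := (Real.exp (2 * D.ρ₂ * x) : ℂ)
  set W := (_ - _ * (X * Y) : ℂ) with hW
  field_simp
  rw [hW]
  field_simp
  ring

theorem hasDerivAt_gram₂₁ (x : ℝ) : HasDerivAt D.gram₂₁
    (2 * (D.ρ₁ + D.ρ₂) * D.gram₂₁ x - conj (D.residue₂ x) * D.residue₁ x) x := by
  have h := (D.hasDerivAt_gram₁₂ x).star
  have e : (fun x => star (D.gram₁₂ x)) = D.gram₂₁ := funext fun x => D.conj_gram₁₂ x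
  rw [e] at h
  refine h.congr_deriv ?_
  rw [← conj_gram₁₂]
  simp only [star_sub, star_mul', star_add, Complex.star_def, Complex.conj_conj,
    Complex.conj_ofReal, Complex.conj_ofNat]
  ring

/-- If `h_k' = -2 i h - 2 ρ_k h_k` and likewise for `g`, then
`conj g h - conj (g + r₁ g₁ + r₂ g₂) (h + r₁ h₁ + r₂ h₂)` is the derivative of the sesquilinear
form of the matrix `gram`. -/
theorem hasDerivAt_gram_form {g g₁ g₂ h h₁ h₂ : ℝ → ℂ} {x : ℝ}
    (hg₁ : HasDerivAt g₁ (-2 * Complex.I * g x - 2 * D.ρ₁ * g₁ x) x)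
    (hg₂ : HasDerivAt g₂ (-2 * Complex.I * g x - 2 * D.ρ₂ * g₂ x) x)
    (hh₁ : HasDerivAt h₁ (-2 * Complex.I * h x - 2 * D.ρ₁ * h₁ x) x)
    (hh₂ : HasDerivAt h₂ (-2 * Complex.I * h x - 2 * D.ρ₂ * h₂ x) x) :
    HasDerivAt (fun x => D.gram₁₁ x * (conj (g₁ x) * h₁ x) + D.gram₁₂ x * (conj (g₁ x) * h₂ x)
        + (D.gram₂₁ x * (conj (g₂ x) * h₁ x) + D.gram₂₂ x * (conj (g₂ x) * h₂ x)))
      (conj (g x) * h x - conj (g x + D.residue₁ x * g₁ x + D.residue₂ x * g₂ x)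
        * (h x + D.residue₁ x * h₁ x + D.residue₂ x * h₂ x)) x := by
  have hc₁ : HasDerivAt (fun x => conj (g₁ x)) _ x := hg₁.star
  have hc₂ : HasDerivAt (fun x => conj (g₂ x)) _ x := hg₂.star
  refine HasDerivAt.congr_deriv
    ((((D.hasDerivAt_gram₁₁ x).fun_mul (hc₁.fun_mul hh₁)).fun_add
      ((D.hasDerivAt_gram₁₂ x).fun_mul (hc₁.fun_mul hh₂))).fun_add
    (((D.hasDerivAt_gram₂₁ x).fun_mul (hc₂.fun_mul hh₁)).fun_add
      ((D.hasDerivAt_gram₂₂ x).fun_mul (hc₂.fun_mul hh₂)))) ?_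
  -- The damping terms `-2ρ_k g_k`, `-2ρ_k h_k` cancel the linear part of the Riccati equation. The
  -- source terms `-2i g`, `-2i h` meet column and row sums of `G`, which are the residues and their
  -- conjugates up to the factor `∓2i`; they supply the mixed terms of the product.
  simp only [starRingEnd_apply, star_add, star_sub, star_mul', star_neg]
  simp only [← starRingEnd_apply, residue₁, residue₂, map_mul, map_add, map_neg, conj_gram₁₁,
    conj_gram₁₂, conj_gram₂₁, conj_gram₂₂, Complex.conj_I, Complex.conj_ofNat,
    Complex.conj_ofReal]
  ring

end TwoSolitonData

/-! ### Bounds for the dressing matrix and the residues -/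

theorem MeasureTheory.MemLp.continuous_bounded_mul {c F : ℝ → ℂ} (hF : MemLp F 2 volume)
    (hc : Continuous c) {C : ℝ} (hC : ∀ x, ‖c x‖ ≤ C) : MemLp (fun x => c x * F x) 2 volume :=
  hF.of_le_mul (c := C) (hc.aestronglyMeasurable.mul hF.aestronglyMeasurable)
    (Eventually.of_forall fun x => by
      rw [norm_mul]; exact mul_le_mul_of_nonneg_right (hC x) (norm_nonneg _))

/-- The left side decays exponentially in both directions; the quadratic Taylor bound `1 + 2ρ²x² ≤
e^{2ρ|x|}` already gives the algebraic rate needed to place the bound states in `L²`. -/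
theorem exp_div_one_add_exp_sq_le {ρ : ℝ} (hρ : 0 < ρ) (x : ℝ) :
    Real.exp (2 * ρ * x) / (1 + Real.exp (2 * ρ * x) ^ 2)
      ≤ (1 + 1 / (2 * ρ ^ 2)) * (1 + x ^ 2)⁻¹ := by
  set X := Real.exp (2 * ρ * x) with hX
  have hX0 : 0 < X := Real.exp_pos _
  have key : X * (1 + 2 * ρ ^ 2 * x ^ 2) ≤ 1 + X ^ 2 := by
    rcases le_total 0 x with h | h
    · have h1 := Real.quadratic_le_exp_of_nonneg (x := 2 * ρ * x) (by positivity)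
      rw [← hX] at h1
      have : 0 ≤ 2 * ρ * x := by positivity
      nlinarith
    · have h1 := Real.quadratic_le_exp_of_nonneg (x := -(2 * ρ * x)) (by nlinarith)
      rw [Real.exp_neg, ← hX] at h1
      have h2 : 0 ≤ -(2 * ρ * x) := by nlinarith
      have h3 : 1 + 2 * ρ ^ 2 * x ^ 2 ≤ X⁻¹ := by nlinarith
      have h4 := mul_le_mul_of_nonneg_left h3 hX0.le
      rw [mul_inv_cancel₀ hX0.ne'] at h4
      nlinarith
  rw [← div_eq_mul_inv, div_le_div_iff₀ (by positivity) (by positivity)]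
  -- The prefactor is chosen so that `1 + x² ≤ (1 + 1/(2ρ²)) (1 + 2ρ²x²)`.
  have h5 : X * (1 + x ^ 2) ≤ (1 + 1 / (2 * ρ ^ 2)) * (X * (1 + 2 * ρ ^ 2 * x ^ 2)) := by
    have : (1 + 1 / (2 * ρ ^ 2)) * (X * (1 + 2 * ρ ^ 2 * x ^ 2))
      = X * (1 + x ^ 2) + X * (1 / (2 * ρ ^ 2) + 2 * ρ ^ 2 * x ^ 2) := by
      field_simp; ring
    rw [this]
    have : 0 ≤ X * (1 / (2 * ρ ^ 2) + 2 * ρ ^ 2 * x ^ 2) := by positivity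
    linarith
  exact h5.trans (mul_le_mul_of_nonneg_left key (by positivity))

namespace TwoSolitonData

variable (D : TwoSolitonData)

/-- Dividing by the product lower bound of the determinant cancels `1 + Y²`. The surviving factor
`X² / (1 + X²)` is at most `1`, and it still decays after multiplication by `e^{-2ρ₁x} = X⁻¹`. -/
theorem norm_gram₁₁_le (x : ℝ) : ‖D.gram₁₁ x‖ ≤
    D.ρ₁ * (D.ρ₂ + D.ρ₁) ^ 2 / (D.ρ₂ - D.ρ₁) ^ 2 * (Real.exp (2 * D.ρ₁ * x) ^ 2
      / (1 + Real.exp (2 * D.ρ₁ * x) ^ 2)) := by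
  have h1 := D.ρ₁_pos
  have h2 := D.ρ₂_pos
  have hd : 0 < D.ρ₂ - D.ρ₁ := sub_pos.2 D.ρ₁_lt_ρ₂
  have hl := D.gramDet_lower_bound x
  have hp := D.gramDet_pos x
  have e : D.gram₁₁ x = ((D.ρ₁ * (D.ρ₂ + D.ρ₁) ^ 2 / 4 * (Real.exp (2 * D.ρ₁ * x) ^ 2
    * (1 + Real.exp (2 * D.ρ₂ * x) ^ 2)) / D.gramDet x : ℝ) : ℂ) := by
    rw [gram₁₁]; push_cast; rfl
  rw [e, Complex.norm_real, Real.norm_of_nonneg (by positivity)]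
  refine (div_le_div_of_nonneg_left (by positivity) (by positivity) hl).trans (le_of_eq ?_)
  field_simp

theorem norm_gram₂₂_le (x : ℝ) : ‖D.gram₂₂ x‖ ≤
    D.ρ₂ * (D.ρ₂ + D.ρ₁) ^ 2 / (D.ρ₂ - D.ρ₁) ^ 2 * (Real.exp (2 * D.ρ₂ * x) ^ 2
      / (1 + Real.exp (2 * D.ρ₂ * x) ^ 2)) := by
  have h1 := D.ρ₁_pos
  have h2 := D.ρ₂_pos
  have hd : 0 < D.ρ₂ - D.ρ₁ := sub_pos.2 D.ρ₁_lt_ρ₂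
  have hl := D.gramDet_lower_bound x
  have hp := D.gramDet_pos x
  have e : D.gram₂₂ x = ((D.ρ₂ * (D.ρ₂ + D.ρ₁) ^ 2 / 4 * (Real.exp (2 * D.ρ₂ * x) ^ 2
    * (1 + Real.exp (2 * D.ρ₁ * x) ^ 2)) / D.gramDet x : ℝ) : ℂ) := by
    rw [gram₂₂]; push_cast; rfl
  rw [e, Complex.norm_real, Real.norm_of_nonneg (by positivity)]
  refine (div_le_div_of_nonneg_left (by positivity) (by positivity) hl).trans (le_of_eq ?_)
  field_simp

theorem norm_gram₁₂_le (x : ℝ) : ‖D.gram₁₂ x‖ ≤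
    2 * D.ρ₁ * D.ρ₂ * (D.ρ₂ + D.ρ₁) / (D.ρ₂ - D.ρ₁) ^ 2 *
      (Real.exp (2 * D.ρ₁ * x) * Real.exp (2 * D.ρ₂ * x)
        * (1 + Real.exp (2 * D.ρ₁ * x) * Real.exp (2 * D.ρ₂ * x))
      / ((1 + Real.exp (2 * D.ρ₁ * x) ^ 2) * (1 + Real.exp (2 * D.ρ₂ * x) ^ 2))) := by
  have h1 := D.ρ₁_pos
  have h2 := D.ρ₂_pos
  have hd : 0 < D.ρ₂ - D.ρ₁ := sub_pos.2 D.ρ₁_lt_ρ₂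
  have hl := D.gramDet_lower_bound x
  have hp := D.gramDet_pos x
  have hn : ‖D.phaseFactor⁻¹ + (Real.exp (2 * D.ρ₁ * x) : ℂ) * (Real.exp (2 * D.ρ₂ * x) : ℂ)‖
      ≤ 1 + Real.exp (2 * D.ρ₁ * x) * Real.exp (2 * D.ρ₂ * x) := by
    refine (norm_add_le _ _).trans ?_
    rw [norm_inv, norm_phaseFactor, norm_mul, Complex.norm_real, Complex.norm_real,
      Real.norm_of_nonneg (Real.exp_pos _).le, Real.norm_of_nonneg (Real.exp_pos _).le, inv_one]
  rw [gram₁₂]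
  simp only [norm_neg, norm_mul, norm_div, Complex.norm_real, Real.norm_of_nonneg h1.le,
    Real.norm_of_nonneg h2.le, Real.norm_of_nonneg hp.le, Real.norm_of_nonneg (Real.exp_pos _).le]
  rw [← Complex.ofReal_add, Complex.norm_real, Real.norm_of_nonneg (add_pos h2 h1).le,
    RCLike.norm_ofNat]
  refine (div_le_div_of_nonneg_right (mul_le_mul_of_nonneg_left (mul_le_mul_of_nonneg_left hn
    (by positivity)) (by positivity)) hp.le).trans ?_
  refine (div_le_div_of_nonneg_left (by positivity) (by positivity) hl).trans (le_of_eq ?_)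
  field_simp
  ring

theorem norm_gram₂₁ (x : ℝ) : ‖D.gram₂₁ x‖ = ‖D.gram₁₂ x‖ := by
  rw [← conj_gram₁₂, Complex.norm_conj]

theorem exists_norm_gram_le : ∃ C : ℝ, 0 < C ∧ ∀ x, ‖D.gram₁₁ x‖ ≤ C ∧ ‖D.gram₁₂ x‖ ≤ C ∧
    ‖D.gram₂₁ x‖ ≤ C ∧ ‖D.gram₂₂ x‖ ≤ C := by
  have h1 := D.ρ₁_pos
  have h2 := D.ρ₂_pos
  have hd : 0 < D.ρ₂ - D.ρ₁ := sub_pos.2 D.ρ₁_lt_ρ₂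
  set A := D.ρ₁ * (D.ρ₂ + D.ρ₁) ^ 2 / (D.ρ₂ - D.ρ₁) ^ 2 with hA
  set B := D.ρ₂ * (D.ρ₂ + D.ρ₁) ^ 2 / (D.ρ₂ - D.ρ₁) ^ 2 with hB
  set E := 2 * D.ρ₁ * D.ρ₂ * (D.ρ₂ + D.ρ₁) / (D.ρ₂ - D.ρ₁) ^ 2 with hE
  have hA0 : 0 < A := by positivity
  have hB0 : 0 < B := by positivity
  have hE0 : 0 < E := by positivity
  have h12 : ∀ x, ‖D.gram₁₂ x‖ ≤ A + B + E := fun x => by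
    refine (D.norm_gram₁₂_le x).trans ((mul_le_of_le_one_right hE0.le ?_).trans (by linarith))
    have hX := Real.exp_pos (2 * D.ρ₁ * x)
    have hY := Real.exp_pos (2 * D.ρ₂ * x)
    rw [div_le_one (by positivity)]
    nlinarith [sq_nonneg (Real.exp (2 * D.ρ₁ * x) - Real.exp (2 * D.ρ₂ * x))]
  refine ⟨A + B + E, by positivity, fun x => ⟨?_, h12 x, (D.norm_gram₂₁ x).trans_le (h12 x), ?_⟩⟩
  · refine (D.norm_gram₁₁_le x).trans ((mul_le_of_le_one_right hA0.le ?_).trans (by linarith))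
    rw [div_le_one (by positivity)]; linarith
  · refine (D.norm_gram₂₂_le x).trans ((mul_le_of_le_one_right hB0.le ?_).trans (by linarith))
    rw [div_le_one (by positivity)]; linarith

/-- The bound states involve `e^{-2ρ_k x}`, which blows up as `x → -∞`. The matrix entries
compensate, and off-diagonal entries must do so for either exponential, since each of them is paired
with both. -/
theorem exists_norm_gram_mul_exp_le : ∃ K : ℝ, 0 < K ∧ ∀ x,
    ‖D.gram₁₁ x‖ * Real.exp (-(2 * D.ρ₁ * x)) ≤ K * (1 + x ^ 2)⁻¹ ∧
    ‖D.gram₁₂ x‖ * Real.exp (-(2 * D.ρ₁ * x)) ≤ K * (1 + x ^ 2)⁻¹ ∧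
    ‖D.gram₂₁ x‖ * Real.exp (-(2 * D.ρ₁ * x)) ≤ K * (1 + x ^ 2)⁻¹ ∧
    ‖D.gram₁₂ x‖ * Real.exp (-(2 * D.ρ₂ * x)) ≤ K * (1 + x ^ 2)⁻¹ ∧
    ‖D.gram₂₁ x‖ * Real.exp (-(2 * D.ρ₂ * x)) ≤ K * (1 + x ^ 2)⁻¹ ∧
    ‖D.gram₂₂ x‖ * Real.exp (-(2 * D.ρ₂ * x)) ≤ K * (1 + x ^ 2)⁻¹ := by
  have h1 := D.ρ₁_pos
  have h2 := D.ρ₂_pos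
  have hd : 0 < D.ρ₂ - D.ρ₁ := sub_pos.2 D.ρ₁_lt_ρ₂
  set A := D.ρ₁ * (D.ρ₂ + D.ρ₁) ^ 2 / (D.ρ₂ - D.ρ₁) ^ 2 with hA
  set B := D.ρ₂ * (D.ρ₂ + D.ρ₁) ^ 2 / (D.ρ₂ - D.ρ₁) ^ 2 with hB
  set E := 2 * D.ρ₁ * D.ρ₂ * (D.ρ₂ + D.ρ₁) / (D.ρ₂ - D.ρ₁) ^ 2 with hE
  set k₁ := 1 + 1 / (2 * D.ρ₁ ^ 2) with hk₁
  set k₂ := 1 + 1 / (2 * D.ρ₂ ^ 2) with hk₂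
  have hA0 : 0 < A := by positivity
  have hB0 : 0 < B := by positivity
  have hE0 : 0 < E := by positivity
  have hk10 : 0 < k₁ := by positivity
  have hk20 : 0 < k₂ := by positivity
  refine ⟨(A + B + E) * (k₁ + k₂), by positivity, fun x => ?_⟩
  have hX := Real.exp_pos (2 * D.ρ₁ * x)
  have hY := Real.exp_pos (2 * D.ρ₂ * x)
  have b11 := D.norm_gram₁₁_le x
  have b22 := D.norm_gram₂₂_le x
  have b12 := D.norm_gram₁₂_le x
  have e1 := exp_div_one_add_exp_sq_le h1 x
  have e2 := exp_div_one_add_exp_sq_le h2 x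
  rw [← hk₁] at e1
  rw [← hk₂] at e2
  rw [norm_gram₂₁, Real.exp_neg, Real.exp_neg]
  set X := Real.exp (2 * D.ρ₁ * x)
  set Y := Real.exp (2 * D.ρ₂ * x)
  set v := (1 + x ^ 2)⁻¹ with hv
  have hv0 : 0 < v := by positivity
  have hX1 : X / (1 + X ^ 2) ≤ (k₁ + k₂) * v := by
    linarith [mul_pos hk20 hv0, add_mul k₁ k₂ v]
  have hY1 : Y / (1 + Y ^ 2) ≤ (k₁ + k₂) * v := by
    linarith [mul_pos hk10 hv0, add_mul k₁ k₂ v]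
  have hXY : X / (1 + X ^ 2) + Y / (1 + Y ^ 2) ≤ (k₁ + k₂) * v := by
    linarith [add_mul k₁ k₂ v]
  have fin : ∀ {a c : ℝ}, 0 < a → a ≤ A + B + E → c ≤ (k₁ + k₂) * v →
      a * c ≤ (A + B + E) * (k₁ + k₂) * v := fun {a c} ha hle hc => by
    calc a * c ≤ a * ((k₁ + k₂) * v) := mul_le_mul_of_nonneg_left hc ha.le
      _ ≤ (A + B + E) * ((k₁ + k₂) * v) := mul_le_mul_of_nonneg_right hle (by positivity)
      _ = _ := by ring
  have c1 : ‖D.gram₁₁ x‖ * X⁻¹ ≤ (A + B + E) * (k₁ + k₂) * v := by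
    refine (mul_le_mul_of_nonneg_right b11 (by positivity)).trans ?_
    have : A * (X ^ 2 / (1 + X ^ 2)) * X⁻¹ = A * (X / (1 + X ^ 2)) := by field_simp
    rw [this]
    exact fin hA0 (by linarith) hX1
  have c2 : ‖D.gram₂₂ x‖ * Y⁻¹ ≤ (A + B + E) * (k₁ + k₂) * v := by
    refine (mul_le_mul_of_nonneg_right b22 (by positivity)).trans ?_
    have : B * (Y ^ 2 / (1 + Y ^ 2)) * Y⁻¹ = B * (Y / (1 + Y ^ 2)) := by field_simp
    rw [this]
    exact fin hB0 (by linarith) hY1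
  have c3 : ‖D.gram₁₂ x‖ * X⁻¹ ≤ (A + B + E) * (k₁ + k₂) * v := by
    refine (mul_le_mul_of_nonneg_right b12 (by positivity)).trans ?_
    rw [mul_assoc]
    refine fin hE0 (by linarith) (le_trans ?_ hXY)
    have : X * Y * (1 + X * Y) / ((1 + X ^ 2) * (1 + Y ^ 2)) * X⁻¹
      = (Y + X * Y ^ 2) / ((1 + X ^ 2) * (1 + Y ^ 2)) := by field_simp
    rw [this, div_add_div _ _ (by positivity) (by positivity)]
    refine div_le_div_of_nonneg_right ?_ (by positivity)
    have : 0 < X + X ^ 2 * Y := by positivity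
    linarith
  have c4 : ‖D.gram₁₂ x‖ * Y⁻¹ ≤ (A + B + E) * (k₁ + k₂) * v := by
    refine (mul_le_mul_of_nonneg_right b12 (by positivity)).trans ?_
    rw [mul_assoc]
    refine fin hE0 (by linarith) (le_trans ?_ hXY)
    have : X * Y * (1 + X * Y) / ((1 + X ^ 2) * (1 + Y ^ 2)) * Y⁻¹
      = (X + X ^ 2 * Y) / ((1 + X ^ 2) * (1 + Y ^ 2)) := by field_simp
    rw [this, div_add_div _ _ (by positivity) (by positivity)]
    refine div_le_div_of_nonneg_right ?_ (by positivity)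
    have : 0 < Y + X * Y ^ 2 := by positivity
    linarith
  exact ⟨c1, c3, c3, c4, c4, c2⟩

theorem continuous_gram₁₁ : Continuous D.gram₁₁ :=
  continuous_iff_continuousAt.2 fun x => (D.hasDerivAt_gram₁₁ x).continuousAt

theorem continuous_gram₁₂ : Continuous D.gram₁₂ :=
  continuous_iff_continuousAt.2 fun x => (D.hasDerivAt_gram₁₂ x).continuousAt

theorem continuous_gram₂₁ : Continuous D.gram₂₁ :=
  continuous_iff_continuousAt.2 fun x => (D.hasDerivAt_gram₂₁ x).continuousAt

theorem continuous_gram₂₂ : Continuous D.gram₂₂ :=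
  continuous_iff_continuousAt.2 fun x => (D.hasDerivAt_gram₂₂ x).continuousAt

theorem continuous_residue₁ : Continuous D.residue₁ :=
  (D.continuous_gram₁₁.add D.continuous_gram₂₁).const_mul _

theorem continuous_residue₂ : Continuous D.residue₂ :=
  (D.continuous_gram₁₂.add D.continuous_gram₂₂).const_mul _

theorem norm_residue₁_le (x : ℝ) : ‖D.residue₁ x‖ ≤ 2 * (‖D.gram₁₁ x‖ + ‖D.gram₂₁ x‖) := by
  rw [residue₁, norm_mul]
  refine (mul_le_mul_of_nonneg_left (norm_add_le _ _) (norm_nonneg _)).trans (le_of_eq ?_)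
  simp

theorem norm_residue₂_le (x : ℝ) : ‖D.residue₂ x‖ ≤ 2 * (‖D.gram₁₂ x‖ + ‖D.gram₂₂ x‖) := by
  rw [residue₂, norm_mul]
  refine (mul_le_mul_of_nonneg_left (norm_add_le _ _) (norm_nonneg _)).trans (le_of_eq ?_)
  simp

theorem exists_norm_residue_le :
    ∃ C : ℝ, 0 < C ∧ ∀ x, ‖D.residue₁ x‖ ≤ C ∧ ‖D.residue₂ x‖ ≤ C := by
  obtain ⟨C, hC, h⟩ := D.exists_norm_gram_le
  refine ⟨4 * C, by positivity, fun x => ?_⟩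
  obtain ⟨h1, h2, h3, h4⟩ := h x
  exact ⟨(D.norm_residue₁_le x).trans (by linarith), (D.norm_residue₂_le x).trans (by linarith)⟩

/-- The weight `1 / √(π (ξ² + ρ₁²) (ξ² + ρ₂²))`. -/
noncomputable def modeWeight (ξ : ℝ) : ℝ :=
  (Real.sqrt (Real.pi * ((ξ ^ 2 + D.ρ₁ ^ 2) * (ξ ^ 2 + D.ρ₂ ^ 2))))⁻¹

theorem modeWeight_arg_pos (ξ : ℝ) :
    0 < Real.pi * ((ξ ^ 2 + D.ρ₁ ^ 2) * (ξ ^ 2 + D.ρ₂ ^ 2)) := by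
  have h1 := D.ρ₁_pos
  have h2 := D.ρ₂_pos
  have := Real.pi_pos
  positivity

theorem sq_modeWeight (ξ : ℝ) : D.modeWeight ξ ^ 2
    = (Real.pi * ((ξ ^ 2 + D.ρ₁ ^ 2) * (ξ ^ 2 + D.ρ₂ ^ 2)))⁻¹ := by
  rw [modeWeight, inv_pow, Real.sq_sqrt (D.modeWeight_arg_pos ξ).le]

theorem continuous_modeWeight : Continuous D.modeWeight := by
  refine Continuous.inv₀ (by fun_prop) fun ξ => ?_
  exact (Real.sqrt_pos.2 (D.modeWeight_arg_pos ξ)).ne'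

/-- Partial fractions in `ξ`: after division by `(ξ + iρ₁)(ξ + iρ₂)`, a mode is a plane wave
corrected by simple poles at `-iρ₁` and `-iρ₂`. -/
theorem a_zero_eq (x : ℝ) (ξ : ℂ) : D.a x 0 ξ
    = ((ξ + Complex.I * D.ρ₁) * (ξ + Complex.I * D.ρ₂)
      + D.residue₁ x * (ξ + Complex.I * D.ρ₂) + D.residue₂ x * (ξ + Complex.I * D.ρ₁))
      * Complex.exp (-2 * Complex.I * (ξ * x)) := by
  rw [a, a1_zero_eq, a0_zero_eq]
  have : -2 * Complex.I * (ξ * x + ξ ^ 2 * ((0 : ℝ) : ℂ)) = -2 * Complex.I * (ξ * x) := by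
    simp
  rw [this]
  congr 1
  linear_combination (-D.ρ₁ * D.ρ₂ : ℂ) * Complex.I_sq

theorem dispersive_zero_eq (x ξ : ℝ) : D.dispersive 0 x ξ
    = D.modeWeight ξ * D.a x 0 ξ := by
  rw [dispersive, modeWeight, div_eq_mul_inv, mul_comm, Complex.ofReal_inv]

end TwoSolitonData

/-! ### Superpositions of modes with compactly supported amplitudes -/

/-- Square integrable functions with bounded support. -/
def IsBandLimited (F : ℝ → ℂ) : Prop :=
  MemLp F 2 volume ∧ ∃ R : ℝ, ∀ ξ, R < |ξ| → F ξ = 0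

theorem IsBandLimited.integrable {F : ℝ → ℂ} (hF : IsBandLimited F) : Integrable F := by
  obtain ⟨h2, R, hR⟩ := hF
  have h1 : IntegrableOn F (Set.Icc (-R) R) := by
    have : MemLp F 2 (volume.restrict (Set.Icc (-R) R)) := h2.restrict _
    exact this.integrable (by norm_num)
  refine (integrableOn_iff_integrable_of_support_subset fun ξ hξ => ?_).1 h1
  by_contra h
  refine hξ (hR ξ ?_)
  rw [Set.mem_Icc, ← abs_le] at h
  exact not_le.1 h

theorem IsBandLimited.continuous_mul {F : ℝ → ℂ} (hF : IsBandLimited F) {c : ℝ → ℂ}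
    (hc : Continuous c) : IsBandLimited (fun ξ => c ξ * F ξ) := by
  obtain ⟨h2, R, hR⟩ := hF
  refine ⟨?_, R, fun ξ hξ => by simp [hR ξ hξ]⟩
  obtain ⟨C, hC⟩ := (isCompact_Icc (a := -R) (b := R)).exists_bound_of_continuousOn hc.continuousOn
  refine h2.of_le_mul (c := C) (hc.aestronglyMeasurable.mul h2.aestronglyMeasurable)
    (Eventually.of_forall fun ξ => ?_)
  by_cases h : R < |ξ|
  · simp [hR ξ h]
  · rw [norm_mul]
    exact mul_le_mul_of_nonneg_right (hC ξ (Set.mem_Icc.2 (abs_le.1 (not_lt.1 h)))) (norm_nonneg _)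

theorem MeasureTheory.MemLp.isBandLimited_indicator {F : ℝ → ℂ} (hF : MemLp F 2 volume) (R : ℝ) :
    IsBandLimited ((Set.Ioc (-R) R).indicator F) := by
  refine ⟨hF.indicator measurableSet_Ioc, R, fun ξ hξ => Set.indicator_of_notMem (fun h => ?_) _⟩
  exact absurd (abs_le.2 ⟨h.1.le, h.2⟩) (not_le.2 hξ)

theorem memLp_conj {f : ℝ → ℂ} (hf : MemLp f 2 volume) : MemLp (fun x => conj (f x)) 2 volume :=
  hf.star

theorem integrable_conj_mul {f g : ℝ → ℂ} (hf : MemLp f 2 volume) (hg : MemLp g 2 volume) :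
    Integrable fun x => conj (f x) * g x :=
  (memLp_conj hf).integrable_mul hg

namespace TwoSolitonData

variable (D : TwoSolitonData)

/-- The superposition `x ↦ ∫ F(ξ) Ψ_d(x, ξ) dξ` of dispersive modes at `t = 0`. -/
noncomputable def synthesis (F : ℝ → ℂ) (x : ℝ) : ℂ := ∫ ξ : ℝ, F ξ * D.dispersive 0 x ξ

/-- The free wave that the double commutation transforms into `synthesis F`. -/
noncomputable def freeWave (F : ℝ → ℂ) : ℝ → ℂ := expFourier fun ξ =>
  ((ξ : ℂ) + Complex.I * D.ρ₁) * (ξ + Complex.I * D.ρ₂) * D.modeWeight ξ * F ξ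

/-- The free wave divided by `ξ + i ρ₁` on the Fourier side. -/
noncomputable def freeWave₁ (F : ℝ → ℂ) : ℝ → ℂ := expFourier fun ξ =>
  ((ξ : ℂ) + Complex.I * D.ρ₂) * D.modeWeight ξ * F ξ

/-- The free wave divided by `ξ + i ρ₂` on the Fourier side. -/
noncomputable def freeWave₂ (F : ℝ → ℂ) : ℝ → ℂ := expFourier fun ξ =>
  ((ξ : ℂ) + Complex.I * D.ρ₁) * D.modeWeight ξ * F ξ

theorem continuous_ofReal_modeWeight : Continuous fun ξ => (D.modeWeight ξ : ℂ) :=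
  Complex.continuous_ofReal.comp D.continuous_modeWeight

variable {D} {F G : ℝ → ℂ}

theorem isBandLimited_freeWave (hF : IsBandLimited F) : IsBandLimited fun ξ : ℝ =>
    ((ξ : ℂ) + Complex.I * D.ρ₁) * (ξ + Complex.I * D.ρ₂) * D.modeWeight ξ * F ξ :=
  hF.continuous_mul (by have := D.continuous_ofReal_modeWeight; fun_prop)

theorem isBandLimited_freeWave₁ (hF : IsBandLimited F) : IsBandLimited fun ξ : ℝ =>
    ((ξ : ℂ) + Complex.I * D.ρ₂) * D.modeWeight ξ * F ξ :=
  hF.continuous_mul (by have := D.continuous_ofReal_modeWeight; fun_prop)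

theorem isBandLimited_freeWave₂ (hF : IsBandLimited F) : IsBandLimited fun ξ : ℝ =>
    ((ξ : ℂ) + Complex.I * D.ρ₁) * D.modeWeight ξ * F ξ :=
  hF.continuous_mul (by have := D.continuous_ofReal_modeWeight; fun_prop)

theorem integrable_mul_exp (hF : Integrable F) (x : ℝ) :
    Integrable fun ξ : ℝ => F ξ * Complex.exp (-2 * Complex.I * (ξ * x)) := by
  refine hF.mul_bdd (c := 1) (by fun_prop) (Eventually.of_forall fun ξ => ?_)
  rw [Complex.norm_exp]; simp

theorem synthesis_eq (hF : IsBandLimited F) (x : ℝ) : D.synthesis F x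
    = D.freeWave F x + D.residue₁ x * D.freeWave₁ F x + D.residue₂ x * D.freeWave₂ F x := by
  have i0 := integrable_mul_exp (isBandLimited_freeWave (D := D) hF).integrable x
  have i1 := integrable_mul_exp (isBandLimited_freeWave₁ (D := D) hF).integrable x
  have i2 := integrable_mul_exp (isBandLimited_freeWave₂ (D := D) hF).integrable x
  have i01 := i0.add (i1.const_mul (D.residue₁ x))
  simp only [Pi.add_def] at i01
  rw [freeWave, freeWave₁, freeWave₂, expFourier, expFourier, expFourier, synthesis,
    ← integral_const_mul, ← integral_const_mul, ← integral_add i0 (i1.const_mul _),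
    ← integral_add i01 (i2.const_mul _)]
  refine integral_congr_ae (Eventually.of_forall fun ξ => ?_)
  simp only [dispersive_zero_eq, a_zero_eq]
  ring

/-- Differentiation multiplies by `-2iξ = -2i(ξ + iρ₁) - 2ρ₁` on the Fourier side, and the factor `ξ
+ iρ₁` restores the undivided wave. -/
theorem hasDerivAt_freeWave₁ (hF : IsBandLimited F) (x : ℝ) : HasDerivAt (D.freeWave₁ F)
    (-2 * Complex.I * D.freeWave F x - 2 * D.ρ₁ * D.freeWave₁ F x) x := by
  have b0 := isBandLimited_freeWave (D := D) hF
  have b1 := isBandLimited_freeWave₁ (D := D) hF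
  refine (hasDerivAt_expFourier b1.integrable
    (b1.continuous_mul Complex.continuous_ofReal).integrable x).congr_deriv ?_
  have i0 := integrable_mul_exp b0.integrable x
  have i1 := integrable_mul_exp b1.integrable x
  rw [freeWave, freeWave₁, expFourier, expFourier, expFourier, ← integral_const_mul,
    ← integral_const_mul, ← integral_const_mul, ← integral_sub (i0.const_mul _) (i1.const_mul _)]
  refine integral_congr_ae (Eventually.of_forall fun ξ => ?_)
  simp only
  linear_combination (2 * (D.ρ₁ : ℂ) * (((ξ : ℂ) + Complex.I * D.ρ₂) * D.modeWeight ξ * F ξ)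
    * Complex.exp (-2 * Complex.I * (ξ * x))) * Complex.I_sq

theorem hasDerivAt_freeWave₂ (hF : IsBandLimited F) (x : ℝ) : HasDerivAt (D.freeWave₂ F)
    (-2 * Complex.I * D.freeWave F x - 2 * D.ρ₂ * D.freeWave₂ F x) x := by
  have b0 := isBandLimited_freeWave (D := D) hF
  have b1 := isBandLimited_freeWave₂ (D := D) hF
  refine (hasDerivAt_expFourier b1.integrable
    (b1.continuous_mul Complex.continuous_ofReal).integrable x).congr_deriv ?_
  have i0 := integrable_mul_exp b0.integrable x
  have i1 := integrable_mul_exp b1.integrable x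
  rw [freeWave, freeWave₂, expFourier, expFourier, expFourier, ← integral_const_mul,
    ← integral_const_mul, ← integral_const_mul, ← integral_sub (i0.const_mul _) (i1.const_mul _)]
  refine integral_congr_ae (Eventually.of_forall fun ξ => ?_)
  simp only
  linear_combination (2 * (D.ρ₂ : ℂ) * (((ξ : ℂ) + Complex.I * D.ρ₁) * D.modeWeight ξ * F ξ)
    * Complex.exp (-2 * Complex.I * (ξ * x))) * Complex.I_sq

theorem memLp_freeWave (hF : IsBandLimited F) : MemLp (D.freeWave F) 2 volume :=
  memLp_expFourier (isBandLimited_freeWave hF).integrable (isBandLimited_freeWave hF).1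

theorem memLp_freeWave₁ (hF : IsBandLimited F) : MemLp (D.freeWave₁ F) 2 volume :=
  memLp_expFourier (isBandLimited_freeWave₁ hF).integrable (isBandLimited_freeWave₁ hF).1

theorem memLp_freeWave₂ (hF : IsBandLimited F) : MemLp (D.freeWave₂ F) 2 volume :=
  memLp_expFourier (isBandLimited_freeWave₂ hF).integrable (isBandLimited_freeWave₂ hF).1

theorem memLp_synthesis (hF : IsBandLimited F) : MemLp (D.synthesis F) 2 volume := by
  obtain ⟨C, -, hC⟩ := D.exists_norm_residue_le
  have e : D.synthesis F = fun x => D.freeWave F x + D.residue₁ x * D.freeWave₁ F x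
    + D.residue₂ x * D.freeWave₂ F x := funext fun x => synthesis_eq hF x
  rw [e]
  exact ((memLp_freeWave hF).add ((memLp_freeWave₁ hF).continuous_bounded_mul
    D.continuous_residue₁ fun x => (hC x).1)).add ((memLp_freeWave₂ hF).continuous_bounded_mul
    D.continuous_residue₂ fun x => (hC x).2)

/-- Plancherel: the weight is such that `π |(ξ + iρ₁)(ξ + iρ₂)|²` times its square equals `1` for
real `ξ`. -/
theorem integral_conj_freeWave_mul (hF : IsBandLimited F) (hG : IsBandLimited G) :
    ∫ x, conj (D.freeWave F x) * D.freeWave G x = ∫ ξ, conj (F ξ) * G ξ := by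
  rw [freeWave, freeWave, integral_conj_expFourier_mul (isBandLimited_freeWave hF).integrable
    (isBandLimited_freeWave hF).1 (isBandLimited_freeWave hG).integrable
    (isBandLimited_freeWave hG).1, ← integral_const_mul]
  refine integral_congr_ae (Eventually.of_forall fun ξ => ?_)
  have h := D.sq_modeWeight ξ
  have h' : (D.modeWeight ξ : ℂ) ^ 2 = ((Real.pi : ℂ) * (((ξ : ℂ) ^ 2 + (D.ρ₁ : ℂ) ^ 2)
      * ((ξ : ℂ) ^ 2 + (D.ρ₂ : ℂ) ^ 2)))⁻¹ := by
    rw [← Complex.ofReal_pow, h]; push_cast; rfl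
  have hne : ((Real.pi : ℂ) * (((ξ : ℂ) ^ 2 + (D.ρ₁ : ℂ) ^ 2)
      * ((ξ : ℂ) ^ 2 + (D.ρ₂ : ℂ) ^ 2))) ≠ 0 := by
    exact_mod_cast (D.modeWeight_arg_pos ξ).ne'
  simp only [map_mul, map_add, Complex.conj_I, Complex.conj_ofReal]
  have e1 : ((ξ : ℂ) + -Complex.I * D.ρ₁) * (ξ + Complex.I * D.ρ₁) = ξ ^ 2 + D.ρ₁ ^ 2 := by
    linear_combination (-(D.ρ₁ : ℂ) ^ 2) * Complex.I_sq
  have e2 : ((ξ : ℂ) + -Complex.I * D.ρ₂) * (ξ + Complex.I * D.ρ₂) = ξ ^ 2 + D.ρ₂ ^ 2 := by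
    linear_combination (-(D.ρ₂ : ℂ) ^ 2) * Complex.I_sq
  calc _ = Real.pi * ((((ξ : ℂ) + -Complex.I * D.ρ₁) * (ξ + Complex.I * D.ρ₁))
      * (((ξ : ℂ) + -Complex.I * D.ρ₂) * (ξ + Complex.I * D.ρ₂))) * (D.modeWeight ξ : ℂ) ^ 2
      * (conj (F ξ) * G ξ) := by ring
    _ = _ := by rw [e1, e2, h', mul_inv_cancel₀ hne, one_mul]

theorem tendsto_gram_form {B g h : ℝ → ℂ} {l : Filter ℝ} {C : ℝ} (hB : ∀ x, ‖B x‖ * ‖g x‖ ≤ C)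
    (hh : Tendsto h l (𝓝 0)) : Tendsto (fun x => B x * (conj (g x) * h x)) l (𝓝 0) := by
  refine squeeze_zero_norm (a := fun x => C * ‖h x‖) (fun x => ?_) ?_
  · rw [norm_mul, norm_mul, Complex.norm_conj, ← mul_assoc]
    exact mul_le_mul_of_nonneg_right (hB x) (norm_nonneg _)
  · simpa using hh.norm.const_mul C

/-- The integral over `ℝ` of the sesquilinear identity `hasDerivAt_gram_form`. -/
theorem integral_conj_synthesis_of_form (hF : IsBandLimited F) {g g₁ g₂ : ℝ → ℂ} {C : ℝ}
    (hg₁ : ∀ x, HasDerivAt g₁ (-2 * Complex.I * g x - 2 * D.ρ₁ * g₁ x) x)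
    (hg₂ : ∀ x, HasDerivAt g₂ (-2 * Complex.I * g x - 2 * D.ρ₂ * g₂ x) x)
    (hg : MemLp g 2 volume)
    (hw : MemLp (fun x => g x + D.residue₁ x * g₁ x + D.residue₂ x * g₂ x) 2 volume)
    (h11 : ∀ x, ‖D.gram₁₁ x‖ * ‖g₁ x‖ ≤ C) (h12 : ∀ x, ‖D.gram₁₂ x‖ * ‖g₁ x‖ ≤ C)
    (h21 : ∀ x, ‖D.gram₂₁ x‖ * ‖g₂ x‖ ≤ C) (h22 : ∀ x, ‖D.gram₂₂ x‖ * ‖g₂ x‖ ≤ C) :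
    ∫ x, conj (g x + D.residue₁ x * g₁ x + D.residue₂ x * g₂ x) * D.synthesis F x
      = ∫ x, conj (g x) * D.freeWave F x := by
  -- Decay comes from the free waves of `F` alone, by Riemann–Lebesgue. Only the products of the
  -- matrix entries with `g₁, g₂` have to be bounded, which leaves room for exponentially growing
  -- `g_k`.
  have hlim : ∀ l : Filter ℝ, l ≤ cocompact ℝ → Tendsto (fun x =>
      D.gram₁₁ x * (conj (g₁ x) * D.freeWave₁ F x) + D.gram₁₂ x * (conj (g₁ x) * D.freeWave₂ F x)
      + (D.gram₂₁ x * (conj (g₂ x) * D.freeWave₁ F x)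
        + D.gram₂₂ x * (conj (g₂ x) * D.freeWave₂ F x))) l (𝓝 0) := fun l hl => by
    have t1 : Tendsto (D.freeWave₁ F) l (𝓝 0) := (tendsto_expFourier_cocompact _).mono_left hl
    have t2 : Tendsto (D.freeWave₂ F) l (𝓝 0) := (tendsto_expFourier_cocompact _).mono_left hl
    simpa using ((tendsto_gram_form h11 t1).add (tendsto_gram_form h12 t2)).add
      ((tendsto_gram_form h21 t1).add (tendsto_gram_form h22 t2))
  have i1 := integrable_conj_mul hg (memLp_freeWave (D := D) hF)
  have i2 := integrable_conj_mul hw (memLp_synthesis (D := D) hF)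
  have key := integral_of_hasDerivAt_of_tendsto
    (f' := fun x => conj (g x) * D.freeWave F x
      - conj (g x + D.residue₁ x * g₁ x + D.residue₂ x * g₂ x) * D.synthesis F x)
    (fun x => by
      rw [synthesis_eq hF]
      exact D.hasDerivAt_gram_form (hg₁ x) (hg₂ x) (hasDerivAt_freeWave₁ hF x)
        (hasDerivAt_freeWave₂ hF x)) (i1.sub i2) (hlim _ atBot_le_cocompact)
    (hlim _ atTop_le_cocompact)
  rw [integral_sub i1 i2, sub_zero] at key
  exact (sub_eq_zero.1 key).symm

theorem exists_norm_expFourier_le (F : ℝ → ℂ) : ∃ C, ∀ x, ‖expFourier F x‖ ≤ C := by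
  refine ⟨∫ ξ, ‖F ξ‖, fun x => (norm_integral_le_integral_norm _).trans (le_of_eq ?_)⟩
  refine integral_congr_ae (Eventually.of_forall fun ξ => ?_)
  simp only [norm_mul, Complex.norm_exp]
  simp

/-- The dispersive modes at `t = 0` are orthonormal. -/
theorem integral_conj_synthesis_mul (hF : IsBandLimited F) (hG : IsBandLimited G) :
    ∫ x, conj (D.synthesis F x) * D.synthesis G x = ∫ ξ, conj (F ξ) * G ξ := by
  obtain ⟨C, hC0, hC⟩ := D.exists_norm_gram_le
  obtain ⟨C₁, hC₁⟩ := exists_norm_expFourier_le fun ξ : ℝ =>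
    ((ξ : ℂ) + Complex.I * D.ρ₂) * D.modeWeight ξ * F ξ
  obtain ⟨C₂, hC₂⟩ := exists_norm_expFourier_le fun ξ : ℝ =>
    ((ξ : ℂ) + Complex.I * D.ρ₁) * D.modeWeight ξ * F ξ
  have e : D.synthesis F = fun x => D.freeWave F x + D.residue₁ x * D.freeWave₁ F x
    + D.residue₂ x * D.freeWave₂ F x := funext fun x => synthesis_eq hF x
  rw [← integral_conj_freeWave_mul hF hG (D := D),
    ← integral_conj_synthesis_of_form (C := C * (max C₁ C₂)) hG (hasDerivAt_freeWave₁ hF)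
    (hasDerivAt_freeWave₂ hF) (memLp_freeWave hF) (e ▸ memLp_synthesis hF)]
  · rw [e]
  · exact fun x => mul_le_mul (hC x).1 ((hC₁ x).trans (le_max_left _ _)) (norm_nonneg _) hC0.le
  · exact fun x => mul_le_mul (hC x).2.1 ((hC₁ x).trans (le_max_left _ _)) (norm_nonneg _) hC0.le
  · exact fun x => mul_le_mul (hC x).2.2.1 ((hC₂ x).trans (le_max_right _ _)) (norm_nonneg _) hC0.le
  · exact fun x => mul_le_mul (hC x).2.2.2 ((hC₂ x).trans (le_max_right _ _)) (norm_nonneg _) hC0.le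

/-! ### Bound states and their orthogonality to the dispersive modes -/

variable (D) in
/-- The linear combinations of the bound states. -/
noncomputable def boundWave (κ₁ κ₂ : ℂ) (x : ℝ) : ℂ :=
  D.residue₁ x * (κ₁ * Real.exp (-(2 * D.ρ₁ * x))) + D.residue₂ x * (κ₂ * Real.exp (-(2 * D.ρ₂ * x)))

theorem continuous_boundWave (κ₁ κ₂ : ℂ) : Continuous (D.boundWave κ₁ κ₂) := by
  have := D.continuous_residue₁
  have := D.continuous_residue₂
  unfold boundWave
  fun_prop

theorem memLp_inv_one_add_sq : MemLp (fun x : ℝ => (1 + x ^ 2)⁻¹) 2 volume := by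
  have hc : Continuous fun x : ℝ => (1 + x ^ 2)⁻¹ :=
    Continuous.inv₀ (by fun_prop) fun x => by positivity
  rw [memLp_two_iff_integrable_sq hc.aestronglyMeasurable]
  refine integrable_inv_one_add_sq.mono' (hc.pow 2).aestronglyMeasurable
    (Eventually.of_forall fun x => ?_)
  have h1 : (1 + x ^ 2)⁻¹ ≤ 1 := inv_le_one_of_one_le₀ (by nlinarith [sq_nonneg x])
  have h0 : 0 < (1 + x ^ 2)⁻¹ := by positivity
  rw [Real.norm_of_nonneg (by positivity)]
  nlinarith

theorem memLp_boundWave (κ₁ κ₂ : ℂ) : MemLp (D.boundWave κ₁ κ₂) 2 volume := by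
  obtain ⟨K, hK, h⟩ := D.exists_norm_gram_mul_exp_le
  refine memLp_inv_one_add_sq.of_le_mul (c := 4 * K * ‖κ₁‖ + 4 * K * ‖κ₂‖)
    (continuous_boundWave _ _).aestronglyMeasurable (Eventually.of_forall fun x => ?_)
  obtain ⟨h1, h2, h3, h4, h5, h6⟩ := h x
  have r1 := mul_le_mul_of_nonneg_right (D.norm_residue₁_le x) (Real.exp_pos (-(2 * D.ρ₁ * x))).le
  have r2 := mul_le_mul_of_nonneg_right (D.norm_residue₂_le x) (Real.exp_pos (-(2 * D.ρ₂ * x))).le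
  rw [Real.norm_of_nonneg (by positivity)]
  refine (norm_add_le _ _).trans ?_
  rw [norm_mul, norm_mul, norm_mul, norm_mul, Complex.norm_real, Complex.norm_real,
    Real.norm_of_nonneg (Real.exp_pos _).le, Real.norm_of_nonneg (Real.exp_pos _).le]
  have s1 : ‖D.residue₁ x‖ * Real.exp (-(2 * D.ρ₁ * x)) ≤ 4 * K * (1 + x ^ 2)⁻¹ := by linarith
  have s2 : ‖D.residue₂ x‖ * Real.exp (-(2 * D.ρ₂ * x)) ≤ 4 * K * (1 + x ^ 2)⁻¹ := by linarith
  have t1 := mul_le_mul_of_nonneg_left s1 (norm_nonneg κ₁)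
  have t2 := mul_le_mul_of_nonneg_left s2 (norm_nonneg κ₂)
  linarith

/-- A bound wave is the dressing of `g = 0` with `g_k = κ_k e^{-2ρ_k x}`, which solves `g_k' = -2ρ_k
g_k`. The integrated sesquilinear identity then equates the integral with that of `conj 0 · h`. -/
theorem integral_conj_boundWave_mul_synthesis (κ₁ κ₂ : ℂ) (hF : IsBandLimited F) :
    ∫ x, conj (D.boundWave κ₁ κ₂ x) * D.synthesis F x = 0 := by
  obtain ⟨K, hK, h⟩ := D.exists_norm_gram_mul_exp_le
  have hder : ∀ (ρ : ℝ) (κ : ℂ) (x : ℝ), HasDerivAt (fun x : ℝ => κ * (Real.exp (-(2 * ρ * x)) : ℂ))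
      (-2 * Complex.I * 0 - 2 * ρ * (κ * (Real.exp (-(2 * ρ * x)) : ℂ))) x := fun ρ κ x => by
    have h := (hasDerivAt_ofReal_exp (-ρ) x).const_mul κ
    have e : ∀ y : ℝ, 2 * -ρ * y = -(2 * ρ * y) := fun y => by ring
    simp only [e] at h
    exact h.congr_deriv (by push_cast; ring)
  have hinv : ∀ x : ℝ, (1 + x ^ 2)⁻¹ ≤ 1 := fun x =>
    inv_le_one_of_one_le₀ (by nlinarith [sq_nonneg x])
  have hb : ∀ (b κ : ℂ) (ρ x : ℝ), ‖b‖ * Real.exp (-(2 * ρ * x)) ≤ K * (1 + x ^ 2)⁻¹ →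
      ‖κ‖ ≤ ‖κ₁‖ + ‖κ₂‖ →
      ‖b‖ * ‖κ * (Real.exp (-(2 * ρ * x)) : ℂ)‖ ≤ (‖κ₁‖ + ‖κ₂‖) * K := fun b κ ρ x hb hκ => by
    rw [norm_mul, Complex.norm_real, Real.norm_of_nonneg (Real.exp_pos _).le, mul_left_comm]
    refine mul_le_mul hκ (hb.trans ?_) (by positivity) (by positivity)
    exact mul_le_of_le_one_right hK.le (hinv x)
  have hk1 : ‖κ₁‖ ≤ ‖κ₁‖ + ‖κ₂‖ := by linarith [norm_nonneg κ₂]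
  have hk2 : ‖κ₂‖ ≤ ‖κ₁‖ + ‖κ₂‖ := by linarith [norm_nonneg κ₁]
  have key := integral_conj_synthesis_of_form (D := D) (F := F) hF (g := fun _ => 0)
    (C := (‖κ₁‖ + ‖κ₂‖) * K)
    (g₁ := fun x => κ₁ * (Real.exp (-(2 * D.ρ₁ * x)) : ℂ))
    (g₂ := fun x => κ₂ * (Real.exp (-(2 * D.ρ₂ * x)) : ℂ)) (hder D.ρ₁ κ₁) (hder D.ρ₂ κ₂)
    MemLp.zero' (by simp only [zero_add]; exact memLp_boundWave κ₁ κ₂)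
    (fun x => hb _ _ _ _ (h x).1 hk1) (fun x => hb _ _ _ _ (h x).2.1 hk1)
    (fun x => hb _ _ _ _ (h x).2.2.2.2.1 hk2) (fun x => hb _ _ _ _ (h x).2.2.2.2.2 hk2)
  simpa [boundWave] using key

-- At `ξ = -iρ₁` every term with the factor `ξ + iρ₁` disappears; only the first residue survives,
-- multiplied by `ξ + iρ₂ = i(ρ₂ - ρ₁)`.
variable (D) in
theorem a_zero_neg_I_mul_ρ₁ (x : ℝ) : D.a x 0 (-Complex.I * D.ρ₁)
    = Complex.I * (D.ρ₂ - D.ρ₁) * (D.residue₁ x * Real.exp (-(2 * D.ρ₁ * x))) := by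
  rw [a_zero_eq, Complex.ofReal_exp]
  have : -2 * Complex.I * (-Complex.I * D.ρ₁ * x) = ((-(2 * D.ρ₁ * x) : ℝ) : ℂ) := by
    push_cast; linear_combination (2 * (D.ρ₁ : ℂ) * x) * Complex.I_sq
  rw [this]
  ring

variable (D) in
theorem a_zero_neg_I_mul_ρ₂ (x : ℝ) : D.a x 0 (-Complex.I * D.ρ₂)
    = -(Complex.I * (D.ρ₂ - D.ρ₁)) * (D.residue₂ x * Real.exp (-(2 * D.ρ₂ * x))) := by
  rw [a_zero_eq, Complex.ofReal_exp]
  have : -2 * Complex.I * (-Complex.I * D.ρ₂ * x) = ((-(2 * D.ρ₂ * x) : ℝ) : ℂ) := by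
    push_cast; linear_combination (2 * (D.ρ₂ : ℂ) * x) * Complex.I_sq
  rw [this]
  ring

variable (D) in
theorem exists_boundEven_eq : ∃ κ₁ κ₂ : ℂ, D.boundEven 0 = D.boundWave κ₁ κ₂ := by
  refine ⟨(1 / Real.sqrt (4 * (D.ρ₁ + D.ρ₂)) : ℝ) * ((2 / (D.ρ₁ - D.ρ₂) : ℝ) *
    (Complex.exp (Complex.I * D.θ₁) * (Complex.I * (D.ρ₂ - D.ρ₁)))),
    (1 / Real.sqrt (4 * (D.ρ₁ + D.ρ₂)) : ℝ) * ((2 / (D.ρ₂ - D.ρ₁) : ℝ) *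
    (Complex.exp (Complex.I * D.θ₂) * -(Complex.I * (D.ρ₂ - D.ρ₁)))), funext fun x => ?_⟩
  rw [boundEven, a_zero_neg_I_mul_ρ₁, a_zero_neg_I_mul_ρ₂, boundWave]
  ring

variable (D) in
theorem exists_boundOdd_eq : ∃ κ₁ κ₂ : ℂ, D.boundOdd 0 = D.boundWave κ₁ κ₂ := by
  refine ⟨(1 / Real.sqrt (4 * (D.ρ₁ + D.ρ₂)) : ℝ) *
    ((Real.sqrt (D.ρ₂ / D.ρ₁) * (2 / (D.ρ₁ - D.ρ₂)) : ℝ) *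
    (Complex.exp (Complex.I * D.θ₁) * (Complex.I * (D.ρ₂ - D.ρ₁)))),
    (1 / Real.sqrt (4 * (D.ρ₁ + D.ρ₂)) : ℝ) *
    ((Real.sqrt (D.ρ₁ / D.ρ₂) * (2 / (D.ρ₂ - D.ρ₁)) : ℝ) *
    (Complex.exp (Complex.I * D.θ₂) * -(Complex.I * (D.ρ₂ - D.ρ₁)))), funext fun x => ?_⟩
  rw [boundOdd, a_zero_neg_I_mul_ρ₁, a_zero_neg_I_mul_ρ₂, boundWave]
  ring

end TwoSolitonData

/-! ### Calculus of functions with two controlled derivatives -/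

/-- `f` is twice continuously differentiable with `|f| ≤ C`, `|f'| ≤ C T`, `|f''| ≤ C T²`. -/
def BoundedJet (C T : ℝ) (f : ℝ → ℂ) : Prop :=
  ∃ f' f'' : ℝ → ℂ, (∀ ξ, HasDerivAt f (f' ξ) ξ) ∧ (∀ ξ, HasDerivAt f' (f'' ξ) ξ) ∧
    Continuous f'' ∧ ∀ ξ, ‖f ξ‖ ≤ C ∧ ‖f' ξ‖ ≤ C * T ∧ ‖f'' ξ‖ ≤ C * T ^ 2

namespace BoundedJet

variable {C C' T T' : ℝ} {f g : ℝ → ℂ}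

theorem norm_le (hf : BoundedJet C T f) (ξ : ℝ) : ‖f ξ‖ ≤ C := by
  obtain ⟨f', f'', h1, h2, h3, h4⟩ := hf
  exact (h4 ξ).1

theorem nonneg (hf : BoundedJet C T f) : 0 ≤ C := (norm_nonneg _).trans (hf.norm_le 0)

theorem mono (hf : BoundedJet C T f) (hT : 0 ≤ T) (hC : C ≤ C') (hTT : T ≤ T') :
    BoundedJet C' T' f := by
  have h0 := hf.nonneg
  have h0' := h0.trans hC
  obtain ⟨f', f'', h1, h2, h3, h4⟩ := hf
  refine ⟨f', f'', h1, h2, h3, fun ξ => ⟨(h4 ξ).1.trans hC, (h4 ξ).2.1.trans ?_,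
    (h4 ξ).2.2.trans ?_⟩⟩ <;> gcongr

theorem const (c : ℂ) : BoundedJet ‖c‖ 0 fun _ => c :=
  ⟨fun _ => 0, fun _ => 0, fun ξ => hasDerivAt_const ξ c, fun ξ => hasDerivAt_const ξ 0,
    continuous_const, fun ξ => by simp⟩

theorem add (hf : BoundedJet C T f) (hg : BoundedJet C' T g) :
    BoundedJet (C + C') T fun ξ => f ξ + g ξ := by
  obtain ⟨f', f'', h1, h2, h3, h4⟩ := hf
  obtain ⟨g', g'', k1, k2, k3, k4⟩ := hg
  refine ⟨fun ξ => f' ξ + g' ξ, fun ξ => f'' ξ + g'' ξ, fun ξ => (h1 ξ).fun_add (k1 ξ),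
    fun ξ => (h2 ξ).fun_add (k2 ξ), h3.add k3, fun ξ => ⟨?_, ?_, ?_⟩⟩
  · exact (norm_add_le _ _).trans (by linarith [(h4 ξ).1, (k4 ξ).1])
  · exact (norm_add_le _ _).trans (by linarith [(h4 ξ).2.1, (k4 ξ).2.1])
  · exact (norm_add_le _ _).trans (by linarith [(h4 ξ).2.2, (k4 ξ).2.2])

/-- By Leibniz the derivative scales add, because `T² + 2TT' + T'² = (T + T')²`. Keeping `T` apart
from `C` is what makes the growth in `x` and `y` easy to track. -/
theorem mul (hf : BoundedJet C T f) (hg : BoundedJet C' T' g) (hT : 0 ≤ T) :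
    BoundedJet (C * C') (T + T') fun ξ => f ξ * g ξ := by
  have c1 := hf.nonneg
  have c2 := hg.nonneg
  obtain ⟨f', f'', h1, h2, h3, h4⟩ := hf
  obtain ⟨g', g'', k1, k2, k3, k4⟩ := hg
  have hfc : Continuous f := continuous_iff_continuousAt.2 fun ξ => (h1 ξ).continuousAt
  have hgc : Continuous g := continuous_iff_continuousAt.2 fun ξ => (k1 ξ).continuousAt
  have hfc' : Continuous f' := continuous_iff_continuousAt.2 fun ξ => (h2 ξ).continuousAt
  have hgc' : Continuous g' := continuous_iff_continuousAt.2 fun ξ => (k2 ξ).continuousAt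
  have m : ∀ {a b : ℂ} {A B : ℝ}, 0 ≤ A → ‖a‖ ≤ A → ‖b‖ ≤ B → ‖a * b‖ ≤ A * B :=
    fun hA ha hb => (norm_mul_le _ _).trans (mul_le_mul ha hb (norm_nonneg _) hA)
  refine ⟨fun ξ => f' ξ * g ξ + f ξ * g' ξ,
    fun ξ => (f'' ξ * g ξ + f' ξ * g' ξ) + (f' ξ * g' ξ + f ξ * g'' ξ),
    fun ξ => (h1 ξ).fun_mul (k1 ξ),
    fun ξ => ((h2 ξ).fun_mul (k1 ξ)).fun_add ((h1 ξ).fun_mul (k2 ξ)), by fun_prop,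
    fun ξ => ⟨m c1 (h4 ξ).1 (k4 ξ).1, ?_, ?_⟩⟩
  · refine (norm_add_le _ _).trans ?_
    have := m (by positivity) (h4 ξ).2.1 (k4 ξ).1
    have := m c1 (h4 ξ).1 (k4 ξ).2.1
    linarith
  · refine (norm_add_le _ _).trans ((add_le_add (norm_add_le _ _) (norm_add_le _ _)).trans ?_)
    have := m (by positivity) (h4 ξ).2.2 (k4 ξ).1
    have := m c1 (h4 ξ).1 (k4 ξ).2.2
    have := m (by positivity) (h4 ξ).2.1 (k4 ξ).2.1
    linarith

theorem const_mul (hf : BoundedJet C T f) (c : ℂ) :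
    BoundedJet (‖c‖ * C) T fun ξ => c * f ξ := by
  simpa using (BoundedJet.const c).mul hf le_rfl

theorem comp_neg (hf : BoundedJet C T f) : BoundedJet C T fun ξ => f (-ξ) := by
  obtain ⟨f', f'', h1, h2, h3, h4⟩ := hf
  refine ⟨fun ξ => -f' (-ξ), fun ξ => f'' (-ξ), fun ξ => ?_, fun ξ => ?_, by fun_prop,
    fun ξ => ⟨(h4 _).1, by rw [norm_neg]; exact (h4 _).2.1, (h4 _).2.2⟩⟩
  · exact ((h1 (-ξ)).scomp ξ (hasDerivAt_neg ξ)).congr_deriv (by simp)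
  · exact ((h2 (-ξ)).scomp ξ (hasDerivAt_neg ξ)).fun_neg.congr_deriv (by simp)

theorem star (hf : BoundedJet C T f) : BoundedJet C T fun ξ => conj (f ξ) := by
  obtain ⟨f', f'', h1, h2, h3, h4⟩ := hf
  refine ⟨fun ξ => conj (f' ξ), fun ξ => conj (f'' ξ), fun ξ => (h1 ξ).star,
    fun ξ => (h2 ξ).star, Complex.continuous_conj.comp h3, fun ξ => ?_⟩
  simpa only [Complex.norm_conj] using h4 ξ

theorem exp (x : ℝ) :
    BoundedJet 1 (2 * |x|) fun ξ : ℝ => Complex.exp (-2 * Complex.I * (ξ * x)) := by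
  have hd : ∀ ξ : ℝ, HasDerivAt (fun ξ : ℝ => Complex.exp (-2 * Complex.I * (ξ * x)))
      (-2 * Complex.I * x * Complex.exp (-2 * Complex.I * (ξ * x))) ξ := fun ξ => by
    have h : HasDerivAt (fun y : ℝ => -2 * Complex.I * ((y : ℂ) * (x : ℂ)))
        (-2 * Complex.I * (1 * x)) ξ :=
      ((Complex.ofRealCLM.hasDerivAt (x := ξ)).mul_const (x : ℂ)).const_mul _
    exact h.cexp.congr_deriv (by ring)
  have hn : ∀ ξ : ℝ, ‖Complex.exp (-2 * Complex.I * (ξ * x))‖ = 1 := fun ξ => by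
    rw [Complex.norm_exp]; simp
  refine ⟨_, _, hd, fun ξ => (hd ξ).const_mul _, by fun_prop, fun ξ => ⟨(hn ξ).le, ?_, ?_⟩⟩
  · rw [norm_mul, hn]; simp
  · rw [norm_mul, norm_mul, norm_mul (_ * _) (Complex.exp _), hn]
    simp [mul_pow]
    nlinarith [sq_abs x]

end BoundedJet

/-- The function `1 / √(ξ² + ρ²)`. -/
noncomputable def invSqrt (ρ ξ : ℝ) : ℝ := (Real.sqrt (ξ ^ 2 + ρ ^ 2))⁻¹

theorem invSqrt_pos {ρ : ℝ} (hρ : 0 < ρ) (ξ : ℝ) : 0 < invSqrt ρ ξ :=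
  inv_pos.2 (Real.sqrt_pos.2 (by positivity))

theorem invSqrt_le {ρ : ℝ} (hρ : 0 < ρ) (ξ : ℝ) : invSqrt ρ ξ ≤ ρ⁻¹ :=
  inv_anti₀ hρ (Real.le_sqrt_of_sq_le (by nlinarith [sq_nonneg ξ]))

/-- With `n = (ξ² + ρ²)^{-1/2}` and `e = ξn`, the point `(e, ρn)` lies on the unit circle. Since `n'
= -e n²` and `e' = ρ² n³`, all derivatives of `n` and `e` are polynomials in bounded quantities. -/
theorem sq_mul_invSqrt {ρ : ℝ} (hρ : 0 < ρ) (ξ : ℝ) :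
    (ξ * invSqrt ρ ξ) ^ 2 + ρ ^ 2 * invSqrt ρ ξ ^ 2 = 1 := by
  rw [mul_pow, ← add_mul, invSqrt, inv_pow, Real.sq_sqrt (by positivity)]
  exact mul_inv_cancel₀ (by positivity)

theorem abs_mul_invSqrt_le {ρ : ℝ} (hρ : 0 < ρ) (ξ : ℝ) : |ξ * invSqrt ρ ξ| ≤ 1 := by
  rw [← sq_le_one_iff_abs_le_one]
  nlinarith [sq_mul_invSqrt hρ ξ, sq_nonneg (ρ * invSqrt ρ ξ)]

theorem hasDerivAt_invSqrt {ρ : ℝ} (hρ : 0 < ρ) (ξ : ℝ) :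
    HasDerivAt (invSqrt ρ) (-(ξ * invSqrt ρ ξ) * invSqrt ρ ξ ^ 2) ξ := by
  have h0 : (0 : ℝ) < ξ ^ 2 + ρ ^ 2 := by positivity
  have h : HasDerivAt (fun ξ : ℝ => ξ ^ 2 + ρ ^ 2) (2 * ξ) ξ := by
    simpa using ((hasDerivAt_id ξ).fun_pow 2).add_const (ρ ^ 2)
  have hs := (h.sqrt h0.ne').fun_inv (Real.sqrt_pos.2 h0).ne'
  refine hs.congr_deriv ?_
  rw [invSqrt]
  have := (Real.sqrt_pos.2 h0).ne'
  field_simp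

theorem hasDerivAt_mul_invSqrt {ρ : ℝ} (hρ : 0 < ρ) (ξ : ℝ) :
    HasDerivAt (fun ξ => ξ * invSqrt ρ ξ) (ρ ^ 2 * invSqrt ρ ξ ^ 3) ξ := by
  refine ((hasDerivAt_id ξ).fun_mul (hasDerivAt_invSqrt hρ ξ)).congr_deriv ?_
  have := sq_mul_invSqrt hρ ξ
  simp only [id]
  linear_combination (-invSqrt ρ ξ) * this

theorem continuous_invSqrt {ρ : ℝ} (hρ : 0 < ρ) : Continuous (invSqrt ρ) :=
  continuous_iff_continuousAt.2 fun ξ => (hasDerivAt_invSqrt hρ ξ).continuousAt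

theorem boundedJet_invSqrt {ρ : ℝ} (hρ : 0 < ρ) :
    BoundedJet ρ⁻¹ (2 * ρ⁻¹) fun ξ => (invSqrt ρ ξ : ℂ) := by
  have hc := continuous_invSqrt hρ
  have d1 := fun ξ => hasDerivAt_invSqrt hρ ξ
  have d2 : ∀ ξ, HasDerivAt (fun ξ => -(ξ * invSqrt ρ ξ) * invSqrt ρ ξ ^ 2)
      (-(ρ ^ 2) * invSqrt ρ ξ ^ 5 + 2 * (ξ * invSqrt ρ ξ) ^ 2 * invSqrt ρ ξ ^ 3) ξ := fun ξ => by
    refine ((hasDerivAt_mul_invSqrt hρ ξ).fun_neg.fun_mul ((d1 ξ).fun_pow 2)).congr_deriv ?_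
    push_cast; ring
  refine ⟨_, _, fun ξ => (d1 ξ).ofReal_comp, fun ξ => (d2 ξ).ofReal_comp,
    Complex.continuous_ofReal.comp (by fun_prop), fun ξ => ?_⟩
  rw [Complex.norm_real, Complex.norm_real, Complex.norm_real, Real.norm_eq_abs, Real.norm_eq_abs,
    Real.norm_eq_abs]
  have hn0 := invSqrt_pos hρ ξ
  have hn := invSqrt_le hρ ξ
  have he := abs_mul_invSqrt_le hρ ξ
  have hr := sq_mul_invSqrt hρ ξ
  set n := invSqrt ρ ξ
  set e := ξ * n
  have hr0 : 0 < ρ⁻¹ := inv_pos.2 hρ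
  have hn2 : n ^ 2 ≤ ρ⁻¹ ^ 2 := by gcongr
  have hn3 : n ^ 3 ≤ ρ⁻¹ ^ 3 := by gcongr
  have he2 : e ^ 2 ≤ 1 := (sq_le_one_iff_abs_le_one e).2 he
  refine ⟨by rw [abs_of_pos hn0]; exact hn, ?_, ?_⟩
  · rw [abs_mul, abs_neg, abs_of_nonneg (sq_nonneg n)]
    have : |e| * n ^ 2 ≤ 1 * ρ⁻¹ ^ 2 := by gcongr
    nlinarith
  -- The circle relation `ρ²n² = 1 - e²` removes `ρ` from the second derivative.
  · have e5 : -(ρ ^ 2) * n ^ 5 + 2 * e ^ 2 * n ^ 3 = (3 * e ^ 2 - 1) * n ^ 3 := by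
      linear_combination (-n ^ 3) * hr
    rw [e5, abs_mul, abs_of_pos (pow_pos hn0 3)]
    have : |3 * e ^ 2 - 1| ≤ 4 := by rw [abs_le]; constructor <;> nlinarith [sq_nonneg e]
    calc |3 * e ^ 2 - 1| * n ^ 3 ≤ 4 * ρ⁻¹ ^ 3 := by gcongr
      _ = _ := by ring

theorem boundedJet_mul_invSqrt {ρ : ℝ} (hρ : 0 < ρ) :
    BoundedJet 1 (2 * ρ⁻¹) fun ξ => ((ξ * invSqrt ρ ξ : ℝ) : ℂ) := by
  have hc := continuous_invSqrt hρ
  have d1 := fun ξ => hasDerivAt_mul_invSqrt hρ ξ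
  have d2 : ∀ ξ, HasDerivAt (fun ξ => ρ ^ 2 * invSqrt ρ ξ ^ 3)
      (-3 * ρ ^ 2 * (ξ * invSqrt ρ ξ) * invSqrt ρ ξ ^ 4) ξ := fun ξ => by
    refine (((hasDerivAt_invSqrt hρ ξ).fun_pow 3).const_mul _).congr_deriv ?_
    push_cast; ring
  refine ⟨_, _, fun ξ => (d1 ξ).ofReal_comp, fun ξ => (d2 ξ).ofReal_comp,
    Complex.continuous_ofReal.comp (by fun_prop), fun ξ => ?_⟩
  rw [Complex.norm_real, Complex.norm_real, Complex.norm_real, Real.norm_eq_abs, Real.norm_eq_abs,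
    Real.norm_eq_abs]
  have hn0 := invSqrt_pos hρ ξ
  have hn := invSqrt_le hρ ξ
  have he := abs_mul_invSqrt_le hρ ξ
  have hr := sq_mul_invSqrt hρ ξ
  set n := invSqrt ρ ξ
  set e := ξ * n
  have hr0 : 0 < ρ⁻¹ := inv_pos.2 hρ
  have hn2 : n ^ 2 ≤ ρ⁻¹ ^ 2 := by gcongr
  have hρn : ρ ^ 2 * n ^ 2 ≤ 1 := by nlinarith [sq_nonneg e]
  refine ⟨he, ?_, ?_⟩
  · rw [abs_of_pos (by positivity)]
    calc ρ ^ 2 * n ^ 3 = (ρ ^ 2 * n ^ 2) * n := by ring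
      _ ≤ 1 * ρ⁻¹ := by gcongr
      _ ≤ _ := by linarith
  · have : |-3 * ρ ^ 2 * e * n ^ 4| = 3 * (ρ ^ 2 * n ^ 2) * |e| * n ^ 2 := by
      rw [abs_mul, abs_mul, abs_mul, abs_of_pos (pow_pos hn0 4), abs_of_pos (pow_pos hρ 2)]
      norm_num; ring
    rw [this]
    calc 3 * (ρ ^ 2 * n ^ 2) * |e| * n ^ 2 ≤ 3 * 1 * 1 * ρ⁻¹ ^ 2 := by gcongr
      _ ≤ _ := by nlinarith

namespace TwoSolitonData

variable (D : TwoSolitonData)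

theorem modeWeight_eq (ξ : ℝ) : D.modeWeight ξ
    = (Real.sqrt Real.pi)⁻¹ * (invSqrt D.ρ₁ ξ * invSqrt D.ρ₂ ξ) := by
  rw [modeWeight, Real.sqrt_mul Real.pi_pos.le, Real.sqrt_mul (by positivity), mul_inv, mul_inv]
  rfl

theorem exists_norm_a0_a1_le : ∃ A : ℝ, 0 < A ∧ ∀ x, ‖D.a1 x 0‖ ≤ A ∧ ‖D.a0 x 0‖ ≤ A := by
  obtain ⟨C, hC, h⟩ := D.exists_norm_residue_le
  have h1 := D.ρ₁_pos
  have h2 := D.ρ₂_pos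
  refine ⟨(D.ρ₂ + D.ρ₁) + 2 * C + D.ρ₁ * D.ρ₂ + (D.ρ₂ + D.ρ₁) * C, by positivity, fun x => ?_⟩
  obtain ⟨r1, r2⟩ := h x
  have n1 : ‖(D.ρ₁ : ℂ)‖ = D.ρ₁ := by rw [Complex.norm_real, Real.norm_of_nonneg h1.le]
  have n2 : ‖(D.ρ₂ : ℂ)‖ = D.ρ₂ := by rw [Complex.norm_real, Real.norm_of_nonneg h2.le]
  constructor
  · rw [a1_zero_eq]
    refine norm_add₃_le.trans ?_
    rw [norm_mul, Complex.norm_I, ← Complex.ofReal_add, Complex.norm_real,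
      Real.norm_of_nonneg (add_pos h2 h1).le]
    have : 0 ≤ D.ρ₁ * D.ρ₂ + (D.ρ₂ + D.ρ₁) * C := by positivity
    linarith
  · rw [a0_zero_eq]
    refine norm_add₃_le.trans ?_
    simp only [norm_mul, norm_neg, Complex.norm_I, one_mul, n1, n2]
    have := mul_le_mul_of_nonneg_left r1 h2.le
    have := mul_le_mul_of_nonneg_left r2 h1.le
    linarith

theorem dispersive_zero_eq_invSqrt (x ξ : ℝ) : D.dispersive 0 x ξ
    = ((Real.sqrt Real.pi)⁻¹ : ℝ) * ((((ξ * invSqrt D.ρ₁ ξ : ℝ) : ℂ) * ((ξ * invSqrt D.ρ₂ ξ : ℝ) : ℂ)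
      + D.a1 x 0 * (((ξ * invSqrt D.ρ₁ ξ : ℝ) : ℂ) * (invSqrt D.ρ₂ ξ : ℂ))
      + D.a0 x 0 * ((invSqrt D.ρ₁ ξ : ℂ) * (invSqrt D.ρ₂ ξ : ℂ)))
      * Complex.exp (-2 * Complex.I * (ξ * x))) := by
  rw [dispersive_zero_eq, modeWeight_eq, a]
  have : -2 * Complex.I * ((ξ : ℂ) * x + (ξ : ℂ) ^ 2 * ((0 : ℝ) : ℂ))
    = -2 * Complex.I * (ξ * x) := by simp
  rw [this]
  push_cast
  ring

/-- The weighted quadratic polynomial is a combination of products of `ξ/√(ξ² + ρ_k²)` and `1/√(ξ² +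
ρ_k²)` with coefficients bounded in `x`. Growth in `x` under `∂_ξ` comes only from `e^{-2iξx}`, at
rate `2|x|`. -/
theorem exists_boundedJet_dispersive : ∃ C T : ℝ, 0 < C ∧ 0 < T ∧
    ∀ x, BoundedJet C (T + 2 * |x|) (D.dispersive 0 x) := by
  obtain ⟨A, hA, h⟩ := D.exists_norm_a0_a1_le
  have h1 := D.ρ₁_pos
  have h2 := D.ρ₂_pos
  have r1 : 0 ≤ 2 * D.ρ₁⁻¹ := by positivity
  have hpi : 0 < (Real.sqrt Real.pi)⁻¹ := inv_pos.2 (Real.sqrt_pos.2 Real.pi_pos)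
  refine ⟨(Real.sqrt Real.pi)⁻¹ * ((1 * 1 + A * (1 * D.ρ₂⁻¹) + A * (D.ρ₁⁻¹ * D.ρ₂⁻¹)) * 1),
    2 * D.ρ₁⁻¹ + 2 * D.ρ₂⁻¹, by positivity, by positivity, fun x => ?_⟩
  have e : D.dispersive 0 x = _ := funext fun ξ => D.dispersive_zero_eq_invSqrt x ξ
  rw [e]
  have j1 := boundedJet_invSqrt h1
  have j2 := boundedJet_invSqrt h2
  have k1 := boundedJet_mul_invSqrt h1
  have k2 := boundedJet_mul_invSqrt h2
  have t1 := k1.mul k2 r1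
  have t2 := ((k1.mul j2 r1).const_mul (D.a1 x 0)).mono (by positivity)
    (mul_le_mul_of_nonneg_right (h x).1 (by positivity)) le_rfl
  have t3 := ((j1.mul j2 r1).const_mul (D.a0 x 0)).mono (by positivity)
    (mul_le_mul_of_nonneg_right (h x).2 (by positivity)) le_rfl
  have t := ((((t1.add t2).add t3).mul (BoundedJet.exp x) (by positivity)).const_mul
    (((Real.sqrt Real.pi)⁻¹ : ℝ) : ℂ))
  rwa [Complex.norm_real, Real.norm_of_nonneg hpi.le] at t

theorem continuous_a1_zero : Continuous fun x => D.a1 x 0 := by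
  have := D.continuous_residue₁
  have := D.continuous_residue₂
  simp only [a1_zero_eq]
  fun_prop

theorem continuous_a0_zero : Continuous fun x => D.a0 x 0 := by
  have := D.continuous_residue₁
  have := D.continuous_residue₂
  simp only [a0_zero_eq]
  fun_prop

theorem continuous_dispersive_zero : Continuous fun p : ℝ × ℝ => D.dispersive 0 p.1 p.2 := by
  have := D.continuous_a1_zero
  have := D.continuous_a0_zero
  have := continuous_invSqrt D.ρ₁_pos
  have := continuous_invSqrt D.ρ₂_pos
  simp only [dispersive_zero_eq_invSqrt]
  fun_prop

/-- The modes `(Ψ_d(x, ξ) + ε Ψ_d(x, -ξ)) / √2`, even for `ε = 1` and odd for `ε = -1`. -/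
noncomputable def parityMode (ε : ℂ) (x ξ : ℝ) : ℂ :=
  ((Real.sqrt 2)⁻¹ : ℝ) * (D.dispersive 0 x ξ + ε * D.dispersive 0 x (-ξ))

theorem ofReal_sqrt_two_pi_mul (u : ℝ) :
    ((Real.sqrt (2 * Real.pi * u) : ℂ))⁻¹
      = ((Real.sqrt 2)⁻¹ : ℝ) * (((Real.sqrt (Real.pi * u))⁻¹ : ℝ) : ℂ) := by
  rw [mul_assoc, Real.sqrt_mul (by norm_num)]
  push_cast
  rw [mul_inv]

theorem modeWeight_neg (ξ : ℝ) : D.modeWeight (-ξ) = D.modeWeight ξ := by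
  rw [modeWeight, modeWeight, neg_sq]

theorem dispersiveEven_zero_eq : D.dispersiveEven 0 = D.parityMode 1 := by
  funext x ξ
  rw [dispersiveEven, div_eq_mul_inv, ofReal_sqrt_two_pi_mul, parityMode, dispersive_zero_eq,
    dispersive_zero_eq, modeWeight_neg, modeWeight]
  push_cast
  ring

theorem dispersiveOdd_zero_eq : D.dispersiveOdd 0 = D.parityMode (-1) := by
  funext x ξ
  rw [dispersiveOdd, div_eq_mul_inv, ofReal_sqrt_two_pi_mul, parityMode, dispersive_zero_eq,
    dispersive_zero_eq, modeWeight_neg, modeWeight]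
  push_cast
  ring

theorem exists_boundedJet_parityMode {ε : ℂ} (hε : ‖ε‖ = 1) : ∃ C T : ℝ, 0 < C ∧ 0 < T ∧
    ∀ x, BoundedJet C (T + 2 * |x|) (D.parityMode ε x) := by
  obtain ⟨C, T, hC, hT, h⟩ := D.exists_boundedJet_dispersive
  have h2 : 0 < (Real.sqrt 2)⁻¹ := by positivity
  refine ⟨(Real.sqrt 2)⁻¹ * (C + 1 * C), T, by positivity, hT, fun x => ?_⟩
  have t := ((h x).add ((h x).comp_neg.const_mul ε)).const_mul
    (((Real.sqrt 2)⁻¹ : ℝ) : ℂ)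
  rwa [Complex.norm_real, Real.norm_of_nonneg h2.le, hε] at t

theorem continuous_parityMode (ε : ℂ) : Continuous fun p : ℝ × ℝ => D.parityMode ε p.1 p.2 := by
  have h := D.continuous_dispersive_zero
  have h' := h.comp (continuous_fst.prodMk continuous_snd.neg : Continuous fun p : ℝ × ℝ => (p.1, -p.2))
  simp only [Function.comp_def] at h'
  exact continuous_const.mul (h.add (continuous_const.mul h'))

end TwoSolitonData

/-! ### Stationary phase on the half line -/

/-- The multiplier `exp (-2 i t ξ²)`. -/
noncomputable def schrodingerPhase (t ξ : ℝ) : ℂ :=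
  Complex.exp (-Complex.I * t * ((2 * ξ ^ 2 : ℝ) : ℂ))

theorem norm_schrodingerPhase (t ξ : ℝ) : ‖schrodingerPhase t ξ‖ = 1 := by
  rw [schrodingerPhase, show -Complex.I * t * ((2 * ξ ^ 2 : ℝ) : ℂ)
    = ((-(t * (2 * ξ ^ 2)) : ℝ) : ℂ) * Complex.I by push_cast; ring, Complex.norm_exp_ofReal_mul_I]

theorem continuous_schrodingerPhase (t : ℝ) : Continuous (schrodingerPhase t) := by
  unfold schrodingerPhase; fun_prop

theorem schrodingerPhase_neg (t ξ : ℝ) : schrodingerPhase t (-ξ) = schrodingerPhase t ξ := by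
  rw [schrodingerPhase, schrodingerPhase, neg_sq]

theorem hasDerivAt_schrodingerPhase (t ξ : ℝ) : HasDerivAt (schrodingerPhase t)
    (-4 * Complex.I * t * ξ * schrodingerPhase t ξ) ξ := by
  have h : HasDerivAt (fun ξ : ℝ => 2 * ξ ^ 2) (4 * ξ) ξ :=
    (((hasDerivAt_id ξ).fun_pow 2).const_mul 2).congr_deriv (by simp; ring)
  have h2 := (h.ofReal_comp.const_mul (-Complex.I * t)).cexp
  exact h2.congr_deriv (by rw [schrodingerPhase]; push_cast; ring)

theorem integral_inv_sq_le {δ R : ℝ} (hδ : 0 < δ) (hR : δ ≤ R) :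
    ∫ ξ in δ..R, (ξ ^ 2)⁻¹ ≤ δ⁻¹ := by
  have hpos : ∀ ξ ∈ Set.uIcc δ R, 0 < ξ := fun ξ hξ => by
    rw [Set.uIcc_of_le hR] at hξ; exact hδ.trans_le hξ.1
  have : ∫ ξ in δ..R, (ξ ^ 2)⁻¹ = -R⁻¹ - -δ⁻¹ := by
    refine intervalIntegral.integral_eq_sub_of_hasDerivAt (f := fun ξ => -ξ⁻¹) (fun ξ hξ => ?_) ?_
    · exact (hasDerivAt_inv (hpos ξ hξ).ne').fun_neg.congr_deriv (by ring)
    · refine ContinuousOn.intervalIntegrable (ContinuousOn.inv₀ (by fun_prop) fun ξ hξ => ?_)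
      exact (pow_pos (hpos ξ hξ) 2).ne'
  rw [this]
  have : 0 < R⁻¹ := inv_pos.2 (hδ.trans_le hR)
  linarith

/-- Integrating by parts twice away from the stationary point. -/
theorem norm_integral_schrodingerPhase_mul_le_of_le {H H' H'' : ℝ → ℂ} {A δ R t : ℝ}
    (h1 : ∀ ξ, HasDerivAt H (H' ξ) ξ) (h2 : ∀ ξ, HasDerivAt H' (H'' ξ) ξ) (h3 : Continuous H'')
    (hδ : 0 < δ) (hδ1 : δ ≤ 1) (ht : |t| = (δ ^ 2)⁻¹) (hR : δ⁻¹ ≤ R)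
    (hA : ∀ ξ, ‖H ξ‖ ≤ A) (hA' : ∀ ξ, ‖H' ξ‖ ≤ A)
    (b0 : ∀ ξ, δ ≤ ξ → ‖H ξ‖ ≤ A * ξ ^ 2) (b1 : ∀ ξ, δ ≤ ξ → ‖H' ξ‖ ≤ A * ξ)
    (b2 : ∀ ξ, δ ≤ ξ → ‖H'' ξ‖ ≤ A) :
    ‖∫ ξ in δ..R, schrodingerPhase t ξ * H ξ‖ ≤ 2 * A * δ ^ 3 := by
  have hA0 : 0 ≤ A := (norm_nonneg _).trans (hA 0)
  have hR1 : 1 ≤ R := (one_le_inv₀ hδ |>.2 hδ1).trans hR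
  have hδR : δ ≤ R := hδ1.trans hR1
  have hR0 : 0 < R := by linarith
  have ht0 : t ≠ 0 := by
    intro h; rw [h, abs_zero] at ht
    exact absurd ht (inv_pos.2 (pow_pos hδ 2)).ne
  have htC : (t : ℂ) ≠ 0 := by exact_mod_cast ht0
  -- The phase `e^{-2itξ²}` has derivative `-4itξ` times itself, so it equals `k/ξ` times its own
  -- derivative. Each integration by parts gains `|k| = δ²/4` and a division by `ξ`.
  set k : ℂ := Complex.I / (4 * t) with hk
  have hkn : ‖k‖ = δ ^ 2 / 4 := by
    rw [hk, norm_div, norm_mul, Complex.norm_I, Complex.norm_real, Real.norm_eq_abs, ht]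
    simp; ring
  have hk4 : -4 * Complex.I * t * k = 1 := by
    rw [hk]; field_simp; linear_combination (-1 : ℂ) * Complex.I_sq
  have hpos : ∀ ξ ∈ Set.uIcc δ R, 0 < ξ := fun ξ hξ => by
    rw [Set.uIcc_of_le hδR] at hξ; exact hδ.trans_le hξ.1
  have hHc : Continuous H := continuous_iff_continuousAt.2 fun ξ => (h1 ξ).continuousAt
  have hHc' : Continuous H' := continuous_iff_continuousAt.2 fun ξ => (h2 ξ).continuousAt
  have hGc := continuous_schrodingerPhase t
  set v' : ℝ → ℂ := fun ξ => k ^ 2 * (H'' ξ / ξ ^ 2 - 3 * H' ξ / ξ ^ 3 + 3 * H ξ / ξ ^ 4) with hv'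
  have hofReal : ∀ ξ : ℝ, HasDerivAt (fun ξ : ℝ => (ξ : ℂ)) 1 ξ := fun ξ =>
    Complex.ofRealCLM.hasDerivAt (x := ξ)
  -- The two boundary terms of the repeated integration by parts, `kH/ξ` and `k² (H/ξ)'/ξ`, are
  -- collected into one function whose derivative is the integrand up to the remainder `v'`.
  have hder : ∀ ξ ∈ Set.uIcc δ R, HasDerivAt
      (fun ξ : ℝ => schrodingerPhase t ξ * (k * (H ξ / ξ) - k ^ 2 * (H' ξ / ξ ^ 2 - H ξ / ξ ^ 3)))
      (schrodingerPhase t ξ * H ξ - schrodingerPhase t ξ * v' ξ) ξ := fun ξ hξ => by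
    have hξ0 : (ξ : ℂ) ≠ 0 := by exact_mod_cast (hpos ξ hξ).ne'
    have d1 := (h1 ξ).fun_div (hofReal ξ) hξ0
    have d2 := (h2 ξ).fun_div ((hofReal ξ).fun_pow 2) (pow_ne_zero 2 hξ0)
    have d3 := (h1 ξ).fun_div ((hofReal ξ).fun_pow 3) (pow_ne_zero 3 hξ0)
    refine ((hasDerivAt_schrodingerPhase t ξ).fun_mul
      ((d1.const_mul k).fun_sub ((d2.fun_sub d3).const_mul (k ^ 2)))).congr_deriv ?_
    rw [hv']
    have e : -4 * Complex.I * t * ξ * schrodingerPhase t ξ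
        * (k * (H ξ / ξ) - k ^ 2 * (H' ξ / ξ ^ 2 - H ξ / ξ ^ 3))
      = schrodingerPhase t ξ * (H ξ - k * (H' ξ / ξ - H ξ / ξ ^ 2)) := by
      have : -4 * Complex.I * t * ξ * schrodingerPhase t ξ
        * (k * (H ξ / ξ) - k ^ 2 * (H' ξ / ξ ^ 2 - H ξ / ξ ^ 3))
        = (-4 * Complex.I * t * k) * (schrodingerPhase t ξ *
          (H ξ * (ξ / ξ) - k * (H' ξ / ξ * (ξ / ξ) - H ξ / ξ ^ 2 * (ξ / ξ)))) := by
        field_simp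
      rw [this, hk4, div_self hξ0]
      ring
    rw [e]
    field_simp
    push_cast
    ring
  have hcv : ContinuousOn v' (Set.uIcc δ R) := by
    have hne : ∀ n : ℕ, ∀ ξ ∈ Set.uIcc δ R, (ξ : ℂ) ^ n ≠ 0 := fun n ξ hξ =>
      pow_ne_zero n (by exact_mod_cast (hpos ξ hξ).ne')
    have c2 : ContinuousOn (fun ξ : ℝ => H'' ξ / (ξ : ℂ) ^ 2) (Set.uIcc δ R) :=
      ContinuousOn.div (by fun_prop) (by fun_prop) (hne 2)
    have c3 : ContinuousOn (fun ξ : ℝ => 3 * H' ξ / (ξ : ℂ) ^ 3) (Set.uIcc δ R) :=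
      ContinuousOn.div (by fun_prop) (by fun_prop) (hne 3)
    have c4 : ContinuousOn (fun ξ : ℝ => 3 * H ξ / (ξ : ℂ) ^ 4) (Set.uIcc δ R) :=
      ContinuousOn.div (by fun_prop) (by fun_prop) (hne 4)
    exact continuousOn_const.mul ((c2.sub c3).add c4)
  have i1 : IntervalIntegrable (fun ξ => schrodingerPhase t ξ * H ξ) volume δ R :=
    (hGc.mul hHc).intervalIntegrable _ _
  have i2 : IntervalIntegrable (fun ξ => schrodingerPhase t ξ * v' ξ) volume δ R :=
    (hGc.continuousOn.mul hcv).intervalIntegrable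
  have key := intervalIntegral.integral_eq_sub_of_hasDerivAt hder (i1.sub i2)
  rw [intervalIntegral.integral_sub i1 i2, sub_eq_iff_eq_add] at key
  -- Applied at both ends. At `δ` the assumed quadratic and linear bounds give the inequalities; at
  -- `R` they follow from the uniform bounds and `δR ≥ 1`, as no decay of `H` is available.
  have bdry : ∀ ξ : ℝ, 0 < ξ → ‖H ξ‖ ≤ A * δ * ξ → ‖H' ξ‖ ≤ A * δ ^ (-1 : ℤ) * ξ ^ 2 →
      ‖H ξ‖ ≤ A * δ ^ (-1 : ℤ) * ξ ^ 3 →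
      ‖schrodingerPhase t ξ * (k * (H ξ / ξ) - k ^ 2 * (H' ξ / ξ ^ 2 - H ξ / ξ ^ 3))‖
        ≤ 3 / 8 * A * δ ^ 3 := fun ξ hξ e0 e1 e2 => by
    rw [norm_mul, norm_schrodingerPhase, one_mul]
    refine (norm_sub_le _ _).trans ?_
    rw [norm_mul, norm_mul, norm_pow, hkn]
    have n1 : ‖H ξ / (ξ : ℂ)‖ ≤ A * δ := by
      rw [norm_div, Complex.norm_real, Real.norm_of_nonneg hξ.le, div_le_iff₀ hξ]; exact e0
    have n2 : ‖H' ξ / (ξ : ℂ) ^ 2‖ ≤ A * δ ^ (-1 : ℤ) := by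
      rw [norm_div, norm_pow, Complex.norm_real, Real.norm_of_nonneg hξ.le,
        div_le_iff₀ (by positivity)]
      exact e1
    have n3 : ‖H ξ / (ξ : ℂ) ^ 3‖ ≤ A * δ ^ (-1 : ℤ) := by
      rw [norm_div, norm_pow, Complex.norm_real, Real.norm_of_nonneg hξ.le,
        div_le_iff₀ (by positivity)]
      exact e2
    have n4 := (norm_sub_le (H' ξ / (ξ : ℂ) ^ 2) (H ξ / (ξ : ℂ) ^ 3)).trans (add_le_add n2 n3)
    calc _ ≤ δ ^ 2 / 4 * (A * δ) + (δ ^ 2 / 4) ^ 2 * (A * δ ^ (-1 : ℤ) + A * δ ^ (-1 : ℤ)) := by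
          gcongr
      _ = _ := by field_simp; ring
  have bδ := bdry δ hδ (by have := b0 δ le_rfl; nlinarith)
    (by have := b1 δ le_rfl; rw [zpow_neg_one]; refine this.trans (le_of_eq ?_); field_simp)
    (by have := b0 δ le_rfl; rw [zpow_neg_one]; refine this.trans (le_of_eq ?_); field_simp)
  have hδR1 : 1 ≤ δ * R := by
    have := mul_le_mul_of_nonneg_left hR hδ.le
    rwa [mul_inv_cancel₀ hδ.ne'] at this
  have hδi : 1 ≤ δ⁻¹ := (one_le_inv₀ hδ).2 hδ1
  have bR := bdry R hR0
    ((hA R).trans (by rw [mul_assoc]; exact le_mul_of_one_le_right hA0 hδR1))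
    ((hA' R).trans (by
      rw [zpow_neg_one, mul_assoc]
      exact le_mul_of_one_le_right hA0 (one_le_mul_of_one_le_of_one_le hδi (one_le_pow₀ hR1))))
    ((hA R).trans (by
      rw [zpow_neg_one, mul_assoc]
      exact le_mul_of_one_le_right hA0 (one_le_mul_of_one_le_of_one_le hδi (one_le_pow₀ hR1))))
  have bI : ‖∫ ξ in δ..R, schrodingerPhase t ξ * v' ξ‖ ≤ 7 / 16 * A * δ ^ 3 := by
    have : ‖∫ ξ in δ..R, schrodingerPhase t ξ * v' ξ‖
        ≤ ∫ ξ in δ..R, (7 / 16 * A * δ ^ 4) * (ξ ^ 2)⁻¹ := by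
      refine intervalIntegral.norm_integral_le_of_norm_le hδR
        (Eventually.of_forall fun ξ hξ => ?_) ?_
      · have hξδ : δ ≤ ξ := hξ.1.le
        have hξ0 : 0 < ξ := hδ.trans hξ.1
        rw [norm_mul, norm_schrodingerPhase, one_mul, hv', norm_mul, norm_pow, hkn]
        have n1 : ‖H'' ξ / (ξ : ℂ) ^ 2‖ ≤ A * (ξ ^ 2)⁻¹ := by
          rw [norm_div, norm_pow, Complex.norm_real, Real.norm_of_nonneg hξ0.le, div_eq_mul_inv]
          exact mul_le_mul_of_nonneg_right (b2 ξ hξδ) (by positivity)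
        have n2 : ‖3 * H' ξ / (ξ : ℂ) ^ 3‖ ≤ 3 * A * (ξ ^ 2)⁻¹ := by
          rw [norm_div, norm_pow, norm_mul, Complex.norm_real, Real.norm_of_nonneg hξ0.le,
            RCLike.norm_ofNat, div_le_iff₀ (by positivity)]
          refine (mul_le_mul_of_nonneg_left (b1 ξ hξδ) (by norm_num)).trans (le_of_eq ?_)
          field_simp
        have n3 : ‖3 * H ξ / (ξ : ℂ) ^ 4‖ ≤ 3 * A * (ξ ^ 2)⁻¹ := by
          rw [norm_div, norm_pow, norm_mul, Complex.norm_real, Real.norm_of_nonneg hξ0.le,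
            RCLike.norm_ofNat, div_le_iff₀ (by positivity)]
          refine (mul_le_mul_of_nonneg_left (b0 ξ hξδ) (by norm_num)).trans (le_of_eq ?_)
          field_simp
        have n4 := (norm_add_le _ _).trans (add_le_add ((norm_sub_le _ _).trans
          (add_le_add n1 n2)) n3)
        refine (mul_le_mul_of_nonneg_left n4 (by positivity)).trans (le_of_eq ?_)
        ring
      · refine ContinuousOn.intervalIntegrable (continuousOn_const.mul
          (ContinuousOn.inv₀ (by fun_prop) fun ξ hξ => (pow_pos (hpos ξ hξ) 2).ne'))
    refine this.trans ?_
    rw [intervalIntegral.integral_const_mul]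
    refine (mul_le_mul_of_nonneg_left (integral_inv_sq_le hδ hδR) (by positivity)).trans
      (le_of_eq ?_)
    field_simp
  rw [key]
  refine (norm_add_le _ _).trans ((add_le_add (norm_sub_le _ _) le_rfl).trans ?_)
  -- The two boundary terms and the remainder add up to `3/8 + 3/8 + 7/16 ≤ 2` times `A δ³`.
  have : 0 ≤ A * δ ^ 3 := by positivity
  linarith

/-- One estimate serves both parities. An amplitude vanishing to second order at `0` allows `A`
independent of `δ`, whence `δ³`. A general amplitude bounded by `M` with its derivatives allows `A =
M δ⁻²`, because `M ≤ M δ⁻² ξ²` for `ξ ≥ δ`, whence `δ`. -/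
theorem norm_integral_schrodingerPhase_mul_le {H H' H'' : ℝ → ℂ} {A δ R t : ℝ}
    (h1 : ∀ ξ, HasDerivAt H (H' ξ) ξ) (h2 : ∀ ξ, HasDerivAt H' (H'' ξ) ξ) (h3 : Continuous H'')
    (hδ : 0 < δ) (hδ1 : δ ≤ 1) (ht : |t| = (δ ^ 2)⁻¹) (hR : δ⁻¹ ≤ R)
    (hA : ∀ ξ, ‖H ξ‖ ≤ A) (hA' : ∀ ξ, ‖H' ξ‖ ≤ A)
    (hin : ∀ ξ, 0 ≤ ξ → ξ ≤ δ → ‖H ξ‖ ≤ A * δ ^ 2)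
    (b0 : ∀ ξ, δ ≤ ξ → ‖H ξ‖ ≤ A * ξ ^ 2) (b1 : ∀ ξ, δ ≤ ξ → ‖H' ξ‖ ≤ A * ξ)
    (b2 : ∀ ξ, δ ≤ ξ → ‖H'' ξ‖ ≤ A) :
    ‖∫ ξ in (0 : ℝ)..R, schrodingerPhase t ξ * H ξ‖ ≤ 3 * A * δ ^ 3 := by
  have hHc : Continuous H := continuous_iff_continuousAt.2 fun ξ => (h1 ξ).continuousAt
  have hc : Continuous fun ξ => schrodingerPhase t ξ * H ξ := (continuous_schrodingerPhase t).mul hHc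
  rw [← intervalIntegral.integral_add_adjacent_intervals (hc.intervalIntegrable 0 δ)
    (hc.intervalIntegrable δ R)]
  have i1 : ‖∫ ξ in (0 : ℝ)..δ, schrodingerPhase t ξ * H ξ‖ ≤ A * δ ^ 2 * |δ - 0| := by
    refine intervalIntegral.norm_integral_le_of_norm_le_const fun ξ hξ => ?_
    rw [Set.uIoc_of_le hδ.le] at hξ
    rw [norm_mul, norm_schrodingerPhase, one_mul]
    exact hin ξ hξ.1.le hξ.2
  rw [sub_zero, abs_of_pos hδ] at i1
  have i2 := norm_integral_schrodingerPhase_mul_le_of_le h1 h2 h3 hδ hδ1 ht hR hA hA' b0 b1 b2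
  refine (norm_add_le _ _).trans ((add_le_add i1 i2).trans (le_of_eq ?_))
  ring

namespace BoundedJet

variable {C T : ℝ} {H : ℝ → ℂ}

theorem norm_integral_schrodingerPhase_mul_le (hH : BoundedJet C T H) (hT : 0 ≤ T) {δ R t : ℝ}
    (hδ : 0 < δ) (hδ1 : δ ≤ 1) (ht : |t| = (δ ^ 2)⁻¹) (hR : δ⁻¹ ≤ R) :
    ‖∫ ξ in (0 : ℝ)..R, schrodingerPhase t ξ * H ξ‖ ≤ 3 * (C * (1 + T) ^ 2) * δ := by
  have hC := hH.nonneg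
  obtain ⟨H', H'', h1, h2, h3, h4⟩ := hH
  set M := C * (1 + T) ^ 2 with hM
  have hCT : 0 ≤ C * T := by positivity
  have hCT2 : 0 ≤ C * T ^ 2 := by positivity
  have m0 : ∀ ξ, ‖H ξ‖ ≤ M := fun ξ => (h4 ξ).1.trans (by rw [hM]; nlinarith)
  have m1 : ∀ ξ, ‖H' ξ‖ ≤ M := fun ξ => (h4 ξ).2.1.trans (by rw [hM]; nlinarith)
  have m2 : ∀ ξ, ‖H'' ξ‖ ≤ M := fun ξ => (h4 ξ).2.2.trans (by rw [hM]; nlinarith)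
  have hM0 : 0 ≤ M := by positivity
  have hd2 : 1 ≤ (δ ^ 2)⁻¹ := (one_le_inv₀ (by positivity)).2 (pow_le_one₀ hδ.le hδ1)
  have hMA : M ≤ M * (δ ^ 2)⁻¹ := le_mul_of_one_le_right hM0 hd2
  have key := _root_.norm_integral_schrodingerPhase_mul_le (A := M * (δ ^ 2)⁻¹) h1 h2 h3 hδ hδ1 ht
    hR (fun ξ => (m0 ξ).trans hMA) (fun ξ => (m1 ξ).trans hMA)
    (fun ξ _ _ => (m0 ξ).trans (le_of_eq (by field_simp)))
    (fun ξ hξ => (m0 ξ).trans ?_) (fun ξ hξ => (m1 ξ).trans ?_) (fun ξ _ => (m2 ξ).trans hMA)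
  · refine key.trans (le_of_eq ?_)
    field_simp
  · rw [mul_assoc]
    refine le_mul_of_one_le_right hM0 ?_
    rw [inv_mul_eq_div, one_le_div (by positivity)]
    gcongr
  · rw [mul_assoc]
    refine le_mul_of_one_le_right hM0 ?_
    rw [inv_mul_eq_div, one_le_div (by positivity)]
    nlinarith

theorem norm_integral_schrodingerPhase_mul_le_of_vanish (hH : BoundedJet C T H) (hT : 0 ≤ T)
    (h0 : H 0 = 0) (h0' : deriv H 0 = 0) {δ R t : ℝ}
    (hδ : 0 < δ) (hδ1 : δ ≤ 1) (ht : |t| = (δ ^ 2)⁻¹) (hR : δ⁻¹ ≤ R) :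
    ‖∫ ξ in (0 : ℝ)..R, schrodingerPhase t ξ * H ξ‖ ≤ 3 * (C * (1 + T) ^ 2) * δ ^ 3 := by
  have hC := hH.nonneg
  obtain ⟨H', H'', h1, h2, h3, h4⟩ := hH
  rw [(h1 0).deriv] at h0'
  set M := C * (1 + T) ^ 2 with hM
  have hCT : 0 ≤ C * T := by positivity
  have hCT2 : 0 ≤ C * T ^ 2 := by positivity
  have m0 : ∀ ξ, ‖H ξ‖ ≤ M := fun ξ => (h4 ξ).1.trans (by rw [hM]; nlinarith)
  have m1 : ∀ ξ, ‖H' ξ‖ ≤ M := fun ξ => (h4 ξ).2.1.trans (by rw [hM]; nlinarith)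
  have m2 : ∀ ξ, ‖H'' ξ‖ ≤ M := fun ξ => (h4 ξ).2.2.trans (by rw [hM]; nlinarith)
  have hM0 : 0 ≤ M := by positivity
  -- Taylor's bound at the double zero, by integrating the bound on the second derivative twice
  -- through the mean value inequality.
  have d1 : ∀ ξ, 0 ≤ ξ → ‖H' ξ‖ ≤ M * ξ := fun ξ hξ => by
    have := (convex_univ (𝕜 := ℝ) (E := ℝ)).norm_image_sub_le_of_norm_hasDerivWithin_le
      (f := H') (f' := H'') (C := M) (fun x _ => (h2 x).hasDerivWithinAt) (fun x _ => m2 x)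
      (Set.mem_univ 0) (Set.mem_univ ξ)
    rwa [h0', sub_zero, sub_zero, Real.norm_of_nonneg hξ] at this
  have d0 : ∀ ξ, 0 ≤ ξ → ‖H ξ‖ ≤ M * ξ ^ 2 := fun ξ hξ => by
    have := (convex_Icc (0 : ℝ) ξ).norm_image_sub_le_of_norm_hasDerivWithin_le
      (f := H) (f' := H') (C := M * ξ) (fun x _ => (h1 x).hasDerivWithinAt)
      (fun x hx => (d1 x hx.1).trans (mul_le_mul_of_nonneg_left hx.2 hM0))
      (Set.left_mem_Icc.2 hξ) (Set.right_mem_Icc.2 hξ)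
    rw [h0, sub_zero, sub_zero, Real.norm_of_nonneg hξ] at this
    exact this.trans (le_of_eq (by ring))
  exact _root_.norm_integral_schrodingerPhase_mul_le h1 h2 h3 hδ hδ1 ht hR m0 m1
    (fun ξ hξ hξδ => (d0 ξ hξ).trans (by gcongr)) (fun ξ hξ => d0 ξ (hδ.le.trans hξ))
    (fun ξ hξ => d1 ξ (hδ.le.trans hξ)) (fun ξ _ => m2 ξ)

end BoundedJet

/-! ### Duality and truncation in `L²` -/

theorem inner_toLp_eq {f g : ℝ → ℂ} (hf : MemLp f 2 volume) (hg : MemLp g 2 volume) :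
    inner ℂ (hf.toLp f) (hg.toLp g) = ∫ x, conj (f x) * g x := by
  rw [L2.inner_def]
  refine integral_congr_ae ?_
  filter_upwards [hf.coeFn_toLp, hg.coeFn_toLp] with x hx hy
  rw [hx, hy]; simp [mul_comm]

theorem integral_conj_mul_self {f : ℝ → ℂ} (hf : MemLp f 2 volume) :
    ∫ x, conj (f x) * f x = (((eLpNorm f 2 volume).toReal ^ 2 : ℝ) : ℂ) := by
  rw [← inner_toLp_eq hf hf, inner_self_eq_norm_sq_to_K, Lp.norm_toLp]
  norm_cast

theorem norm_integral_conj_mul_le {f g : ℝ → ℂ} (hf : MemLp f 2 volume) (hg : MemLp g 2 volume) :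
    ‖∫ x, conj (f x) * g x‖ ≤ (eLpNorm f 2 volume).toReal * (eLpNorm g 2 volume).toReal := by
  rw [← inner_toLp_eq hf hg, ← Lp.norm_toLp f hf, ← Lp.norm_toLp g hg]
  exact norm_inner_le_norm _ _

theorem eLpNorm_eq_of_integral_conj_mul_eq {f g : ℝ → ℂ} (hf : MemLp f 2 volume)
    (hg : MemLp g 2 volume) (h : ∫ x, conj (f x) * f x = ∫ x, conj (g x) * g x) :
    eLpNorm f 2 volume = eLpNorm g 2 volume := by
  rw [integral_conj_mul_self hf, integral_conj_mul_self hg, Complex.ofReal_inj] at h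
  have := (sq_eq_sq₀ ENNReal.toReal_nonneg ENNReal.toReal_nonneg).1 h
  rwa [ENNReal.toReal_eq_toReal_iff' hf.2.ne hg.2.ne] at this

theorem tendsto_integral_conj_mul {f g : ℝ → ℂ} {φ : ℝ → ℝ → ℂ} (hf : MemLp f 2 volume)
    (hg : MemLp g 2 volume) (hφ : ∀ R, MemLp (φ R) 2 volume)
    (h : Tendsto (fun R => eLpNorm (fun x => φ R x - g x) 2 volume) atTop (𝓝 0)) :
    Tendsto (fun R => ∫ x, conj (f x) * φ R x) atTop (𝓝 (∫ x, conj (f x) * g x)) := by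
  rw [tendsto_iff_norm_sub_tendsto_zero]
  have h' : Tendsto (fun R => (eLpNorm f 2 volume).toReal
      * (eLpNorm (fun x => φ R x - g x) 2 volume).toReal) atTop (𝓝 0) := by
    have := (ENNReal.tendsto_toReal ENNReal.zero_ne_top).comp h
    simpa using this.const_mul (eLpNorm f 2 volume).toReal
  refine squeeze_zero (fun _ => norm_nonneg _) (fun R => ?_) h'
  rw [← integral_sub (integrable_conj_mul hf (hφ R)) (integrable_conj_mul hf hg)]
  simp_rw [← mul_sub]
  exact norm_integral_conj_mul_le hf ((hφ R).sub hg)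

theorem tendsto_eLpNorm_indicator_sub {f : ℝ → ℂ} (hf : MemLp f 2 volume) :
    Tendsto (fun R : ℝ => eLpNorm (fun x => (Set.Ioc (-R) R).indicator f x - f x) 2 volume) atTop
      (𝓝 0) := by
  have hm : ∀ R : ℝ, MemLp (fun x => (Set.Ioc (-R) R).indicator f x - f x) 2 volume := fun R =>
    (hf.indicator measurableSet_Ioc).sub hf
  have key : Tendsto (fun R : ℝ => ∫ x, ‖(Set.Ioc (-R) R).indicator f x - f x‖ ^ 2) atTop
      (𝓝 (∫ x : ℝ, (0 : ℝ))) := by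
    refine tendsto_integral_filter_of_dominated_convergence (fun x => ‖f x‖ ^ 2)
      (Eventually.of_forall fun R => ((hm R).norm.aestronglyMeasurable.pow 2))
      (Eventually.of_forall fun R => Eventually.of_forall fun x => ?_)
      (hf.integrable_norm_pow (by norm_num)) (Eventually.of_forall fun x => ?_)
    · rw [Real.norm_of_nonneg (by positivity)]
      by_cases hx : x ∈ Set.Ioc (-R) R
      · rw [Set.indicator_of_mem hx]; simp
      · rw [Set.indicator_of_notMem hx]; simp
    · refine tendsto_const_nhds.congr' ?_
      filter_upwards [eventually_gt_atTop |x|] with R hR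
      rw [abs_lt] at hR
      rw [Set.indicator_of_mem (Set.mem_Ioc.2 ⟨hR.1, hR.2.le⟩)]; simp
  rw [integral_zero] at key
  have h2 : ∀ R : ℝ, eLpNorm (fun x => (Set.Ioc (-R) R).indicator f x - f x) 2 volume
      = ENNReal.ofReal (Real.sqrt (∫ x, ‖(Set.Ioc (-R) R).indicator f x - f x‖ ^ 2)) := fun R => by
    rw [(hm R).eLpNorm_eq_integral_rpow_norm (by norm_num) (by norm_num), Real.sqrt_eq_rpow]
    simp
  simp_rw [h2]
  have := ENNReal.tendsto_ofReal ((Real.continuous_sqrt.tendsto 0).comp key)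
  simpa using this

/-- A locally square integrable function is square integrable if it is bounded as a functional
on square integrable functions with bounded support. -/
theorem eLpNorm_le_of_norm_integral_conj_mul_le {f : ℝ → ℂ}
    (hf : ∀ R : ℝ, MemLp ((Set.Ioc (-R) R).indicator f) 2 volume) {c : ℝ} (hc : 0 ≤ c)
    (h : ∀ H, IsBandLimited H →
      ‖∫ x, conj (H x) * f x‖ ≤ (eLpNorm H 2 volume).toReal * c) :
    eLpNorm f 2 volume ≤ ENNReal.ofReal c := by
  have hN : ∀ R : ℝ, eLpNorm ((Set.Ioc (-R) R).indicator f) 2 volume ≤ ENNReal.ofReal c := by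
    intro R
    -- The truncation of `f` is its own test function: the hypothesis reads `N² ≤ N c` for its norm
    -- `N`.
    set H := (Set.Ioc (-R) R).indicator f with hH
    have hb : IsBandLimited H := by
      have := (hf R).isBandLimited_indicator R
      rwa [Set.indicator_indicator, Set.inter_self] at this
    have h1 := h H hb
    have e : ∀ x, conj (H x) * f x = conj (H x) * H x := fun x => by
      by_cases hx : x ∈ Set.Ioc (-R) R
      · rw [hH, Set.indicator_of_mem hx]
      · rw [hH, Set.indicator_of_notMem hx]; simp
    simp_rw [e] at h1
    rw [integral_conj_mul_self hb.1, Complex.norm_real, Real.norm_of_nonneg (by positivity)] at h1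
    have h2 : (eLpNorm H 2 volume).toReal ≤ c := by
      by_contra hlt
      have : 0 < (eLpNorm H 2 volume).toReal := by linarith
      nlinarith
    exact (ENNReal.le_ofReal_iff_toReal_le hb.1.2.ne hc).2 h2
  have hlim : ∀ x : ℝ, Tendsto (fun n : ℕ => (Set.Ioc (-(n : ℝ)) n).indicator f x) atTop
      (𝓝 (f x)) := fun x => by
    refine tendsto_const_nhds.congr' ?_
    filter_upwards [tendsto_natCast_atTop_atTop.eventually_gt_atTop |x|] with n hn
    rw [abs_lt] at hn
    rw [Set.indicator_of_mem (Set.mem_Ioc.2 ⟨hn.1, hn.2.le⟩)]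
  -- Fatou's lemma along integer truncations removes the cutoff.
  refine (Lp.eLpNorm_lim_le_liminf_eLpNorm (fun n : ℕ => (hf n).aestronglyMeasurable) f
    (Eventually.of_forall hlim)).trans ?_
  exact (liminf_le_of_frequently_le' (Frequently.of_forall fun n : ℕ => hN n))

/-! ### Mode transform and superposition on `L²` -/

namespace TwoSolitonData

variable (D : TwoSolitonData)

/-- The transform `ξ ↦ ⟨Ψ_d(·, ξ), f⟩` of an integrable function. -/
noncomputable def analysis (f : ℝ → ℂ) (ξ : ℝ) : ℂ := ∫ y : ℝ, conj (D.dispersive 0 y ξ) * f y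

theorem exists_norm_dispersive_zero_le : ∃ C : ℝ, 0 < C ∧ ∀ x ξ, ‖D.dispersive 0 x ξ‖ ≤ C := by
  obtain ⟨C, T, hC, hT, h⟩ := D.exists_boundedJet_dispersive
  exact ⟨C, hC, fun x ξ => (h x).norm_le ξ⟩

theorem continuous_dispersive_zero_left (ξ : ℝ) : Continuous fun x => D.dispersive 0 x ξ := by
  have h := D.continuous_dispersive_zero.comp
    (continuous_id.prodMk continuous_const : Continuous fun x : ℝ => (x, ξ))
  simpa only [Function.comp_def, id] using h

theorem continuous_dispersive_zero_right (x : ℝ) : Continuous (D.dispersive 0 x) := by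
  have h := D.continuous_dispersive_zero.comp
    (continuous_const.prodMk continuous_id : Continuous fun ξ : ℝ => (x, ξ))
  simpa only [Function.comp_def, id] using h

variable {D}

theorem integrable_mul_dispersive {F : ℝ → ℂ} (hF : Integrable F) (x : ℝ) :
    Integrable fun ξ => F ξ * D.dispersive 0 x ξ := by
  obtain ⟨C, -, h⟩ := D.exists_norm_dispersive_zero_le
  exact hF.mul_bdd (c := C) (D.continuous_dispersive_zero_right x).aestronglyMeasurable
    (Eventually.of_forall fun ξ => h x ξ)

theorem integrable_conj_dispersive_mul {f : ℝ → ℂ} (hf : Integrable f) (ξ : ℝ) :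
    Integrable fun y => conj (D.dispersive 0 y ξ) * f y := by
  obtain ⟨C, -, h⟩ := D.exists_norm_dispersive_zero_le
  refine hf.bdd_mul (c := C) (Complex.continuous_conj.comp
    (D.continuous_dispersive_zero_left ξ)).aestronglyMeasurable (Eventually.of_forall fun y => ?_)
  rw [Complex.norm_conj]; exact h y ξ

theorem continuous_analysis {f : ℝ → ℂ} (hf : Integrable f) : Continuous (D.analysis f) := by
  obtain ⟨C, -, h⟩ := D.exists_norm_dispersive_zero_le
  refine continuous_of_dominated (bound := fun y => C * ‖f y‖)
    (fun ξ => (integrable_conj_dispersive_mul hf ξ).aestronglyMeasurable)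
    (fun ξ => Eventually.of_forall fun y => ?_) (hf.norm.const_mul C)
    (Eventually.of_forall fun y => ?_)
  · rw [norm_mul, Complex.norm_conj]
    exact mul_le_mul_of_nonneg_right (h y ξ) (norm_nonneg _)
  · exact (Complex.continuous_conj.comp (D.continuous_dispersive_zero_right y)).mul continuous_const

theorem synthesis_sub {F G : ℝ → ℂ} (hF : Integrable F) (hG : Integrable G) (x : ℝ) :
    D.synthesis (fun ξ => F ξ - G ξ) x = D.synthesis F x - D.synthesis G x := by
  rw [synthesis, synthesis, synthesis, ← integral_sub (integrable_mul_dispersive hF x)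
    (integrable_mul_dispersive hG x)]
  simp_rw [sub_mul]

theorem eLpNorm_synthesis {F : ℝ → ℂ} (hF : IsBandLimited F) :
    eLpNorm (D.synthesis F) 2 volume = eLpNorm F 2 volume :=
  eLpNorm_eq_of_integral_conj_mul_eq (memLp_synthesis hF) hF.1 (integral_conj_synthesis_mul hF hF)

/-- Fubini: the transform is the adjoint of the superposition. Bessel's inequality and the inversion
on superpositions are deduced from this and orthonormality by duality. -/
theorem integral_conj_mul_analysis {H f : ℝ → ℂ} (hH : Integrable H) (hf : Integrable f) :
    ∫ ξ, conj (H ξ) * D.analysis f ξ = ∫ x, conj (D.synthesis H x) * f x := by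
  obtain ⟨C, -, h⟩ := D.exists_norm_dispersive_zero_le
  have e1 : ∀ ξ, conj (H ξ) * D.analysis f ξ
      = ∫ y, conj (H ξ) * f y * conj (D.dispersive 0 y ξ) := fun ξ => by
    rw [analysis, ← integral_const_mul]
    congr 1; ext y; ring
  have e2 : ∀ x, conj (D.synthesis H x) * f x
      = ∫ ξ, conj (H ξ) * f x * conj (D.dispersive 0 x ξ) := fun x => by
    rw [synthesis, ← integral_conj, ← integral_mul_const]
    congr 1; ext y; rw [map_mul]; ring
  simp_rw [e1, e2]
  refine integral_integral_swap ?_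
  have hHc : Integrable fun ξ => conj (H ξ) := by
    refine hH.norm.mono' (Complex.continuous_conj.comp_aestronglyMeasurable
      hH.aestronglyMeasurable) (Eventually.of_forall fun ξ => ?_)
    rw [Complex.norm_conj]
  refine (hHc.mul_prod hf).mul_bdd (c := C) ?_ (Eventually.of_forall fun p => ?_)
  · exact (Complex.continuous_conj.comp (D.continuous_dispersive_zero.comp
      (continuous_snd.prodMk continuous_fst))).aestronglyMeasurable
  · rw [Complex.norm_conj]; exact h _ _

theorem memLp_indicator_of_continuous {f : ℝ → ℂ} (hf : Continuous f) (R : ℝ) :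
    MemLp ((Set.Ioc (-R) R).indicator f) 2 volume := by
  rw [memLp_indicator_iff_restrict measurableSet_Ioc]
  obtain ⟨C, hC⟩ := (isCompact_Icc (a := -R) (b := R)).exists_bound_of_continuousOn hf.continuousOn
  refine MemLp.of_bound hf.aestronglyMeasurable C ?_
  rw [ae_restrict_iff' measurableSet_Ioc]
  exact Eventually.of_forall fun x hx => hC x (Set.Ioc_subset_Icc_self hx)

/-- Bessel's inequality for the dispersive modes. -/
theorem eLpNorm_analysis_le {f : ℝ → ℂ} (h1 : Integrable f) (h2 : MemLp f 2 volume) :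
    eLpNorm (D.analysis f) 2 volume ≤ eLpNorm f 2 volume := by
  have key := eLpNorm_le_of_norm_integral_conj_mul_le (f := D.analysis f)
    (c := (eLpNorm f 2 volume).toReal)
    (fun R => memLp_indicator_of_continuous (continuous_analysis h1) R) ENNReal.toReal_nonneg
    (fun H hH => by
      rw [integral_conj_mul_analysis hH.integrable h1, ← eLpNorm_synthesis (D := D) hH]
      exact norm_integral_conj_mul_le (memLp_synthesis hH) h2)
  rwa [ENNReal.ofReal_toReal h2.2.ne] at key

theorem memLp_analysis {f : ℝ → ℂ} (h1 : Integrable f) (h2 : MemLp f 2 volume) :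
    MemLp (D.analysis f) 2 volume :=
  ⟨(continuous_analysis h1).aestronglyMeasurable, (eLpNorm_analysis_le h1 h2).trans_lt h2.2⟩

variable (D) in
/-- `g` is the superposition of the dispersive modes with amplitudes `F`, in the sense of `L²`. -/
def IsSynthesis (F g : ℝ → ℂ) : Prop :=
  IsL2Limit volume (fun R => D.synthesis ((Set.Ioc (-R) R).indicator F)) g

/-- Superposition is isometric on compactly supported amplitudes, so the truncated superpositions
are as far apart as the truncated amplitudes; they form a Cauchy family. -/
theorem exists_isSynthesis {F : ℝ → ℂ} (hF : MemLp F 2 volume) : ∃ g, D.IsSynthesis F g := by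
  have hb : ∀ R : ℝ, IsBandLimited ((Set.Ioc (-R) R).indicator F) := hF.isBandLimited_indicator
  set u : ℝ → Lp ℂ 2 (volume : Measure ℝ) := fun R => (memLp_synthesis (D := D) (hb R)).toLp _
  set v : ℝ → Lp ℂ 2 (volume : Measure ℝ) := fun R => (hb R).1.toLp _
  have hv : Tendsto v atTop (𝓝 (hF.toLp F)) := by
    rw [Lp.tendsto_Lp_iff_tendsto_eLpNorm'' _ (fun R => (hb R).1)]
    exact tendsto_eLpNorm_indicator_sub hF
  have huv : ∀ R R', dist (u R) (u R') = dist (v R) (v R') := fun R R' => by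
    have hd : IsBandLimited fun ξ => (Set.Ioc (-R) R).indicator F ξ
        - (Set.Ioc (-R') R').indicator F ξ := by
      obtain ⟨k1, N, k2⟩ := hb R
      obtain ⟨k1', N', k2'⟩ := hb R'
      exact ⟨k1.sub k1', max N N', fun ξ hξ => by
        beta_reduce
        rw [k2 ξ ((le_max_left _ _).trans_lt hξ), k2' ξ ((le_max_right _ _).trans_lt hξ), sub_zero]⟩
    rw [dist_edist, dist_edist, Lp.edist_toLp_toLp, Lp.edist_toLp_toLp]
    congr 1
    refine Eq.trans ?_ (eLpNorm_synthesis (D := D) hd)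
    congr 1
    ext x
    exact (synthesis_sub (hb R).integrable (hb R').integrable x).symm
  have hc : CauchySeq u := by
    have h := Metric.cauchySeq_iff.1 hv.cauchySeq
    refine Metric.cauchySeq_iff.2 fun ε hε => ?_
    obtain ⟨N, hN⟩ := h ε hε
    exact ⟨N, fun m hm n hn => by rw [huv]; exact hN m hm n hn⟩
  obtain ⟨g, hg⟩ := cauchySeq_tendsto_of_complete hc
  refine ⟨g, Lp.memLp g, ?_⟩
  have hg' : Tendsto u atTop (𝓝 ((Lp.memLp g).toLp g)) := by rwa [Lp.toLp_coeFn]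
  rw [Lp.tendsto_Lp_iff_tendsto_eLpNorm'' _ (fun R => memLp_synthesis (hb R))] at hg'
  exact hg'

theorem IsSynthesis.integral_conj_synthesis_mul {F g H : ℝ → ℂ} (hg : D.IsSynthesis F g)
    (hF : MemLp F 2 volume) (hH : IsBandLimited H) :
    ∫ x, conj (D.synthesis H x) * g x = ∫ ξ, conj (H ξ) * F ξ := by
  have hb : ∀ R : ℝ, IsBandLimited ((Set.Ioc (-R) R).indicator F) := hF.isBandLimited_indicator
  have t1 := tendsto_integral_conj_mul (memLp_synthesis (D := D) hH) hg.1
    (fun R => memLp_synthesis (hb R)) hg.2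
  have t2 := tendsto_integral_conj_mul hH.1 hF (fun R => (hb R).1) (tendsto_eLpNorm_indicator_sub hF)
  refine tendsto_nhds_unique t1 (t2.congr fun R => ?_)
  exact (TwoSolitonData.integral_conj_synthesis_mul hH (hb R)).symm

theorem IsSynthesis.integral_conj_boundWave_mul {F g : ℝ → ℂ} (hg : D.IsSynthesis F g)
    (hF : MemLp F 2 volume) (κ₁ κ₂ : ℂ) : ∫ x, conj (D.boundWave κ₁ κ₂ x) * g x = 0 := by
  have hb : ∀ R : ℝ, IsBandLimited ((Set.Ioc (-R) R).indicator F) := hF.isBandLimited_indicator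
  have t1 := tendsto_integral_conj_mul (memLp_boundWave (D := D) κ₁ κ₂) hg.1
    (fun R => memLp_synthesis (hb R)) hg.2
  simp_rw [fun R => integral_conj_boundWave_mul_synthesis (D := D) κ₁ κ₂ (hb R)] at t1
  exact tendsto_nhds_unique t1 tendsto_const_nhds

theorem IsSynthesis.eLpNorm_le {F g : ℝ → ℂ} (hg : D.IsSynthesis F g)
    (hF : MemLp F 2 volume) : eLpNorm g 2 volume ≤ eLpNorm F 2 volume := by
  have hb : ∀ R : ℝ, IsBandLimited ((Set.Ioc (-R) R).indicator F) := hF.isBandLimited_indicator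
  have h1 : ∀ R : ℝ, eLpNorm g 2 volume ≤ eLpNorm F 2 volume + eLpNorm (fun x =>
      D.synthesis ((Set.Ioc (-R) R).indicator F) x - g x) 2 volume := fun R => by
    have hs := memLp_synthesis (D := D) (hb R)
    have h := eLpNorm_sub_le (p := 2) hs.1 (hs.1.sub hg.1.1) (by norm_num)
    rw [sub_sub_cancel, eLpNorm_synthesis (hb R)] at h
    exact h.trans (add_le_add_left (eLpNorm_indicator_le F) _)
  have h2 := (tendsto_const_nhds (x := eLpNorm F 2 volume)).add hg.2
  rw [add_zero] at h2
  exact ge_of_tendsto' h2 h1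

/-- Paired with a band-limited `H`, the difference becomes the product of the superposition of `H`
with the truncation error of `g`, by adjointness and orthonormality. Its `L²` norm is therefore at
most that error, and `F` is the transform of `g`. -/
theorem IsSynthesis.tendsto_analysis {F g : ℝ → ℂ} (hg : D.IsSynthesis F g)
    (hF : MemLp F 2 volume) : Tendsto (fun R : ℝ => eLpNorm (fun ξ =>
      D.analysis ((Set.Ioc (-R) R).indicator g) ξ - F ξ) 2 volume) atTop (𝓝 0) := by
  have hb : ∀ R : ℝ, IsBandLimited ((Set.Ioc (-R) R).indicator g) := hg.1.isBandLimited_indicator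
  refine tendsto_of_tendsto_of_tendsto_of_le_of_le tendsto_const_nhds
    (tendsto_eLpNorm_indicator_sub hg.1) (fun R => zero_le) fun R => ?_
  have hm : MemLp (fun x => (Set.Ioc (-R) R).indicator g x - g x) 2 volume := (hb R).1.sub hg.1
  have ha := memLp_analysis (D := D) (hb R).integrable (hb R).1
  have key := eLpNorm_le_of_norm_integral_conj_mul_le
    (f := fun ξ => D.analysis ((Set.Ioc (-R) R).indicator g) ξ - F ξ)
    (c := (eLpNorm (fun x => (Set.Ioc (-R) R).indicator g x - g x) 2 volume).toReal)
    (fun R' => (ha.sub hF).indicator measurableSet_Ioc) ENNReal.toReal_nonneg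
    (fun H hH => by
      simp_rw [mul_sub]
      rw [integral_sub (integrable_conj_mul hH.1 ha) (integrable_conj_mul hH.1 hF),
        integral_conj_mul_analysis hH.integrable (hb R).integrable,
        ← hg.integral_conj_synthesis_mul hF hH,
        ← integral_sub (integrable_conj_mul (memLp_synthesis hH) (hb R).1)
          (integrable_conj_mul (memLp_synthesis hH) hg.1), ← eLpNorm_synthesis (D := D) hH]
      simp_rw [← mul_sub]
      exact norm_integral_conj_mul_le (memLp_synthesis hH) hm)
  rwa [ENNReal.ofReal_toReal hm.2.ne] at key

end TwoSolitonData

/-! ### Polynomial weights -/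

theorem one_le_japaneseBracket (x : ℝ) : 1 ≤ japaneseBracket x := by
  rw [japaneseBracket, Real.one_le_sqrt]; nlinarith [sq_nonneg x]

theorem japaneseBracket_pos (x : ℝ) : 0 < japaneseBracket x :=
  one_pos.trans_le (one_le_japaneseBracket x)

theorem abs_le_japaneseBracket (x : ℝ) : |x| ≤ japaneseBracket x := by
  rw [japaneseBracket]; exact Real.abs_le_sqrt (by linarith)

theorem continuous_japaneseBracket : Continuous japaneseBracket := by
  unfold japaneseBracket; fun_prop

theorem continuous_japaneseBracket_rpow (s : ℝ) : Continuous fun x => japaneseBracket x ^ s :=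
  continuous_japaneseBracket.rpow_const fun x => Or.inl (japaneseBracket_pos x).ne'

theorem memLp_japaneseBracket_rpow {s : ℝ} (hs : s < -(1 / 2)) :
    MemLp (fun x => japaneseBracket x ^ s) 2 volume := by
  rw [memLp_two_iff_integrable_sq (continuous_japaneseBracket_rpow s).aestronglyMeasurable]
  have h := integrable_rpow_neg_one_add_norm_sq (E := ℝ) (μ := volume) (r := -(2 * s))
    (by simp; linarith)
  refine h.congr (Eventually.of_forall fun x => ?_)
  have h0 : 0 ≤ 1 + x ^ 2 := by positivity
  simp only [Real.norm_eq_abs, sq_abs]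
  rw [japaneseBracket, Real.sqrt_eq_rpow, ← Real.rpow_mul h0, ← Real.rpow_mul_natCast h0]
  congr 1
  push_cast
  ring

theorem norm_weighted (s : ℝ) (f : ℝ → ℂ) (x : ℝ) :
    ‖weighted s f x‖ = japaneseBracket x ^ s * ‖f x‖ := by
  rw [weighted, norm_mul, Complex.norm_real,
    Real.norm_of_nonneg (Real.rpow_nonneg (japaneseBracket_pos x).le s)]

theorem eLpNorm_weighted_le {s : ℝ} (hs : s ≤ 0) (f : ℝ → ℂ) :
    eLpNorm (weighted s f) 2 volume ≤ eLpNorm f 2 volume := by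
  refine eLpNorm_mono fun x => ?_
  rw [norm_weighted]
  exact mul_le_of_le_one_left (norm_nonneg _)
    (Real.rpow_le_one_of_one_le_of_nonpos (one_le_japaneseBracket x) hs)

theorem eLpNorm_le_weighted {s : ℝ} (hs : 0 ≤ s) (f : ℝ → ℂ) :
    eLpNorm f 2 volume ≤ eLpNorm (weighted s f) 2 volume := by
  refine eLpNorm_mono fun x => ?_
  rw [norm_weighted]
  exact le_mul_of_one_le_left (norm_nonneg _)
    (Real.one_le_rpow (one_le_japaneseBracket x) hs)

/-- Cauchy–Schwarz with `⟨y⟩² = ⟨y⟩^{2-σ} ⟨y⟩^σ`; the first factor is square integrable exactly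
because `σ > 5/2`. The square of the bracket matches the growth of the kernel in `y`. -/
theorem exists_integral_sq_japaneseBracket_mul_le {σ : ℝ} (hσ : 5 / 2 < σ) : ∃ K : ℝ, 0 < K ∧
    ∀ f : ℝ → ℂ, MemLp (weighted σ f) 2 volume → Integrable (fun y => japaneseBracket y ^ 2 * ‖f y‖) ∧
      ∫ y, japaneseBracket y ^ 2 * ‖f y‖ ≤ K * (eLpNorm (weighted σ f) 2 volume).toReal := by
  have hw := memLp_japaneseBracket_rpow (s := 2 - σ) (by linarith)
  set w : ℝ → ℂ := fun x => ((japaneseBracket x ^ (2 - σ) : ℝ) : ℂ) with hwdef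
  have hwc : MemLp w 2 volume := hw.ofReal
  refine ⟨(eLpNorm w 2 volume).toReal + 1, by positivity, fun f hf => ?_⟩
  have e : ∀ y, ((japaneseBracket y ^ 2 * ‖f y‖ : ℝ) : ℂ)
      = conj (w y) * ((‖weighted σ f y‖ : ℝ) : ℂ) := fun y => by
    rw [hwdef, Complex.conj_ofReal, norm_weighted, ← Complex.ofReal_mul, ← mul_assoc,
      ← Real.rpow_add (japaneseBracket_pos y)]
    norm_num
  have hn : MemLp (fun y => ((‖weighted σ f y‖ : ℝ) : ℂ)) 2 volume := hf.norm.ofReal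
  have hi := integrable_conj_mul hwc hn
  simp_rw [← e] at hi
  have hi' : Integrable (fun y => japaneseBracket y ^ 2 * ‖f y‖) := by
    have := hi.re
    simpa only [RCLike.re_to_complex, Complex.ofReal_re] using this
  refine ⟨hi', ?_⟩
  have h := norm_integral_conj_mul_le hwc hn
  simp_rw [← e] at h
  rw [integral_complex_ofReal, Complex.norm_real] at h
  have hnn : eLpNorm (fun y => ((‖weighted σ f y‖ : ℝ) : ℂ)) 2 volume
      = eLpNorm (weighted σ f) 2 volume := by
    refine eLpNorm_congr_norm_ae (Eventually.of_forall fun y => ?_)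
    rw [Complex.norm_real, norm_norm]
  rw [hnn] at h
  refine (Real.le_norm_self _).trans (h.trans ?_)
  exact mul_le_mul_of_nonneg_right (by linarith) ENNReal.toReal_nonneg

/-! ### Parity modes, projections and the evolution -/

namespace TwoSolitonData

variable (D : TwoSolitonData)

/-- The transform `ξ ↦ ⟨Ψ(·, ξ), f⟩` in the even or odd modes. -/
noncomputable def parityAnalysis (ε : ℂ) (f : ℝ → ℂ) (ξ : ℝ) : ℂ :=
  ∫ y : ℝ, conj (D.parityMode ε y ξ) * f y

variable {D}

theorem parityAnalysis_eq (ε : ℂ) {f : ℝ → ℂ} (hf : Integrable f) (ξ : ℝ) :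
    D.parityAnalysis ε f ξ
      = ((Real.sqrt 2)⁻¹ : ℝ) * (D.analysis f ξ + conj ε * D.analysis f (-ξ)) := by
  rw [parityAnalysis, analysis, analysis, ← integral_const_mul (conj ε),
    ← integral_add (integrable_conj_dispersive_mul hf ξ)
      ((integrable_conj_dispersive_mul hf (-ξ)).const_mul _), ← integral_const_mul]
  refine integral_congr_ae (Eventually.of_forall fun y => ?_)
  simp only [parityMode, map_mul, map_add, Complex.conj_ofReal]
  ring

theorem continuous_parityAnalysis (ε : ℂ) {f : ℝ → ℂ} (hf : Integrable f) :
    Continuous (D.parityAnalysis ε f) := by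
  have h := continuous_analysis (D := D) hf
  have e : D.parityAnalysis ε f = fun ξ => ((Real.sqrt 2)⁻¹ : ℝ)
      * (D.analysis f ξ + conj ε * D.analysis f (-ξ)) := funext fun ξ => parityAnalysis_eq ε hf ξ
  rw [e]
  fun_prop

theorem parityAnalysis_neg {ε : ℂ} (hε : ε = 1 ∨ ε = -1) {f : ℝ → ℂ} (hf : Integrable f) (ξ : ℝ) :
    D.parityAnalysis ε f (-ξ) = ε * D.parityAnalysis ε f ξ := by
  rw [parityAnalysis_eq ε hf, parityAnalysis_eq ε hf, neg_neg]
  rcases hε with rfl | rfl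
  · simp; ring
  · simp; ring

theorem memLp_comp_neg {f : ℝ → ℂ} (hf : MemLp f 2 volume) : MemLp (fun x => f (-x)) 2 volume :=
  hf.comp_measurePreserving (Measure.measurePreserving_neg volume)

theorem eLpNorm_comp_neg {f : ℝ → ℂ} (hf : MemLp f 2 volume) :
    eLpNorm (fun x => f (-x)) 2 volume = eLpNorm f 2 volume :=
  eLpNorm_comp_measurePreserving hf.aestronglyMeasurable (Measure.measurePreserving_neg volume)

theorem eLpNorm_parityAnalysis_le {ε : ℂ} (hε : ε = 1 ∨ ε = -1) {f : ℝ → ℂ} (h1 : Integrable f)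
    (h2 : MemLp f 2 volume) :
    eLpNorm (D.parityAnalysis ε f) 2 volume ≤ 2 * eLpNorm f 2 volume := by
  have ha := memLp_analysis (D := D) h1 h2
  have hn : ‖ε‖ = 1 := by rcases hε with rfl | rfl <;> simp
  have hs : ‖(((Real.sqrt 2)⁻¹ : ℝ) : ℂ)‖ ≤ 1 := by
    rw [Complex.norm_real, Real.norm_of_nonneg (by positivity)]
    exact inv_le_one_of_one_le₀ (Real.one_le_sqrt.2 (by norm_num))
  calc eLpNorm (D.parityAnalysis ε f) 2 volume
      ≤ eLpNorm (fun ξ => ‖D.analysis f ξ‖ + ‖D.analysis f (-ξ)‖) 2 volume := by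
        refine eLpNorm_mono_real fun ξ => ?_
        rw [parityAnalysis_eq ε h1, norm_mul]
        refine (mul_le_of_le_one_left (norm_nonneg _) hs).trans ((norm_add_le _ _).trans ?_)
        rw [norm_mul, Complex.norm_conj, hn, one_mul]
    _ ≤ eLpNorm (fun ξ => ‖D.analysis f ξ‖) 2 volume
        + eLpNorm (fun ξ => ‖D.analysis f (-ξ)‖) 2 volume :=
        eLpNorm_add_le ha.norm.1 (memLp_comp_neg ha).norm.1 (by norm_num)
    _ = eLpNorm (D.analysis f) 2 volume + eLpNorm (D.analysis f) 2 volume := by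
        rw [eLpNorm_norm, eLpNorm_norm, eLpNorm_comp_neg ha]
    _ ≤ eLpNorm f 2 volume + eLpNorm f 2 volume :=
        add_le_add (eLpNorm_analysis_le h1 h2) (eLpNorm_analysis_le h1 h2)
    _ = _ := (two_mul _).symm

theorem memLp_parityAnalysis {ε : ℂ} (hε : ε = 1 ∨ ε = -1) {f : ℝ → ℂ} (h1 : Integrable f)
    (h2 : MemLp f 2 volume) : MemLp (D.parityAnalysis ε f) 2 volume :=
  ⟨(continuous_parityAnalysis ε h1).aestronglyMeasurable, (eLpNorm_parityAnalysis_le hε h1 h2).trans_lt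
    (ENNReal.mul_lt_top (by simp) h2.2)⟩

theorem norm_parity_eq_one {ε : ℂ} (hε : ε = 1 ∨ ε = -1) : ‖ε‖ = 1 := by
  rcases hε with rfl | rfl <;> simp

theorem continuous_parityMode_left (ε : ℂ) (ξ : ℝ) : Continuous fun x => D.parityMode ε x ξ := by
  have h := (D.continuous_parityMode ε).comp
    (continuous_id.prodMk continuous_const : Continuous fun x : ℝ => (x, ξ))
  simpa only [Function.comp_def, id] using h

theorem continuous_parityMode_right (ε : ℂ) (x : ℝ) : Continuous (D.parityMode ε x) := by
  have h := (D.continuous_parityMode ε).comp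
    (continuous_const.prodMk continuous_id : Continuous fun ξ : ℝ => (x, ξ))
  simpa only [Function.comp_def, id] using h

theorem integrable_conj_parityMode_mul {ε : ℂ} (hε : ε = 1 ∨ ε = -1) {f : ℝ → ℂ}
    (hf : Integrable f) (ξ : ℝ) : Integrable fun y => conj (D.parityMode ε y ξ) * f y := by
  obtain ⟨C, T, -, -, h⟩ := D.exists_boundedJet_parityMode (norm_parity_eq_one hε)
  refine hf.bdd_mul (c := C) (Complex.continuous_conj.comp
    (continuous_parityMode_left ε ξ)).aestronglyMeasurable (Eventually.of_forall fun y => ?_)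
  rw [Complex.norm_conj]; exact (h y).norm_le ξ

theorem intervalIntegral_eq_integral_indicator {k f : ℝ → ℂ} {R : ℝ} (hR : 0 ≤ R) :
    ∫ y in (-R)..R, k y * f y = ∫ y, k y * (Set.Ioc (-R) R).indicator f y := by
  rw [intervalIntegral.integral_of_le (by linarith), ← integral_indicator measurableSet_Ioc]
  refine integral_congr_ae (Eventually.of_forall fun y => ?_)
  simp only [Set.indicator_apply]
  split_ifs <;> simp

/-- The truncated integral minus the full one is the transform of the truncation error, so the `L²`
bound applied to that error gives convergence, first on the line and then on the half line. -/
theorem isModeTransform_parityAnalysis {ε : ℂ} (hε : ε = 1 ∨ ε = -1) {f : ℝ → ℂ}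
    (h1 : Integrable f) (h2 : MemLp f 2 volume) :
    IsModeTransform (D.parityMode ε) (Set.Ioi 0) f (D.parityAnalysis ε f) := by
  refine ⟨(memLp_parityAnalysis hε h1 h2).restrict _, ?_⟩
  have h3 := ENNReal.Tendsto.const_mul (a := 2) (tendsto_eLpNorm_indicator_sub h2) (Or.inr (by simp))
  rw [mul_zero] at h3
  refine tendsto_of_tendsto_of_tendsto_of_le_of_le' tendsto_const_nhds h3
    (Eventually.of_forall fun _ => zero_le) ?_
  filter_upwards [eventually_ge_atTop 0] with R hR
  have hi : Integrable ((Set.Ioc (-R) R).indicator f) := h1.indicator measurableSet_Ioc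
  have e : (fun ξ => (∫ y in (-R)..R, conj (D.parityMode ε y ξ) * f y) - D.parityAnalysis ε f ξ)
      = D.parityAnalysis ε fun x => (Set.Ioc (-R) R).indicator f x - f x := by
    ext ξ
    rw [intervalIntegral_eq_integral_indicator hR, parityAnalysis, parityAnalysis,
      ← integral_sub (integrable_conj_parityMode_mul hε hi ξ)
        (integrable_conj_parityMode_mul hε h1 ξ)]
    simp_rw [mul_sub]
  rw [e]
  exact (eLpNorm_restrict_le _ _ _ _).trans (eLpNorm_parityAnalysis_le hε (hi.sub h1)
    ((h2.indicator measurableSet_Ioc).sub h2))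

theorem synthesis_indicator_eq (F : ℝ → ℂ) {R : ℝ} (hR : 0 ≤ R) (x : ℝ) :
    D.synthesis ((Set.Ioc (-R) R).indicator F) x = ∫ ξ in (-R)..R, F ξ * D.dispersive 0 x ξ := by
  rw [synthesis]
  have := intervalIntegral_eq_integral_indicator (k := D.dispersive 0 x) (f := F) hR
  simp_rw [mul_comm _ (D.dispersive 0 x _)]
  exact this.symm

/-- A superposition with amplitudes of parity `ε` is one of modes of parity `ε`. -/
theorem synthesis_indicator_parity_eq {ε : ℂ} {P : ℝ → ℂ} (hP : Continuous P)
    (hPε : ∀ ξ, P (-ξ) = ε * P ξ) {R : ℝ} (hR : 0 ≤ R) (x : ℝ) :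
    D.synthesis ((Set.Ioc (-R) R).indicator fun ξ => ((Real.sqrt 2)⁻¹ : ℝ) * P ξ) x
      = ∫ ξ in (0 : ℝ)..R, P ξ * D.parityMode ε x ξ := by
  rw [synthesis_indicator_eq _ hR]
  have hd := D.continuous_dispersive_zero_right x
  have hc : Continuous fun ξ => (((Real.sqrt 2)⁻¹ : ℝ) : ℂ) * P ξ * D.dispersive 0 x ξ :=
    (continuous_const.mul hP).mul hd
  have hc' : Continuous fun ξ => (((Real.sqrt 2)⁻¹ : ℝ) : ℂ) * P (-ξ) * D.dispersive 0 x (-ξ) :=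
    hc.comp continuous_neg
  rw [← intervalIntegral.integral_add_adjacent_intervals (hc.intervalIntegrable (-R) 0)
    (hc.intervalIntegrable 0 R)]
  -- The negative half of the spectrum is reflected onto the positive half; parity of the amplitude
  -- then combines `Ψ_d(x, ξ)` and `Ψ_d(x, -ξ)` into the parity mode.
  have e := intervalIntegral.integral_comp_neg (a := 0) (b := R)
    (fun ξ => (((Real.sqrt 2)⁻¹ : ℝ) : ℂ) * P ξ * D.dispersive 0 x ξ)
  rw [neg_zero] at e
  rw [← e, ← intervalIntegral.integral_add (hc'.intervalIntegrable 0 R) (hc.intervalIntegrable 0 R)]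
  refine intervalIntegral.integral_congr fun ξ _ => ?_
  simp only [hPε, parityMode]
  ring

theorem IsSynthesis.isL2Limit_parity {ε : ℂ} {P g : ℝ → ℂ}
    (hg : D.IsSynthesis (fun ξ => ((Real.sqrt 2)⁻¹ : ℝ) * P ξ) g) (hP : Continuous P)
    (hPε : ∀ ξ, P (-ξ) = ε * P ξ) :
    IsL2Limit volume (fun R x => ∫ ξ in (0 : ℝ)..R, P ξ * D.parityMode ε x ξ) g := by
  refine ⟨hg.1, hg.2.congr' ?_⟩
  filter_upwards [eventually_ge_atTop 0] with R hR
  simp_rw [synthesis_indicator_parity_eq hP hPε hR]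

theorem IsSynthesis.isModeTransform {F g : ℝ → ℂ} (hg : D.IsSynthesis F g)
    (hF : MemLp F 2 volume) : IsModeTransform (D.dispersive 0) Set.univ g F := by
  refine ⟨hF.restrict _, ?_⟩
  rw [Measure.restrict_univ]
  refine (hg.tendsto_analysis hF).congr' ?_
  filter_upwards [eventually_ge_atTop 0] with R hR
  simp_rw [intervalIntegral_eq_integral_indicator hR]
  rfl

theorem memLp_schrodingerPhase_mul (t : ℝ) {F : ℝ → ℂ} (hF : MemLp F 2 volume) :
    MemLp (fun ξ => schrodingerPhase t ξ * F ξ) 2 volume :=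
  hF.continuous_bounded_mul (continuous_schrodingerPhase t) fun ξ => (norm_schrodingerPhase t ξ).le

/-- A superposition of dispersive modes is orthogonal to both bound states and has its amplitude as
transform, so the evolution acts purely by the phase in `ξ`. -/
theorem IsSynthesis.isFloquetEvolution (β t : ℝ) {F g u : ℝ → ℂ} (hg : D.IsSynthesis F g)
    (hF : MemLp F 2 volume) (hu : D.IsSynthesis (fun ξ => schrodingerPhase t ξ * F ξ) u) :
    D.IsFloquetEvolution β t g u := by
  obtain ⟨κ₁, κ₂, hκ⟩ := D.exists_boundEven_eq
  obtain ⟨μ₁, μ₂, hμ⟩ := D.exists_boundOdd_eq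
  have b1 : l2Inner (D.boundEven 0) g = 0 := by
    rw [hκ]; exact hg.integral_conj_boundWave_mul hF κ₁ κ₂
  have b2 : l2Inner (D.boundOdd 0) g = 0 := by
    rw [hμ]; exact hg.integral_conj_boundWave_mul hF μ₁ μ₂
  refine ⟨F, hg.isModeTransform hF, hu.1, hu.2.congr' ?_⟩
  filter_upwards [eventually_ge_atTop 0] with R hR
  simp_rw [synthesis_indicator_eq _ hR, b1, b2, zero_mul, add_zero, mul_zero, zero_add]
  rfl

/-! ### Kernel bounds and weighted decay -/

/-- A pointwise bound on the truncated kernel of the evolution in the modes of parity `ε`. -/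
def KernelBound (D : TwoSolitonData) (ε : ℂ) (n : ℕ) (M : ℝ) : Prop :=
  ∀ x y t δ R : ℝ, 0 < δ → δ ≤ 1 → |t| = (δ ^ 2)⁻¹ → δ⁻¹ ≤ R →
    ‖∫ ξ in (0 : ℝ)..R, schrodingerPhase t ξ * (D.parityMode ε x ξ * conj (D.parityMode ε y ξ))‖
      ≤ M * (japaneseBracket x ^ 2 * japaneseBracket y ^ 2) * δ ^ n

/-- Converts the derivative scale of the product of two modes into the weights: each of `1`, `T`,
`|x|`, `|y|` is at most a multiple of `⟨x⟩⟨y⟩`, and `1 + 2T + 2 + 2 = 5 + 2T`. -/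
theorem sq_one_add_le {T : ℝ} (hT : 0 < T) (x y : ℝ) :
    (1 + ((T + 2 * |x|) + (T + 2 * |y|))) ^ 2
      ≤ (5 + 2 * T) ^ 2 * (japaneseBracket x ^ 2 * japaneseBracket y ^ 2) := by
  rw [← mul_pow, ← mul_pow]
  have hx := one_le_japaneseBracket x
  have hy := one_le_japaneseBracket y
  have hx' := abs_le_japaneseBracket x
  have hy' := abs_le_japaneseBracket y
  have h1 : japaneseBracket x ≤ japaneseBracket x * japaneseBracket y :=
    le_mul_of_one_le_right (by linarith) hy
  have h2 : japaneseBracket y ≤ japaneseBracket x * japaneseBracket y :=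
    le_mul_of_one_le_left (by linarith) hx
  have h3 : 1 ≤ japaneseBracket x * japaneseBracket y := hx.trans h1
  have h4 := le_mul_of_one_le_right hT.le h3
  gcongr
  linarith

variable (D) in
theorem exists_kernelBound_even : ∃ M, 0 < M ∧ D.KernelBound 1 1 M := by
  obtain ⟨C, T, hC, hT, h⟩ := D.exists_boundedJet_parityMode (ε := 1) (by simp)
  refine ⟨3 * ((C * C) * (5 + 2 * T) ^ 2), by positivity, fun x y t δ R hδ hδ1 ht hR => ?_⟩
  have j := (h x).mul (h y).star (by positivity)
  refine (j.norm_integral_schrodingerPhase_mul_le (by positivity) hδ hδ1 ht hR).trans ?_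
  rw [pow_one]
  have := mul_le_mul_of_nonneg_left (sq_one_add_le hT x y) (mul_pos hC hC).le
  refine mul_le_mul_of_nonneg_right ?_ hδ.le
  linarith

-- The mode with `ε = -1` is a difference of values at `ξ` and `-ξ`, so both factors of the kernel
-- vanish at `ξ = 0` and their product has a double zero there. This is the source of the faster
-- rate.
variable (D) in
theorem exists_kernelBound_odd : ∃ M, 0 < M ∧ D.KernelBound (-1) 3 M := by
  obtain ⟨C, T, hC, hT, h⟩ := D.exists_boundedJet_parityMode (ε := -1) (by simp)
  refine ⟨3 * ((C * C) * (5 + 2 * T) ^ 2), by positivity, fun x y t δ R hδ hδ1 ht hR => ?_⟩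
  have j := (h x).mul (h y).star (by positivity)
  have hz : ∀ x, D.parityMode (-1) x 0 = 0 := fun x => by simp [parityMode]
  have hd : deriv (fun ξ => D.parityMode (-1) x ξ * conj (D.parityMode (-1) y ξ)) 0 = 0 := by
    obtain ⟨f', -, hf, -⟩ := h x
    obtain ⟨g', -, hg, -⟩ := (h y).star
    have := ((hf 0).fun_mul (hg 0)).deriv
    rw [this, hz, hz]; simp
  refine (j.norm_integral_schrodingerPhase_mul_le_of_vanish (by positivity) (by simp [hz]) hd hδ
    hδ1 ht hR).trans ?_
  have := mul_le_mul_of_nonneg_left (sq_one_add_le hT x y) (mul_pos hC hC).le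
  refine mul_le_mul_of_nonneg_right ?_ (by positivity)
  linarith

/-- Fubini on the bounded spectral interval turns the truncated evolution into an integral operator
with the estimated kernel. -/
theorem KernelBound.norm_integral_le {ε : ℂ} (hε : ε = 1 ∨ ε = -1) {n : ℕ} {M : ℝ}
    (hK : D.KernelBound ε n M) {f : ℝ → ℂ} (hf : Integrable f)
    (hf2 : Integrable fun y => japaneseBracket y ^ 2 * ‖f y‖) {t δ R : ℝ} (hδ : 0 < δ) (hδ1 : δ ≤ 1)
    (ht : |t| = (δ ^ 2)⁻¹) (hR : δ⁻¹ ≤ R) (x : ℝ) :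
    ‖∫ ξ in (0 : ℝ)..R, (schrodingerPhase t ξ * D.parityAnalysis ε f ξ) * D.parityMode ε x ξ‖
      ≤ M * δ ^ n * (∫ y, japaneseBracket y ^ 2 * ‖f y‖) * japaneseBracket x ^ 2 := by
  obtain ⟨C, T, hC, -, h⟩ := D.exists_boundedJet_parityMode (norm_parity_eq_one hε)
  have e : ∀ ξ, (schrodingerPhase t ξ * D.parityAnalysis ε f ξ) * D.parityMode ε x ξ
      = ∫ y, f y * (schrodingerPhase t ξ * (D.parityMode ε x ξ * conj (D.parityMode ε y ξ))) :=
    fun ξ => by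
      rw [parityAnalysis, ← integral_const_mul, ← integral_mul_const]
      congr 1; ext y; ring
  simp_rw [e]
  rw [intervalIntegral_integral_swap]
  · simp_rw [intervalIntegral.integral_const_mul]
    have hb : ∀ y, ‖f y * ∫ ξ in (0 : ℝ)..R,
        schrodingerPhase t ξ * (D.parityMode ε x ξ * conj (D.parityMode ε y ξ))‖
        ≤ (M * δ ^ n * japaneseBracket x ^ 2) * (japaneseBracket y ^ 2 * ‖f y‖) := fun y => by
      rw [norm_mul]
      refine (mul_le_mul_of_nonneg_left (hK x y t δ R hδ hδ1 ht hR) (norm_nonneg _)).trans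
        (le_of_eq ?_)
      ring
    refine (norm_integral_le_of_norm_le (hf2.const_mul _) (Eventually.of_forall hb)).trans
      (le_of_eq ?_)
    rw [integral_const_mul]
    ring
  · have h1 : Integrable (fun _ : ℝ => (1 : ℂ)) (volume.restrict (Set.uIoc 0 R)) :=
      continuous_const.integrableOn_uIcc.mono_set Set.uIoc_subset_uIcc
    have c1 := (D.continuous_parityMode ε).comp
      (continuous_snd.prodMk continuous_fst : Continuous fun p : ℝ × ℝ => (p.2, p.1))
    have c2 := (continuous_parityMode_right (D := D) ε x).comp
      (continuous_fst : Continuous fun p : ℝ × ℝ => p.1)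
    have c3 := (continuous_schrodingerPhase t).comp
      (continuous_fst : Continuous fun p : ℝ × ℝ => p.1)
    simp only [Function.comp_def] at c1 c2 c3
    have h2 : Continuous fun p : ℝ × ℝ =>
        schrodingerPhase t p.1 * (D.parityMode ε x p.1 * conj (D.parityMode ε p.2 p.1)) :=
      c3.mul (c2.mul (Complex.continuous_conj.comp c1))
    have h3 := (h1.mul_prod hf).mul_bdd (c := C * C) h2.aestronglyMeasurable
      (Eventually.of_forall fun p => by
        rw [norm_mul, norm_schrodingerPhase, one_mul, norm_mul, Complex.norm_conj]
        exact mul_le_mul ((h x).norm_le _) ((h _).norm_le _) (norm_nonneg _) hC.le)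
    refine h3.congr (Eventually.of_forall fun p => ?_)
    simp [Function.uncurry]

/-- Weighted decay of the evolution of a superposition of modes of parity `ε`. -/
theorem exists_weighted_decay {ε : ℂ} (hε : ε = 1 ∨ ε = -1) {n : ℕ} {M : ℝ} (hM : 0 < M)
    (hK : D.KernelBound ε n M) {σ : ℝ} (hσ : 5 / 2 < σ) : ∃ C : ℝ, 0 < C ∧ ∀ f : ℝ → ℂ,
      Integrable f → MemLp f 2 volume → MemLp (weighted σ f) 2 volume → ∀ t u,
      D.IsSynthesis (fun ξ => ((Real.sqrt 2)⁻¹ : ℝ)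
        * (schrodingerPhase t ξ * D.parityAnalysis ε f ξ)) u →
      eLpNorm (weighted (-σ) u) 2 volume
        ≤ ENNReal.ofReal (C * japaneseBracket t ^ (-((n : ℝ) / 2)))
          * eLpNorm (weighted σ f) 2 volume := by
  obtain ⟨K, hK0, hKf⟩ := exists_integral_sq_japaneseBracket_mul_le hσ
  have hw := memLp_japaneseBracket_rpow (s := 2 - σ) (by linarith)
  set N := (eLpNorm (fun x => japaneseBracket x ^ (2 - σ)) 2 volume).toReal with hN
  have hN0 : 0 ≤ N := ENNReal.toReal_nonneg
  have h2n : (0 : ℝ) < 2 ^ ((n : ℝ) / 2) := by positivity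
  -- The summand `2` covers `|t| ≤ 1` by the `L²` bound of the transform, and `M K N` covers `|t| ≥
  -- 1` by the kernel. The power of `2` passes to `⟨t⟩`, as `⟨t⟩ ≤ 2` in the first case and `⟨t⟩ ≤
  -- 2|t|` in the second.
  refine ⟨(2 + M * K * N) * 2 ^ ((n : ℝ) / 2), by positivity, fun f f1 f2 fw t u hu => ?_⟩
  have hP2 : MemLp (fun ξ => schrodingerPhase t ξ * D.parityAnalysis ε f ξ) 2 volume :=
    memLp_schrodingerPhase_mul t (memLp_parityAnalysis hε f1 f2)
  have hB : 0 < japaneseBracket t := japaneseBracket_pos t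
  rcases le_total |t| 1 with ht | ht
  · have hs : ‖(((Real.sqrt 2)⁻¹ : ℝ) : ℂ)‖ ≤ 1 := by
      rw [Complex.norm_real, Real.norm_of_nonneg (by positivity)]
      exact inv_le_one_of_one_le₀ (Real.one_le_sqrt.2 (by norm_num))
    have hc : 2 ≤ (2 + M * K * N) * 2 ^ ((n : ℝ) / 2) * japaneseBracket t ^ (-((n : ℝ) / 2)) := by
      have h1 : japaneseBracket t ≤ 2 := by
        rw [japaneseBracket, Real.sqrt_le_left (by norm_num)]
        have := (sq_le_one_iff_abs_le_one t).2 ht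
        linarith
      have h3 : (1 : ℝ) ≤ 2 ^ ((n : ℝ) / 2) * japaneseBracket t ^ (-((n : ℝ) / 2)) := by
        rw [Real.rpow_neg hB.le, ← div_eq_mul_inv, one_le_div (Real.rpow_pos_of_pos hB _)]
        exact Real.rpow_le_rpow hB.le h1 (by positivity)
      have h4 : 0 ≤ M * K * N := by positivity
      rw [mul_assoc]
      nlinarith
    calc eLpNorm (weighted (-σ) u) 2 volume ≤ eLpNorm u 2 volume :=
          eLpNorm_weighted_le (by linarith) u
      _ ≤ _ := hu.eLpNorm_le (hP2.const_mul _)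
      _ ≤ eLpNorm (D.parityAnalysis ε f) 2 volume := by
          refine eLpNorm_mono fun ξ => ?_
          rw [norm_mul, norm_mul, norm_schrodingerPhase, one_mul]
          exact mul_le_of_le_one_left (norm_nonneg _) hs
      _ ≤ 2 * eLpNorm f 2 volume := eLpNorm_parityAnalysis_le hε f1 f2
      _ ≤ _ := by
          refine mul_le_mul' ?_ (eLpNorm_le_weighted (by linarith) f)
          rw [← ENNReal.ofReal_ofNat]
          exact ENNReal.ofReal_le_ofReal hc
  · have ht0 : 0 < |t| := by linarith
    set δ := (Real.sqrt |t|)⁻¹ with hδ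
    have hδ0 : 0 < δ := inv_pos.2 (Real.sqrt_pos.2 ht0)
    have hδ1 : δ ≤ 1 := inv_le_one_of_one_le₀ (Real.one_le_sqrt.2 ht)
    have htδ : |t| = (δ ^ 2)⁻¹ := by
      rw [hδ, inv_pow, inv_inv, Real.sq_sqrt ht0.le]
    obtain ⟨fi, fb⟩ := hKf f fw
    set E := (eLpNorm (weighted σ f) 2 volume).toReal with hE
    have hE0 : 0 ≤ E := ENNReal.toReal_nonneg
    have hPc : Continuous fun ξ => schrodingerPhase t ξ * D.parityAnalysis ε f ξ :=
      (continuous_schrodingerPhase t).mul (continuous_parityAnalysis ε f1)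
    have hPε : ∀ ξ, schrodingerPhase t (-ξ) * D.parityAnalysis ε f (-ξ)
        = ε * (schrodingerPhase t ξ * D.parityAnalysis ε f ξ) := fun ξ => by
      rw [schrodingerPhase_neg, parityAnalysis_neg hε f1]; ring
    have hlim := hu.isL2Limit_parity hPc hPε
    set S : ℝ → ℝ → ℂ := fun R x => ∫ ξ in (0 : ℝ)..R,
      (schrodingerPhase t ξ * D.parityAnalysis ε f ξ) * D.parityMode ε x ξ with hS
    have hSb : ∀ R, δ⁻¹ ≤ R → eLpNorm (weighted (-σ) (S R)) 2 volume
        ≤ ENNReal.ofReal (M * δ ^ n * (K * E) * N) := fun R hR => by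
      have hpt : ∀ x, ‖weighted (-σ) (S R) x‖
          ≤ M * δ ^ n * (K * E) * ‖japaneseBracket x ^ (2 - σ)‖ := fun x => by
        have h1 := hK.norm_integral_le hε f1 fi hδ0 hδ1 htδ hR x
        have hx := japaneseBracket_pos x
        rw [norm_weighted, Real.norm_of_nonneg (Real.rpow_nonneg hx.le _)]
        have h2 : japaneseBracket x ^ (2 - σ)
            = japaneseBracket x ^ (-σ) * japaneseBracket x ^ 2 := by
          rw [← Real.rpow_natCast, ← Real.rpow_add hx]; congr 1; push_cast; ring
        have h3 : 0 ≤ japaneseBracket x ^ (-σ) := Real.rpow_nonneg hx.le _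
        rw [h2]
        calc _ ≤ japaneseBracket x ^ (-σ) * (M * δ ^ n *
              (∫ y, japaneseBracket y ^ 2 * ‖f y‖) * japaneseBracket x ^ 2) :=
              mul_le_mul_of_nonneg_left h1 h3
          _ ≤ japaneseBracket x ^ (-σ) * (M * δ ^ n * (K * E) * japaneseBracket x ^ 2) := by
              gcongr
          _ = _ := by ring
      refine (eLpNorm_le_mul_eLpNorm_of_ae_le_mul (Eventually.of_forall hpt) 2).trans (le_of_eq ?_)
      rw [ENNReal.ofReal_mul (p := M * δ ^ n * (K * E)) (by positivity), hN,
        ENNReal.ofReal_toReal hw.2.ne]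
    have hcont : ∀ R, 0 ≤ R → AEStronglyMeasurable (S R) volume := fun R hR => by
      have e : S R = D.synthesis ((Set.Ioc (-R) R).indicator fun ξ => ((Real.sqrt 2)⁻¹ : ℝ)
          * (schrodingerPhase t ξ * D.parityAnalysis ε f ξ)) := funext fun x =>
        (synthesis_indicator_parity_eq hPc hPε hR x).symm
      rw [e]
      exact (memLp_synthesis ((hP2.const_mul _).isBandLimited_indicator R)).1
    have hmw : ∀ v : ℝ → ℂ, AEStronglyMeasurable v volume →
        AEStronglyMeasurable (weighted (-σ) v) volume := fun v hv =>
      (Complex.continuous_ofReal.comp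
        (continuous_japaneseBracket_rpow (-σ))).aestronglyMeasurable.mul hv
    -- The truncated bound is uniform in `R ≥ δ⁻¹`, and the weight `⟨x⟩^{-σ} ≤ 1` keeps the `L²`
    -- convergence of the truncations, so the bound passes to the limit `u`.
    have hall : ∀ᶠ R in atTop, eLpNorm (weighted (-σ) u) 2 volume
        ≤ ENNReal.ofReal (M * δ ^ n * (K * E) * N)
          + eLpNorm (fun x => S R x - u x) 2 volume := by
      filter_upwards [eventually_ge_atTop δ⁻¹] with R hR
      have hR0 : 0 ≤ R := (inv_pos.2 hδ0).le.trans hR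
      have hS1 := hcont R hR0
      have e : weighted (-σ) u = weighted (-σ) (S R) - weighted (-σ) (fun x => S R x - u x) := by
        ext x; simp only [weighted, Pi.sub_apply]; ring
      rw [e]
      refine (eLpNorm_sub_le (hmw _ hS1) (hmw _ (hS1.sub hu.1.1)) (by norm_num)).trans ?_
      exact add_le_add (hSb R hR) (eLpNorm_weighted_le (by linarith) _)
    have hl := (tendsto_const_nhds (x := ENNReal.ofReal (M * δ ^ n * (K * E) * N))).add hlim.2
    rw [add_zero] at hl
    refine (ge_of_tendsto hl hall).trans ?_
    have hδn : δ ^ n ≤ 2 ^ ((n : ℝ) / 2) * japaneseBracket t ^ (-((n : ℝ) / 2)) := by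
      have h1 : japaneseBracket t ≤ 2 * |t| := by
        rw [japaneseBracket, Real.sqrt_le_left (by positivity), mul_pow, sq_abs]
        have : 1 ≤ t ^ 2 := by rw [← sq_abs]; exact one_le_pow₀ ht
        linarith
      have h2 : δ ^ n = (|t| ^ ((n : ℝ) / 2))⁻¹ := by
        rw [hδ, inv_pow, Real.sqrt_eq_rpow, ← Real.rpow_natCast, ← Real.rpow_mul ht0.le]
        congr 2; ring
      rw [h2, Real.rpow_neg hB.le, ← div_eq_mul_inv, inv_eq_one_div,
        div_le_div_iff₀ (Real.rpow_pos_of_pos ht0 _) (Real.rpow_pos_of_pos hB _), one_mul,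
        ← Real.mul_rpow (by norm_num) ht0.le]
      exact Real.rpow_le_rpow hB.le h1 (by positivity)
    have hB' : 0 ≤ japaneseBracket t ^ (-((n : ℝ) / 2)) := Real.rpow_nonneg hB.le _
    rw [← ENNReal.ofReal_toReal fw.2.ne, ← hE, ← ENNReal.ofReal_mul (by positivity)]
    refine ENNReal.ofReal_le_ofReal ?_
    calc M * δ ^ n * (K * E) * N = (M * K * N) * δ ^ n * E := by ring
      _ ≤ (2 + M * K * N) * (2 ^ ((n : ℝ) / 2) * japaneseBracket t ^ (-((n : ℝ) / 2))) * E := by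
          gcongr
          linarith
      _ = _ := by ring

/-- Weighted decay in the subspace of parity `ε` of the continuous spectral subspace. -/
theorem exists_parity_decay {ε : ℂ} (hε : ε = 1 ∨ ε = -1) {n : ℕ} {M : ℝ} (hM : 0 < M)
    (hK : D.KernelBound ε n M) (β : ℝ) {σ : ℝ} (hσ : 5 / 2 < σ) : ∃ C : ℝ, 0 < C ∧ ∀ f : ℝ → ℂ,
      MemLp f 2 volume → MemLp (weighted σ f) 2 volume →
      ∃ g : ℝ → ℂ, (∃ F : ℝ → ℂ, IsModeTransform (D.parityMode ε) (Set.Ioi 0) f F ∧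
        IsL2Limit volume (fun R x => ∫ ξ in (0 : ℝ)..R, F ξ * D.parityMode ε x ξ) g) ∧
        ∀ t : ℝ, ∃ u : ℝ → ℂ, D.IsFloquetEvolution β t g u ∧
          eLpNorm (weighted (-σ) u) 2 volume
            ≤ ENNReal.ofReal (C * japaneseBracket t ^ (-((n : ℝ) / 2)))
              * eLpNorm (weighted σ f) 2 volume := by
  obtain ⟨C, hC, h⟩ := exists_weighted_decay hε hM hK hσ
  refine ⟨C, hC, fun f f2 fw => ?_⟩
  obtain ⟨K, -, hKf⟩ := exists_integral_sq_japaneseBracket_mul_le hσ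
  -- The weighted hypothesis puts `f` in `L¹`, so the transform is an absolutely convergent integral
  -- and a continuous function.
  have f1 : Integrable f := (hKf f fw).1.mono' f2.1 (Eventually.of_forall fun y =>
    le_mul_of_one_le_left (norm_nonneg _) (one_le_pow₀ (one_le_japaneseBracket y)))
  have hF := memLp_parityAnalysis (D := D) hε f1 f2
  have hF' : MemLp (fun ξ => (((Real.sqrt 2)⁻¹ : ℝ) : ℂ) * D.parityAnalysis ε f ξ) 2 volume :=
    hF.const_mul _
  obtain ⟨g, hg⟩ := exists_isSynthesis (D := D) hF'
  refine ⟨g, ⟨_, isModeTransform_parityAnalysis hε f1 f2, hg.isL2Limit_parity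
    (continuous_parityAnalysis ε f1) (parityAnalysis_neg hε f1)⟩, fun t => ?_⟩
  obtain ⟨u, hu⟩ := exists_isSynthesis (D := D) (memLp_schrodingerPhase_mul t hF')
  refine ⟨u, hg.isFloquetEvolution β t hF' hu, h f f1 f2 fw t u ?_⟩
  simp_rw [mul_left_comm (schrodingerPhase t _)] at hu
  exact hu

end TwoSolitonData

/-! ### Both parities: kernel exponents `n = 1` and `n = 3` -/

theorem mainTheorem1 (D : TwoSolitonData) (β : ℝ) (hβ : D.IsFloquetExponent β)
    (σ : ℝ) (hσ : 5 / 2 < σ) :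
    (∃ C : ℝ, 0 < C ∧ ∀ f : ℝ → ℂ, MemLp f 2 volume → MemLp (weighted σ f) 2 volume →
      ∃ g : ℝ → ℂ, D.IsEvenContinuousProjection f g ∧
        ∀ t : ℝ, ∃ u : ℝ → ℂ, D.IsFloquetEvolution β t g u ∧
          eLpNorm (weighted (-σ) u) 2 volume
            ≤ ENNReal.ofReal (C * japaneseBracket t ^ (-(1 / 2) : ℝ))
              * eLpNorm (weighted σ f) 2 volume) ∧
    (∃ C : ℝ, 0 < C ∧ ∀ f : ℝ → ℂ, MemLp f 2 volume → MemLp (weighted σ f) 2 volume →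
      ∃ g : ℝ → ℂ, D.IsOddContinuousProjection f g ∧
        ∀ t : ℝ, ∃ u : ℝ → ℂ, D.IsFloquetEvolution β t g u ∧
          eLpNorm (weighted (-σ) u) 2 volume
            ≤ ENNReal.ofReal (C * japaneseBracket t ^ (-(3 / 2) : ℝ))
              * eLpNorm (weighted σ f) 2 volume) := by
  obtain ⟨M₁, hM₁, hK₁⟩ := D.exists_kernelBound_even
  obtain ⟨M₂, hM₂, hK₂⟩ := D.exists_kernelBound_odd
  have h₁ := TwoSolitonData.exists_parity_decay (Or.inl rfl) hM₁ hK₁ β hσ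
  have h₂ := TwoSolitonData.exists_parity_decay (Or.inr rfl) hM₂ hK₂ β hσ
  rw [← D.dispersiveEven_zero_eq] at h₁
  rw [← D.dispersiveOdd_zero_eq] at h₂
  rw [Nat.cast_one] at h₁
  rw [Nat.cast_ofNat] at h₂
  exact ⟨h₁, h₂⟩
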